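/- Let $k\ge 0$ and let $(M_i^{n_i},g_i)$, $0\le i\le k$, be smooth Riemannian manifolds (without boundary) with $n_i=\dim M_i\ge 2$ for all $0\le i\le k$. Let $M^n=\prod_{i=0}^k M_i^{n_i}$ be the Riemannian product, with the product metric $g=\sum_i g_i$ and $n=\sum_{i=0}^k n_i$, and let $f\colon M^n\to\mathbb{R}^{n+k}$ be a conformal immersion, i.e. a smooth map such that $\langle f_*X,f_*Y\rangle=\varphi^2\, g(X,Y)$ for all tangent vectors $X,Y$ and some smooth function $\varphi\colon M\to(0,\infty)$. Let $x=(x_0,\dots,x_k)\in M^n$. Suppose that - some plane in $T_{x_0}M_0$ (two-dimensional subspace) has vanishing sectional curvature, and - for each $1\le i\le k$, $M_i$ is not flat at $x_i$, i.e. some plane in $T_{x_i}M_i$ has non-zero sectional curvature. Then the second fundamental form $\alpha^f$ of $f$ is adapted to the product net of $M^n$ at $x$, that is, $\alpha^f(X_i,X_j)=0$ for all $X_i\in T_{x_i}M_i$ and $X_j\in T_{x_j}M_j$ with $i\neq j$. Here $T_{x_i}M_i$ is regarded as a subspace of $T_xM$, and $\alpha^f(X,Y)$ denotes the component of the derivative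 of $f_*Y$ in direction $X$ that is normal to $f_*T_xM$ in $\mathbb{R}^{n+k}$. -/

import Mathlib

open Set Bundle
open scoped Manifold ContDiff RealInnerProductSpace

noncomputable section

/-! ## Sectional curvature of a Riemannian manifold -/

section Curvature

variable {E : Type*} [NormedAddCommGroup E] [NormedSpace ℝ E]

/-- The Christoffel symbol `Γ(u, v)` at `y` of a metric `G` on an open subset of a vector space:
`2 G(Γ(u, v), w) = (D_u G)(v, w) + (D_v G)(u, w) - (D_w G)(u, v)` for all `w`. -/
def christoffel (G : E → E →L[ℝ] E →L[ℝ] ℝ) (y u v : E) : E :=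
  (G y).inverse ((1 / 2 : ℝ) •
    (fderiv ℝ G y u v + fderiv ℝ G y v u - ((fderiv ℝ G y).flip u).flip v))

/-- The curvature tensor `R(u, v) w = ∇_u ∇_v w - ∇_v ∇_u w` (`u`, `v`, `w` extended as constant
vector fields) of a metric `G` on an open subset of a vector space. -/
def chartCurvature (G : E → E →L[ℝ] E →L[ℝ] ℝ) (y u v w : E) : E :=
  fderiv ℝ (fun z ↦ christoffel G z v w) y u - fderiv ℝ (fun z ↦ christoffel G z u w) y v
    + christoffel G y u (christoffel G y v w) - christoffel G y v (christoffel G y u w)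

/-- Sectional curvature, for a metric `G` on an open subset of a vector space, of the plane spanned
by `u` and `v` at `y`. -/
def chartSectionalCurvature (G : E → E →L[ℝ] E →L[ℝ] ℝ) (y u v : E) : ℝ :=
  G y (chartCurvature G y u v v) u / (G y u u * G y v v - (G y u v) ^ 2)

variable {M : Type*} [TopologicalSpace M] [ChartedSpace E M] [IsManifold 𝓘(ℝ, E) ∞ M]

/-- The Riemannian metric `g` read in the preferred chart at `x`: the pull-back of `g` by the
inverse of the chart. -/
def metricInChart
    (g : ContMDiffRiemannianMetric 𝓘(ℝ, E) ∞ E (fun p : M ↦ TangentSpace 𝓘(ℝ, E) p)) (x : M) :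
    E → E →L[ℝ] E →L[ℝ] ℝ := fun y ↦
  let B : E →L[ℝ] E →L[ℝ] ℝ := g.inner ((extChartAt 𝓘(ℝ, E) x).symm y)
  let D : E →L[ℝ] E := mfderiv 𝓘(ℝ, E) 𝓘(ℝ, E) (extChartAt 𝓘(ℝ, E) x).symm y
  B.bilinearComp D D

theorem metricInChart_apply
    (g : ContMDiffRiemannianMetric 𝓘(ℝ, E) ∞ E (fun p : M ↦ TangentSpace 𝓘(ℝ, E) p)) (x : M)
    (y u v : E) :
    metricInChart g x y u v = g.inner ((extChartAt 𝓘(ℝ, E) x).symm y)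
      (mfderiv 𝓘(ℝ, E) 𝓘(ℝ, E) (extChartAt 𝓘(ℝ, E) x).symm y u)
      (mfderiv 𝓘(ℝ, E) 𝓘(ℝ, E) (extChartAt 𝓘(ℝ, E) x).symm y v) :=
  rfl

/-- The sectional curvature of `(M, g)` at `x` of the plane spanned by the linearly independent
tangent vectors `u` and `v`. -/
def sectionalCurvature
    (g : ContMDiffRiemannianMetric 𝓘(ℝ, E) ∞ E (fun p : M ↦ TangentSpace 𝓘(ℝ, E) p)) (x : M)
    (u v : TangentSpace 𝓘(ℝ, E) x) : ℝ :=
  chartSectionalCurvature (metricInChart g x) (extChartAt 𝓘(ℝ, E) x x)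
    (mfderiv 𝓘(ℝ, E) 𝓘(ℝ, E) (extChartAt 𝓘(ℝ, E) x) x u)
    (mfderiv 𝓘(ℝ, E) 𝓘(ℝ, E) (extChartAt 𝓘(ℝ, E) x) x v)

/-- `T_x M` contains a plane with vanishing sectional curvature. -/
def HasFlatPlaneAt
    (g : ContMDiffRiemannianMetric 𝓘(ℝ, E) ∞ E (fun p : M ↦ TangentSpace 𝓘(ℝ, E) p)) (x : M) :
    Prop :=
  ∃ u v : TangentSpace 𝓘(ℝ, E) x, LinearIndependent ℝ ![u, v] ∧ sectionalCurvature g x u v = 0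

/-- `(M, g)` is flat at the point `x`: all planes in `T_x M` have vanishing sectional curvature
(equivalently, the curvature tensor vanishes at `x`). -/
def IsFlatAt
    (g : ContMDiffRiemannianMetric 𝓘(ℝ, E) ∞ E (fun p : M ↦ TangentSpace 𝓘(ℝ, E) p)) (x : M) :
    Prop :=
  ∀ u v : TangentSpace 𝓘(ℝ, E) x, LinearIndependent ℝ ![u, v] → sectionalCurvature g x u v = 0

end Curvature

/-! ## Second fundamental form of an immersion into Euclidean space -/

section SecondFundamentalForm

variable {E H M F : Type*} [NormedAddCommGroup E] [NormedSpace ℝ E]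
  [TopologicalSpace H] (I : ModelWithCorners ℝ E H) [TopologicalSpace M] [ChartedSpace H M]
  [NormedAddCommGroup F] [InnerProductSpace ℝ F] [FiniteDimensional ℝ F]

/-- The tangent space `f_* T_x M` of the immersion `f : M → F` at `x`, as a subspace of `F`. -/
def tangentImage (f : M → F) (x : M) : Submodule ℝ F :=
  LinearMap.range (mfderiv I 𝓘(ℝ, F) f x : E →L[ℝ] F).toLinearMap

/-- The second fundamental form `α^f (X, Y) ∈ (f_* T_x M)ᗮ` at `x` of an immersion `f` of a
manifold (without boundary) into the Euclidean space `F`: the normal component of the derivative of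
`f_* Y` in direction `X`. Here `Y` is extended to be constant in the preferred chart at `x`; another
extension changes the derivative by a tangent vector only. -/
def secondFundamentalForm (f : M → F) (x : M) (X Y : TangentSpace I x) : F :=
  (tangentImage I f x)ᗮ.starProjection
    (fderiv ℝ (fderiv ℝ (f ∘ (extChartAt I x).symm)) (extChartAt I x x)
      (mfderiv I 𝓘(ℝ, E) (extChartAt I x) x X) (mfderiv I 𝓘(ℝ, E) (extChartAt I x) x Y))

end SecondFundamentalForm

/-! ## Riemannian products and their conformal immersions -/

section Product

variable {ι : Type*} [Fintype ι] {n : ι → ℕ} {M : ι → Type*} [∀ i, TopologicalSpace (M i)]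
  [∀ i, ChartedSpace (EuclideanSpace ℝ (Fin (n i))) (M i)]

/-- The model of the product manifold `∏ i, M i`, where `M i` has dimension `n i`. -/
abbrev productModel (n : ι → ℕ) :
    ModelWithCorners ℝ (∀ i, EuclideanSpace ℝ (Fin (n i)))
      (ModelPi fun i ↦ EuclideanSpace ℝ (Fin (n i))) :=
  ModelWithCorners.pi fun i ↦ 𝓘(ℝ, EuclideanSpace ℝ (Fin (n i)))

/-- The component in `T_{x i} (M i)` of a vector tangent to the product at `x`. -/
def tangentComponent (x : ∀ i, M i) (X : TangentSpace (productModel n) x) (i : ι) :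
    TangentSpace 𝓘(ℝ, EuclideanSpace ℝ (Fin (n i))) (x i) :=
  (X : ∀ i, EuclideanSpace ℝ (Fin (n i))) i

/-- The product metric `∑ i, g i` at the point `x`. -/
def productInner [∀ i, IsManifold 𝓘(ℝ, EuclideanSpace ℝ (Fin (n i))) ∞ (M i)]
    (g : ∀ i, ContMDiffRiemannianMetric 𝓘(ℝ, EuclideanSpace ℝ (Fin (n i))) ∞
      (EuclideanSpace ℝ (Fin (n i)))
      (fun p : M i ↦ TangentSpace 𝓘(ℝ, EuclideanSpace ℝ (Fin (n i))) p))
    (x : ∀ i, M i) (X Y : TangentSpace (productModel n) x) : ℝ :=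
  ∑ i, (g i).inner (x i) (tangentComponent x X i) (tangentComponent x Y i)

/-- `f` is a (smooth) conformal immersion of the Riemannian product of the `(M i, g i)` into the
Euclidean space `ℝ^N`: the metric induced by `f` is `φ ^ 2` times the product metric for a smooth
positive function `φ`. (In particular the differential of `f` is injective at each point.) -/
def IsConformalImmersion [∀ i, IsManifold 𝓘(ℝ, EuclideanSpace ℝ (Fin (n i))) ∞ (M i)]
    (g : ∀ i, ContMDiffRiemannianMetric 𝓘(ℝ, EuclideanSpace ℝ (Fin (n i))) ∞
      (EuclideanSpace ℝ (Fin (n i)))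
      (fun p : M i ↦ TangentSpace 𝓘(ℝ, EuclideanSpace ℝ (Fin (n i))) p))
    {N : ℕ} (f : (∀ i, M i) → EuclideanSpace ℝ (Fin N)) : Prop :=
  ContMDiff (productModel n) 𝓘(ℝ, EuclideanSpace ℝ (Fin N)) ∞ f ∧
    ∃ φ : (∀ i, M i) → ℝ, ContMDiff (productModel n) 𝓘(ℝ, ℝ) ∞ φ ∧ (∀ x, 0 < φ x) ∧
      ∀ (x : ∀ i, M i) (X Y : TangentSpace (productModel n) x),
        ⟪(mfderiv (productModel n) 𝓘(ℝ, EuclideanSpace ℝ (Fin N)) f x X :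
            EuclideanSpace ℝ (Fin N)),
          mfderiv (productModel n) 𝓘(ℝ, EuclideanSpace ℝ (Fin N)) f x Y⟫ =
        φ x ^ 2 * productInner g x X Y

/-- The second fundamental form of `f` is adapted to the product net at `x`: `α^f (X, Y) = 0`
whenever `X` is tangent to the factor `M i` and `Y` is tangent to the factor `M j` with `i ≠ j`
(a vector is tangent to `M i` if its components in the other factors vanish). -/
def IsAdaptedAt {N : ℕ} (f : (∀ i, M i) → EuclideanSpace ℝ (Fin N)) (x : ∀ i, M i) : Prop :=
  ∀ i j : ι, i ≠ j → ∀ X Y : TangentSpace (productModel n) x,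
    (∀ l, l ≠ i → tangentComponent x X l = 0) → (∀ l, l ≠ j → tangentComponent x Y l = 0) →
      secondFundamentalForm (productModel n) f x X Y = 0

end Product

end

/-! ## Flat bilinear maps -/

section FlatBilinear

open Module

variable {L V W : Type*} [AddCommGroup L] [Module ℝ L] [AddCommGroup V] [Module ℝ V]

/-! The problem is reduced to linear algebra by a lift to the light cone. With `l = φ⁻¹`, the map `Φ
= (l f, l, -l ⟪f, f⟫ / 2)` is an isometric immersion of the product into the null cone of a
Lorentzian space of dimension `n + k + 2`. Its normal space `W` at a point is Lorentzian of
dimension `k + 2` and contains the null vector `F = -Φ`. The second fundamental form `α` of `Φ`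
satisfies `Q (α X Y) F = ⟪X, Y⟫` and the Gauss equation with the curvature of the product. If `α`
vanishes on vectors of distinct factors, so do the second derivatives of `Φ`, because the product
connection has no mixed terms. Comparing components of `Φ` then shows that the mixed second
derivatives of `f` are tangent.

For the linear algebra, take a flat plane `Y` in the factor `0` and, in each other factor, a plane
with orthonormal basis `u i, v i` and curvature `K i ≠ 0`. Let `V` be the sum of these planes and
`Z` the sum of `Y` and of the lines `ℝ u i`. The curvature of two vectors of `Z` vanishes, so `α`
restricted to `Z × V` is a flat bilinear map. The kernel of a regular element then gives two cases
(`IsFrameForm.normal_or_null`): either `α` vanishes on `Z` times the `v i`, or `α(Z, V)` is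
orthogonal to a null vector `ζ` with `Q ζ F = 1`. In the second case a nullity estimate in the
definite space orthogonal to `F` and `ζ` shows that `α` is diagonal on `Z`, or that some `u i` is
umbilic in `Z` with value `ζ` (`IsFrameForm.umbilic_or_diagonal`).

These alternatives depend on the bases of the planes. Rotating the planes by angles `θ i` makes each
of the finitely many alternatives a system of analytic equations in `θ`; by Baire's theorem one of
them holds for all `θ` (`ContDiff.exists_forall_eq_zero`). An umbilic `u i` cannot persist under all
rotations, and each of the other two alternatives, valid in all frames, makes `α` adapted to the
planes (`IsFrameForm.adapted`).

It remains to pass from planes to factors. For a vector `X` of the factor `0` outside `Y`, the Gauss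
equations force `α X (u i) = 0` (`IsFrameForm.extension_eq_zero`). In the other factors, the vectors
lying in a plane of non-zero curvature span the whole tangent space, so bilinearity concludes. -/

theorem Submodule.finrank_le_finrank_inf_ker_add_one [FiniteDimensional ℝ V] (K : Submodule ℝ V)
    (φ : V →ₗ[ℝ] ℝ) : finrank ℝ K ≤ finrank ℝ ↥(K ⊓ LinearMap.ker φ) + 1 := by
  have h1 := (φ.domRestrict K).finrank_range_add_finrank_ker
  have h2 : finrank ℝ (LinearMap.range (φ.domRestrict K)) ≤ 1 := by
    simpa using Submodule.finrank_le (LinearMap.range (φ.domRestrict K))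
  have h3 : finrank ℝ (LinearMap.ker (φ.domRestrict K)) = finrank ℝ ↥(K ⊓ LinearMap.ker φ) := by
    rw [LinearMap.ker_domRestrict, ← Submodule.finrank_map_subtype_eq, Submodule.map_comap_subtype]
  omega

variable [NormedAddCommGroup W] [NormedSpace ℝ W]

/-- A regular element of a bilinear map: an element `X` of maximal rank. -/
theorem LinearMap.exists_regular [FiniteDimensional ℝ W] (γ : L →ₗ[ℝ] V →ₗ[ℝ] W) :
    ∃ X, ∀ Y n, γ X n = 0 → γ Y n ∈ LinearMap.range (γ X) := by
  have hfin : (Set.range fun X ↦ finrank ℝ (LinearMap.range (γ X))).Finite :=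
    (Set.finite_Iic (finrank ℝ W)).subset (by
      rintro _ ⟨X, rfl⟩
      exact Submodule.finrank_le _)
  obtain ⟨_, ⟨X, rfl⟩, hX⟩ := Set.exists_max_image _ (fun m ↦ m) hfin (Set.range_nonempty _)
  refine ⟨X, fun Y n hn ↦ ?_⟩
  by_contra hmem
  set r := finrank ℝ (LinearMap.range (γ X)) with hr
  let b := finBasis ℝ (LinearMap.range (γ X))
  have hz : ∀ i, ∃ z, γ X z = b i := fun i ↦ (b i).2
  choose z hz using hz
  -- If `γ Y n` were outside the range of `γ X`, then for small `t ≠ 0` the range of `γ (X + t • Y)`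
  -- would contain these `r + 1` vectors. They are independent at `t = 0`, hence nearby, which
  -- contradicts the maximality of the rank `r`.
  let v : ℝ → Fin (r + 1) → W := fun t ↦ Fin.snoc (fun i ↦ γ X (z i) + t • γ Y (z i)) (γ Y n)
  have hcont : Continuous v := by
    refine continuous_pi fun i ↦ ?_
    refine Fin.lastCases ?_ (fun i ↦ ?_) i
    · simpa [v] using continuous_const
    · simp only [v, Fin.snoc_castSucc]
      fun_prop
  have h0 : LinearIndependent ℝ (v 0) := by
    simp only [v, zero_smul, add_zero, linearIndependent_finSnoc]
    have hbz : (fun i ↦ γ X (z i)) = (LinearMap.range (γ X)).subtype ∘ b := by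
      ext i
      simp [hz]
    rw [hbz]
    refine ⟨b.linearIndependent.map' _ (Submodule.ker_subtype _), ?_⟩
    rw [Set.range_comp, ← Submodule.map_span, b.span_eq]
    simpa using hmem
  have hev : ∀ᶠ t in nhds (0 : ℝ), LinearIndependent ℝ (v t) :=
    hcont.continuousAt.eventually (isOpen_setOfPred_linearIndependent.mem_nhds h0)
  obtain ⟨t, ht, ht0⟩ :=
    ((hev.filter_mono nhdsWithin_le_nhds).and (self_mem_nhdsWithin (s := {(0 : ℝ)}ᶜ))).exists
  have hle : Submodule.span ℝ (Set.range (v t)) ≤ LinearMap.range (γ (X + t • Y)) := by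
    rw [Submodule.span_le]
    rintro _ ⟨i, rfl⟩
    refine Fin.lastCases ?_ (fun i ↦ ?_) i
    · refine ⟨t⁻¹ • n, ?_⟩
      have ht0' : t ≠ 0 := ht0
      simp [v, hn, smul_smul, ht0']
    · exact ⟨z i, by simp [v]⟩
  have h1 := Submodule.finrank_mono hle
  rw [finrank_span_eq_card ht, Fintype.card_fin] at h1
  have h2 : finrank ℝ (LinearMap.range (γ (X + t • Y))) ≤ r := hX _ (Set.mem_range_self (X + t • Y))
  omega

/-- The vectors annihilated by all the `γ Y`. -/
def LinearMap.rightNullity (γ : L →ₗ[ℝ] V →ₗ[ℝ] W) : Submodule ℝ V := LinearMap.ker γ.flip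

theorem LinearMap.mem_rightNullity {γ : L →ₗ[ℝ] V →ₗ[ℝ] W} {n : V} :
    n ∈ γ.rightNullity ↔ ∀ Y, γ Y n = 0 := by
  simp [rightNullity, LinearMap.ext_iff]

/-- The nullity of a bilinear map which is flat with respect to `Q` and takes its values in a
subspace on which `Q` is anisotropic. -/
theorem LinearMap.le_finrank_rightNullity [FiniteDimensional ℝ V] [FiniteDimensional ℝ W]
    (γ : L →ₗ[ℝ] V →ₗ[ℝ] W)
    (Q : W →ₗ[ℝ] W →ₗ[ℝ] ℝ)
    (hflat : ∀ X Y p q, Q (γ X p) (γ Y q) = Q (γ X q) (γ Y p)) (U : Submodule ℝ W)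
    (hU : ∀ w ∈ U, Q w w = 0 → w = 0) (hγ : ∀ X p, γ X p ∈ U) :
    finrank ℝ V ≤ finrank ℝ γ.rightNullity + finrank ℝ U := by
  obtain ⟨X, hX⟩ := γ.exists_regular
  have h1 := (γ X).finrank_range_add_finrank_ker
  have h2 : finrank ℝ (LinearMap.range (γ X)) ≤ finrank ℝ U := by
    refine Submodule.finrank_mono ?_
    rintro _ ⟨p, rfl⟩
    exact hγ X p
  have h3 : finrank ℝ (LinearMap.ker (γ X)) ≤ finrank ℝ γ.rightNullity := by
    refine Submodule.finrank_mono fun n hn ↦ mem_rightNullity.2 fun Y ↦ ?_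
    rw [LinearMap.mem_ker] at hn
    obtain ⟨z, hz⟩ := hX Y n hn
    -- Regularity writes `γ Y n = γ X z`; flatness then exchanges `z` and `n`, and `γ X n = 0` makes
    -- `γ Y n` null.
    refine hU _ (hγ Y n) ?_
    nth_rewrite 1 [← hz]
    rw [hflat, hn, map_zero, LinearMap.zero_apply]
  omega

end FlatBilinear

/-! ## Lorentzian forms -/

section Lorentz

open Module

variable {W : Type*} [AddCommGroup W] [Module ℝ W]

/-- `Q` is a nondegenerate symmetric form and `F` a null vector such that the only null vectors
orthogonal to `F` are the multiples of `F`. This holds for a Lorentzian form `Q`. -/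
structure IsLorentz (Q : W →ₗ[ℝ] W →ₗ[ℝ] ℝ) (F : W) : Prop where
  symm : ∀ v w, Q v w = Q w v
  nondegenerate : ∀ v, (∀ w, Q v w = 0) → v = 0
  null : Q F F = 0
  exists_eq_smul : ∀ w, Q w F = 0 → Q w w = 0 → ∃ c : ℝ, w = c • F

variable {Q : W →ₗ[ℝ] W →ₗ[ℝ] ℝ} {F : W}

/-- Null vectors orthogonal to `F` are multiples of `F`, and orthogonality to `z` removes these.
This gives anisotropy of the complement of `F` and `z`. -/
theorem IsLorentz.eq_zero (h : IsLorentz Q F) {d z : W} (hz : Q F z ≠ 0) (hdF : Q d F = 0)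
    (hd : Q d d = 0) (hdz : Q d z = 0) : d = 0 := by
  obtain ⟨c, rfl⟩ := h.exists_eq_smul d hdF hd
  have : c = 0 := by simpa [hz] using hdz
  simp [this]

/-- The null vector `p` and `r` span a Lorentzian plane, so their complement is anisotropic.
Subtracting the multiple of `p` that makes `w` orthogonal to `F` reduces to the defining property of
`F`. -/
theorem IsLorentz.eq_zero_of_orthogonal (h : IsLorentz Q F) {p r w : W} (hp : Q p p = 0)
    (hpF : Q p F = 1) (hpr : Q p r ≠ 0) (hwp : Q w p = 0) (hwr : Q w r = 0) (hw : Q w w = 0) :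
    w = 0 := by
  set c := Q w F with hc
  have h1 : Q (w - c • p) F = 0 := by simp [hpF, hc]
  have h2 : Q (w - c • p) (w - c • p) = 0 := by simp [hw, hp, hwp, h.symm p w]
  obtain ⟨e, he⟩ := h.exists_eq_smul _ h1 h2
  have h3 : e = 0 := by
    have := congrArg (fun x ↦ Q p x) he
    simpa [hp, hpF, h.symm p w, hwp] using this.symm
  have h4 : w = c • p := by
    rw [h3, zero_smul] at he
    exact sub_eq_zero.1 he
  have h5 : c = 0 := by
    have : Q (c • p) r = 0 := by rw [← h4, hwr]
    simpa [hpr] using this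
  simpa [h5] using h4

/-- The orthogonal complement of two vectors. -/
def orthogonalPair (Q : W →ₗ[ℝ] W →ₗ[ℝ] ℝ) (p r : W) : Submodule ℝ W :=
  LinearMap.ker ((Q p).prod (Q r))

theorem mem_orthogonalPair {p r w : W} :
    w ∈ orthogonalPair Q p r ↔ Q p w = 0 ∧ Q r w = 0 := by
  simp [orthogonalPair]

theorem finrank_orthogonalPair [FiniteDimensional ℝ W] (hQ : ∀ v w, Q v w = Q w v) {p r : W}
    (hp : Q p p = 0) (hr : Q r r = 0) (hpr : Q p r ≠ 0) :
    finrank ℝ (orthogonalPair Q p r) + 2 = finrank ℝ W := by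
  have h1 := ((Q p).prod (Q r)).finrank_range_add_finrank_ker
  have h2 : LinearMap.range ((Q p).prod (Q r)) = ⊤ := by
    rw [LinearMap.range_eq_top]
    rintro ⟨a, b⟩
    refine ⟨(a / Q p r) • r + (b / Q p r) • p, ?_⟩
    simp [hp, hr, hQ r p, hpr]
  rw [h2, finrank_top, finrank_prod, finrank_self] at h1
  change finrank ℝ (LinearMap.ker ((Q p).prod (Q r))) + 2 = finrank ℝ W
  rw [← h1, add_comm]

end Lorentz

/-! ## Second fundamental forms of products of planes, one of which is flat -/

section PlaneProduct

open Module

variable {Y ι W : Type*} [NormedAddCommGroup Y] [InnerProductSpace ℝ Y]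

/-- The sum of `Y` and of the lines spanned by the `u i`. -/
def frameIncl : (Y × (ι → ℝ)) →ₗ[ℝ] Y × (ι → ℝ) × (ι → ℝ) :=
  LinearMap.prodMap LinearMap.id (LinearMap.inl ℝ _ _)

theorem frameIncl_apply (z : Y × (ι → ℝ)) : frameIncl z = (z.1, z.2, 0) := rfl

variable [Fintype ι]

/-- The scalar product of the orthogonal sum of `Y` and of a family of planes with orthonormal
bases: `(y, a, b)` is the sum of `y` and of the `a i • u i + b i • v i`. -/
def frameInner (p q : Y × (ι → ℝ) × (ι → ℝ)) : ℝ :=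
  ⟪p.1, q.1⟫ + p.2.1 ⬝ᵥ q.2.1 + p.2.2 ⬝ᵥ q.2.2

/-- The curvature of the product of `Y` and of planes with curvatures `K i`. -/
def frameCurvature (K : ι → ℝ) (p q r s : Y × (ι → ℝ) × (ι → ℝ)) : ℝ :=
  ∑ i, K i * ((p.2.1 i * q.2.2 i - q.2.1 i * p.2.2 i) * (r.2.2 i * s.2.1 i - r.2.1 i * s.2.2 i))

variable [NormedAddCommGroup W] [NormedSpace ℝ W]

/-- `α` is a symmetric bilinear form on the orthogonal sum of `Y` and of a family of planes which
satisfies the Gauss equation of an isometric immersion into the light cone. -/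
structure IsFrameForm (Q : W →ₗ[ℝ] W →ₗ[ℝ] ℝ) (F : W) (K : ι → ℝ)
    (α : (Y × (ι → ℝ) × (ι → ℝ)) →ₗ[ℝ] (Y × (ι → ℝ) × (ι → ℝ)) →ₗ[ℝ] W) : Prop where
  symm : ∀ p q, α p q = α q p
  pair : ∀ p q, Q (α p q) F = frameInner p q
  gauss : ∀ p q r s, Q (α p s) (α q r) - Q (α p r) (α q s) = frameCurvature K p q r s

variable {Q : W →ₗ[ℝ] W →ₗ[ℝ] ℝ} {F : W} {K : ι → ℝ}
  {α : (Y × (ι → ℝ) × (ι → ℝ)) →ₗ[ℝ] (Y × (ι → ℝ) × (ι → ℝ)) →ₗ[ℝ] W}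

/-- Two vectors of `Y ⊕ ⨁ ℝ u i` have proportional components in each curved plane, and `Y` is flat,
so the right-hand side of the Gauss equation vanishes. -/
theorem IsFrameForm.flat (h : IsFrameForm Q F K α) (z z' : Y × (ι → ℝ))
    (p q : Y × (ι → ℝ) × (ι → ℝ)) :
    Q (α (frameIncl z) p) (α (frameIncl z') q) = Q (α (frameIncl z) q) (α (frameIncl z') p) := by
  have := h.gauss (frameIncl z) (frameIncl z') q p
  simp only [frameCurvature, frameIncl_apply, Pi.zero_apply, mul_zero, sub_zero, zero_mul,
    Finset.sum_const_zero] at this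
  exact sub_eq_zero.1 this

/-- `frameInner` as a bilinear map. -/
def frameInnerL : (Y × (ι → ℝ) × (ι → ℝ)) →ₗ[ℝ] (Y × (ι → ℝ) × (ι → ℝ)) →ₗ[ℝ] ℝ :=
  LinearMap.mk₂ ℝ frameInner
    (fun p q r ↦ by
      simp only [frameInner, Prod.fst_add, Prod.snd_add, inner_add_left, add_dotProduct]
      ring)
    (fun c p q ↦ by
      simp only [frameInner, Prod.smul_fst, Prod.smul_snd, real_inner_smul_left, smul_dotProduct,
        smul_eq_mul]
      ring)
    (fun p q r ↦ by
      simp only [frameInner, Prod.fst_add, Prod.snd_add, inner_add_right, dotProduct_add]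
      ring)
    (fun c p q ↦ by
      simp only [frameInner, Prod.smul_fst, Prod.smul_snd, real_inner_smul_right, dotProduct_smul,
        smul_eq_mul]
      ring)

variable [FiniteDimensional ℝ Y] [FiniteDimensional ℝ W]

/-- For `X` regular and `N` the kernel of `α X`, the values of `α` on `Z × N` span an isotropic
subspace, which has dimension at most one in Lorentzian signature. If `N` is orthogonal to `Z`, a
dimension count identifies it with the span `B` of the `v i`. Otherwise the isotropic line is
spanned by `ζ`. -/
theorem IsFrameForm.normal_or_null (h : IsFrameForm Q F K α) (hQ : IsLorentz Q F)
    (hY : finrank ℝ Y = 2) (hW : finrank ℝ W = Fintype.card ι + 2) :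
    (∀ z b, α (frameIncl z) (0, 0, b) = 0) ∨
      ∃ ζ, Q ζ ζ = 0 ∧ Q ζ F = 1 ∧ ∀ z p, Q ζ (α (frameIncl z) p) = 0 := by
  obtain ⟨X, hX⟩ := (α ∘ₗ frameIncl).exists_regular
  simp only [LinearMap.comp_apply] at hX
  set N := LinearMap.ker (α (frameIncl X)) with hN
  have hdim := (α (frameIncl X)).finrank_range_add_finrank_ker
  rw [← hN] at hdim
  have hV : finrank ℝ (Y × (ι → ℝ) × (ι → ℝ)) = 2 + 2 * Fintype.card ι := by
    simp only [finrank_prod, hY, finrank_fintype_fun_eq_card]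
    ring
  let B : Submodule ℝ (Y × (ι → ℝ) × (ι → ℝ)) :=
    LinearMap.range (LinearMap.inr ℝ Y ((ι → ℝ) × (ι → ℝ)) ∘ₗ LinearMap.inr ℝ (ι → ℝ) (ι → ℝ))
  have hB : finrank ℝ B = Fintype.card ι := by
    rw [LinearMap.finrank_range_of_inj, finrank_fintype_fun_eq_card]
    exact LinearMap.inr_injective.comp LinearMap.inr_injective
  have hmemB : ∀ n : Y × (ι → ℝ) × (ι → ℝ), n ∈ B ↔ n.1 = 0 ∧ n.2.1 = 0 := by
    rintro ⟨y, a, b⟩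
    constructor
    · rintro ⟨b', hb'⟩
      simp only [LinearMap.comp_apply, LinearMap.inr_apply, Prod.mk.injEq] at hb'
      exact ⟨hb'.1.symm, hb'.2.1.symm⟩
    · rintro ⟨h1, h2⟩
      simp only at h1 h2
      exact ⟨b, by simp [h1, h2]⟩
  have hself : ∀ n : Y × (ι → ℝ) × (ι → ℝ), frameInner (frameIncl (n.1, n.2.1)) n = 0 → n ∈ B := by
    intro n hn
    have h1 : 0 ≤ ⟪n.1, n.1⟫ := real_inner_self_nonneg
    have h2 : 0 ≤ n.2.1 ⬝ᵥ n.2.1 := Finset.sum_nonneg fun i _ ↦ mul_self_nonneg _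
    simp only [frameInner, frameIncl_apply, zero_dotProduct, add_zero] at hn
    exact (hmemB n).2 ⟨inner_self_eq_zero.1 (by linarith : ⟪n.1, n.1⟫ = 0),
      dotProduct_self_eq_zero.1 (by linarith)⟩
  have horth : ∀ n ∈ N, ∀ z p, Q (α (frameIncl z) n) (α (frameIncl X) p) = 0 := by
    intro n hn z p
    rw [LinearMap.mem_ker] at hn
    rw [h.flat, hn, map_zero]
  have hnull : ∀ n ∈ N, ∀ n' ∈ N, ∀ z z', Q (α (frameIncl z) n) (α (frameIncl z') n') = 0 := by
    intro n hn n' hn' z z'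
    obtain ⟨p, hp⟩ := hX z' n' (LinearMap.mem_ker.1 hn')
    rw [← hp]
    exact horth n hn z p
  have hrange : finrank ℝ (LinearMap.range (α (frameIncl X))) ≤ Fintype.card ι + 2 :=
    hW ▸ Submodule.finrank_le _
  -- A non-zero `α(z, n)` with `n ∈ N` is orthogonal to the range of `α X`. The range is then
  -- proper, so its kernel has dimension at least `2 + 2k - (k + 1)`.
  have hbig : (∃ n ∈ N, ∃ z, α (frameIncl z) n ≠ 0) → Fintype.card ι + 1 ≤ finrank ℝ N := by
    rintro ⟨n, hn, z, hz⟩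
    have hlt : LinearMap.range (α (frameIncl X)) < ⊤ := by
      rw [lt_top_iff_ne_top]
      intro htop
      refine hz (hQ.nondegenerate _ fun w ↦ ?_)
      obtain ⟨p, rfl⟩ := LinearMap.range_eq_top.1 htop w
      exact horth n hn z p
    have := Submodule.finrank_lt_finrank_of_lt hlt
    rw [finrank_top] at this
    omega
  have hmemN : ∀ b, (0, 0, b) ∈ B := fun b ↦ (hmemB _).2 ⟨rfl, rfl⟩
  by_cases hp : ∀ n ∈ N, ∀ z, frameInner (frameIncl z) n = 0
  · left
    have hNB : N ≤ B := fun n hn ↦ hself n (hp n hn _)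
    have hzero : ∀ n ∈ N, ∀ z, α (frameIncl z) n = 0 := by
      by_contra! hc
      have h1 := hbig hc
      have h2 := Submodule.finrank_mono hNB
      omega
    have hNB' : N = B := Submodule.eq_of_le_of_finrank_le hNB (by omega)
    exact fun z b ↦ hzero _ (hNB' ▸ hmemN b) z
  · push Not at hp
    obtain ⟨n₁, hn₁, z₁, hz₁⟩ := hp
    set c := frameInner (frameIncl z₁) n₁ with hc
    set ζ := c⁻¹ • α (frameIncl z₁) n₁ with hζ
    have hζζ : Q ζ ζ = 0 := by simp [hζ, hnull n₁ hn₁ n₁ hn₁]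
    have hζF : Q ζ F = 1 := by simp [hζ, h.pair, ← hc, hz₁]
    -- The difference of the two sides is null and orthogonal to both `F` and `ζ`.
    have hval : ∀ n ∈ N, ∀ z, α (frameIncl z) n = frameInner (frameIncl z) n • ζ := by
      intro n hn z
      rw [← sub_eq_zero]
      refine hQ.eq_zero (z := ζ) (by rw [hQ.symm, hζF]; exact one_ne_zero) ?_ ?_ ?_
      · simp [h.pair, hζF]
      · simp [hζ, hnull n₁ hn₁ n₁ hn₁, hnull n hn n hn, hnull n₁ hn₁ n hn, hnull n hn n₁ hn₁]
      · simp [hζ, hnull n₁ hn₁ n₁ hn₁, hnull n hn n₁ hn₁]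
    have hN1 : Fintype.card ι + 1 ≤ finrank ℝ N := by
      refine hbig ⟨n₁, hn₁, z₁, fun h0 ↦ ?_⟩
      rw [hζ, h0] at hζF
      simp at hζF
    by_cases hBN : B ≤ N
    · left
      intro z b
      rw [hval _ (hBN (hmemN b))]
      simp [frameInner, frameIncl_apply]
    · right
      refine ⟨ζ, hζζ, hζF, fun z p ↦ ?_⟩
      have hlt : finrank ℝ ↥(N ⊓ B) < Fintype.card ι := by
        rw [← hB]
        refine Submodule.finrank_lt_finrank_of_lt (lt_of_le_of_ne inf_le_right fun he ↦ hBN ?_)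
        exact he ▸ inf_le_left
      -- The part of `N` orthogonal to `z` has dimension at least `k`, while `N ⊓ B` is smaller.
      -- Flatness applied to such an `n` and to its `Z`-component `z'` gives `⟪z', n⟫ Q(α(z, p), ζ)
      -- = 0`, where `⟪z', n⟫ = |z'|² ≠ 0`.
      have hex : ∃ n ∈ N, frameInner (frameIncl z) n = 0 ∧ n ∉ B := by
        by_contra! hall
        have hle : N ⊓ LinearMap.ker (frameInnerL (frameIncl z)) ≤ N ⊓ B :=
          fun n hn ↦ ⟨hn.1, hall n hn.1 hn.2⟩
        have h1 := Submodule.finrank_mono hle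
        have h2 := N.finrank_le_finrank_inf_ker_add_one (frameInnerL (frameIncl z))
        omega
      obtain ⟨n, hn, hzn, hnB⟩ := hex
      have h1 := h.flat z (n.1, n.2.1) p n
      rw [hval n hn, hval n hn, hzn, zero_smul, map_zero, LinearMap.zero_apply, map_smul,
        smul_eq_mul] at h1
      rw [hQ.symm]
      exact (mul_eq_zero.1 h1).resolve_left fun h0 ↦ hnB (hself n h0)

end PlaneProduct

/-! ### Forms orthogonal to a null vector: an umbilic line or a diagonal form -/

section PlaneProduct

open Module

variable {Y ι W : Type*} [NormedAddCommGroup Y] [InnerProductSpace ℝ Y] [Fintype ι]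
  [NormedAddCommGroup W] [NormedSpace ℝ W]
  {Q : W →ₗ[ℝ] W →ₗ[ℝ] ℝ} {F : W} {K : ι → ℝ}
  {α : (Y × (ι → ℝ) × (ι → ℝ)) →ₗ[ℝ] (Y × (ι → ℝ) × (ι → ℝ)) →ₗ[ℝ] W}
  [FiniteDimensional ℝ Y] [FiniteDimensional ℝ W] [DecidableEq ι]

open Classical in
/-- If the image of `α` on the sum of `Y` and of the lines `ℝ u i` is orthogonal to a null vector
`ζ`, then one of the `u i` is umbilic with `ζ` as value, or `α` is diagonal on that sum. -/
theorem IsFrameForm.umbilic_or_diagonal (h : IsFrameForm Q F K α) (hQ : IsLorentz Q F)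
    (hK : ∀ i, K i ≠ 0) (hY : finrank ℝ Y = 2) (hW : finrank ℝ W = Fintype.card ι + 2) {ζ : W}
    (hζ : Q ζ ζ = 0) (hζF : Q ζ F = 1) (hζα : ∀ z p, Q ζ (α (frameIncl z) p) = 0) :
    (∃ i, ∀ z, α (frameIncl (0, Pi.single i 1)) (frameIncl z) = z.2 i • ζ) ∨
      (∀ y z, α (frameIncl (y, 0)) (frameIncl z) = ⟪y, z.1⟫ • ζ) ∧
        ∀ i j, i ≠ j →
          α (frameIncl (0, Pi.single i 1)) (frameIncl (0, Pi.single j 1)) = 0 := by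
  rw [or_iff_not_imp_left]
  intro hbad
  have hFζ : Q F ζ = 1 := by rw [hQ.symm, hζF]
  -- Subtracting the `ζ`-part leaves a flat map into `{F, ζ}ᗮ`, which is anisotropic of dimension
  -- `k`. Its right nullity `N` therefore has dimension at least `k + 2`.
  let γ : (Y × (ι → ℝ)) →ₗ[ℝ] (Y × (ι → ℝ) × (ι → ℝ)) →ₗ[ℝ] W :=
    LinearMap.mk₂ ℝ (fun z p ↦ α (frameIncl z) p - frameInnerL (frameIncl z) p • ζ)
      (fun z z' p ↦ by simp only [map_add, LinearMap.add_apply]; module)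
      (fun c z p ↦ by simp only [map_smul, LinearMap.smul_apply, smul_eq_mul]; module)
      (fun z p p' ↦ by simp only [map_add]; module)
      (fun c z p ↦ by simp only [map_smul, smul_eq_mul]; module)
  have hγ : ∀ z p, γ z p = α (frameIncl z) p - frameInner (frameIncl z) p • ζ := fun _ _ ↦ rfl
  have hαζ : ∀ z p, Q (α (frameIncl z) p) ζ = 0 := fun z p ↦ by rw [hQ.symm, hζα]
  set U := orthogonalPair Q F ζ with hUdef
  have hUdim : finrank ℝ U = Fintype.card ι := by
    have := finrank_orthogonalPair hQ.symm hQ.null hζ (p := F) (r := ζ) (by simp [hFζ])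
    rw [← hUdef] at this
    omega
  have hγU : ∀ z p, γ z p ∈ U := by
    intro z p
    rw [mem_orthogonalPair, hγ]
    simp [hζα, hζ, hQ.symm F, h.pair, hζF]
  have hflat : ∀ z z' p q, Q (γ z p) (γ z' q) = Q (γ z q) (γ z' p) := by
    intro z z' p q
    simp only [hγ, map_sub, LinearMap.sub_apply, map_smul, LinearMap.smul_apply, hζα, hαζ, hζ,
      smul_zero, sub_zero, h.flat z z' p q]
  have hNdim := γ.le_finrank_rightNullity Q hflat U (fun w hw hww ↦ by
    rw [mem_orthogonalPair] at hw
    exact hQ.eq_zero (z := ζ) (by simp [hFζ]) (by rw [hQ.symm, hw.1]) hww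
      (by rw [hQ.symm, hw.2])) hγU
  set N := γ.rightNullity with hN
  have hV : finrank ℝ (Y × (ι → ℝ) × (ι → ℝ)) = 2 + 2 * Fintype.card ι := by
    simp only [finrank_prod, hY, finrank_fintype_fun_eq_card]
    ring
  have hmem : ∀ n, n ∈ N ↔ ∀ z, α (frameIncl z) n = frameInner (frameIncl z) n • ζ := by
    intro n
    simp only [hN, LinearMap.mem_rightNullity, hγ, sub_eq_zero]
  have hnotbad : ∀ i, ((0, Pi.single i 1, 0) : Y × (ι → ℝ) × (ι → ℝ)) ∉ N := by
    intro i hi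
    refine hbad ⟨i, fun z ↦ ?_⟩
    rw [h.symm]
    have := (hmem _).1 hi z
    rw [frameIncl_apply (0, _), this]
    simp [frameInner, frameIncl_apply]
  -- An element `a = ∑ a m • u m` of `N` with `a i ≠ 0` has a second coordinate `a l ≠ 0`, because
  -- `u i ∉ N`. The Gauss equation of `(v i, a, b', u m)` evaluates `a m * Q (α (v i) b') ζ`: the
  -- choice `m = l` makes the second factor vanish, and `m = i` then gives `K i * a i * b' i = 0`.
  have hb : ∀ i, (∃ a : ι → ℝ, (0, a, 0) ∈ N ∧ a i ≠ 0) → ∀ n ∈ N, n.2.2 i = 0 := by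
    rintro i ⟨a, ha, hai⟩ ⟨y', a', b'⟩ hn'
    obtain ⟨l, hli, hal⟩ : ∃ l, l ≠ i ∧ a l ≠ 0 := by
      by_contra! hc
      refine hnotbad i ?_
      have : ((0, Pi.single i 1, 0) : Y × (ι → ℝ) × (ι → ℝ)) = (a i)⁻¹ • (0, a, 0) := by
        ext j
        · simp
        · by_cases hj : j = i
          · subst hj
            simp [hai]
          · simp [hj, hc j hj]
        · simp
      rw [this]
      exact N.smul_mem _ ha
    -- Both `(y', a', b')` and `(0, a, 0)` lie in `N`, so pairing `a` with `(y', a', b')` and with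
    -- its `Z`-component gives the same multiple of `ζ`.
    have e1 : α (0, a, 0) (0, 0, b') = 0 := by
      have h1 : ((0, 0, b') : Y × (ι → ℝ) × (ι → ℝ)) = (y', a', b') - frameIncl (y', a') := by
        simp [frameIncl_apply]
      have h2 := (hmem _).1 hn' (0, a)
      have h3 := (hmem _).1 ha (y', a')
      rw [frameIncl_apply (0, a)] at h2
      rw [h1, map_sub, h2, h.symm, h3, ← sub_smul]
      simp [frameInner, frameIncl_apply, dotProduct_comm a a']
    have e2 : ∀ m, a m * Q (α (0, 0, Pi.single i 1) (0, 0, b')) ζ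
        = if m = i then K i * a i * b' i else 0 := by
      intro m
      have h1 := h.gauss (0, 0, Pi.single i 1) (0, a, 0) (0, 0, b') (frameIncl (0, Pi.single m 1))
      rw [e1, h.symm (0, a, 0), (hmem _).1 ha] at h1
      have h2 : frameInner (frameIncl (0, Pi.single m 1)) ((0, a, 0) : Y × (ι → ℝ) × (ι → ℝ))
          = a m := by simp [frameInner, frameIncl_apply]
      have h3 : frameCurvature K ((0, 0, Pi.single i 1) : Y × (ι → ℝ) × (ι → ℝ)) (0, a, 0)
          (0, 0, b') (frameIncl (0, Pi.single m 1)) = - if m = i then K i * a i * b' i else 0 := by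
        rw [frameCurvature, Finset.sum_eq_single i]
        · by_cases hmi : m = i
          · subst hmi
            simp [frameIncl_apply]
            ring
          · simp [frameIncl_apply, hmi, Ne.symm hmi]
        · intro j _ hj
          simp [hj]
        · simp
      rw [h2, h3, map_smul, map_zero, smul_eq_mul, zero_sub, neg_inj] at h1
      exact h1
    have h4 := e2 l
    have h5 := e2 i
    rw [if_neg hli] at h4
    rw [(mul_eq_zero.1 h4).resolve_left hal, if_pos rfl, mul_zero] at h5
    exact (mul_eq_zero.1 h5.symm).resolve_left (mul_ne_zero (hK i) hai)
  -- For each `i`, keep the `u i`-coordinate if some pure combination of the `u`'s in `N` involves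
  -- `u i`, and the `v i`-coordinate otherwise. By `hb` nothing is lost, so `T` is injective; its
  -- target has dimension `k + 2`, so it is bijective.
  let T : N →ₗ[ℝ] Y × (ι → ℝ) :=
    { toFun := fun n ↦ (n.1.1, fun i ↦
        if ∃ a : ι → ℝ, (0, a, 0) ∈ N ∧ a i ≠ 0 then n.1.2.1 i else n.1.2.2 i)
      map_add' := fun n n' ↦ by
        ext i
        · simp
        · simp only [Submodule.coe_add, Prod.snd_add, Prod.fst_add, Pi.add_apply]
          split_ifs <;> rfl
      map_smul' := fun c n ↦ by
        ext i
        · simp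
        · simp only [Submodule.coe_smul, Prod.smul_snd, Prod.smul_fst, Pi.smul_apply,
            RingHom.id_apply]
          split_ifs <;> rfl }
  have hTinj : Function.Injective T := by
    rw [← LinearMap.ker_eq_bot, LinearMap.ker_eq_bot']
    rintro ⟨⟨y, a, b⟩, hn⟩ hTn
    have h1 : y = 0 := congrArg Prod.fst hTn
    have h2 : ∀ i, (if ∃ a : ι → ℝ, (0, a, 0) ∈ N ∧ a i ≠ 0 then a i else b i) = 0 :=
      fun i ↦ congrFun (congrArg Prod.snd hTn) i
    have h3 : b = 0 := by
      ext i
      by_cases hi : ∃ a : ι → ℝ, (0, a, 0) ∈ N ∧ a i ≠ 0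
      · exact hb i hi _ hn
      · simpa [hi] using h2 i
    subst h1 h3
    have h4 : a = 0 := by
      ext i
      by_contra hai
      have := h2 i
      rw [if_pos ⟨a, hn, hai⟩] at this
      exact hai this
    subst h4
    rfl
  have hYι : finrank ℝ (Y × (ι → ℝ)) = 2 + Fintype.card ι := by
    simp [finrank_prod, hY]
  have hTsurj : Function.Surjective T := by
    have := LinearMap.finrank_le_finrank_of_injective hTinj
    exact (LinearMap.injective_iff_surjective_of_finrank_eq_finrank (by omega)).1 hTinj
  -- A preimage of the `i`-th basis vector would be `u i` itself, which is not in `N`. Hence `N` is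
  -- a graph over the `Y`- and `v`-coordinates.
  have hJ : ∀ i, ¬ ∃ a : ι → ℝ, (0, a, 0) ∈ N ∧ a i ≠ 0 := by
    intro i hi
    obtain ⟨⟨⟨y, a, b⟩, hn⟩, hTn⟩ := hTsurj (0, Pi.single i 1)
    have h1 : y = 0 := congrArg Prod.fst hTn
    have h2 : ∀ j, (if ∃ a : ι → ℝ, (0, a, 0) ∈ N ∧ a j ≠ 0 then a j else b j)
        = (Pi.single i 1 : ι → ℝ) j := fun j ↦ congrFun (congrArg Prod.snd hTn) j
    have h3 : b = 0 := by
      ext j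
      by_cases hj : ∃ a : ι → ℝ, (0, a, 0) ∈ N ∧ a j ≠ 0
      · exact hb j hj _ hn
      · have := h2 j
        rw [if_neg hj] at this
        have hij : j ≠ i := fun e ↦ hj (e ▸ hi)
        simpa [hij] using this
    subst h1 h3
    have h4 : a = Pi.single i 1 := by
      ext j
      by_cases hj : ∃ a : ι → ℝ, (0, a, 0) ∈ N ∧ a j ≠ 0
      · simpa [hj] using h2 j
      · have hij : j ≠ i := fun e ↦ hj (e ▸ hi)
        by_contra hne
        exact hj ⟨a, hn, by simpa [hij] using hne⟩
    subst h4
    exact hnotbad i hn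
  have hex : ∀ y b, ∃ a, ((y, a, b) : Y × (ι → ℝ) × (ι → ℝ)) ∈ N := by
    intro y b
    obtain ⟨⟨⟨y', a, b'⟩, hn⟩, hTn⟩ := hTsurj (y, b)
    have h1 : y' = y := congrArg Prod.fst hTn
    have h2 : b' = b := by
      ext j
      have : (if ∃ a : ι → ℝ, (0, a, 0) ∈ N ∧ a j ≠ 0 then a j else b' j) = b j :=
        congrFun (congrArg Prod.snd hTn) j
      rwa [if_neg (hJ j)] at this
    subst h1 h2
    exact ⟨a, hn⟩
  -- The element of `N` over `v i`, paired with `v i`, gives a vector `η i` whose product with `α z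
  -- z'` detects, by the Gauss equation, only the `u i`-coordinates of `z` and `z'`.
  choose A hA using fun i ↦ hex 0 (Pi.single i 1)
  set η : ι → W := fun i ↦ α (0, A i, Pi.single i 1) (0, 0, Pi.single i 1) with hη
  have hαη : ∀ z z' i, Q (α (frameIncl z) (frameIncl z')) (η i) = K i * (z.2 i * z'.2 i) := by
    intro z z' i
    have h1 := h.gauss (frameIncl z) (0, A i, Pi.single i 1) (0, 0, Pi.single i 1) (frameIncl z')
    rw [h.symm _ (frameIncl z'), h.symm _ (frameIncl z'), (hmem _).1 (hA i), map_smul, hαζ,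
      smul_zero, sub_zero, h.symm] at h1
    rw [hη]
    simp only
    rw [h1, frameCurvature, Finset.sum_eq_single i]
    · simp [frameIncl_apply]
    · intro j _ hj
      simp [hj, frameIncl_apply]
    · simp
  have hζη : ∀ i, Q ζ (η i) = 0 := by
    intro i
    have : Nontrivial Y := Module.nontrivial_of_finrank_pos (R := ℝ) (by omega)
    obtain ⟨y, hy⟩ := exists_ne (0 : Y)
    obtain ⟨a, ha⟩ := hex y 0
    have h1 := hαη (y, 0) (y, a) i
    rw [frameIncl_apply (y, a), (hmem _).1 ha, map_smul] at h1
    have h2 : frameInner (frameIncl (y, 0)) ((y, a, 0) : Y × (ι → ℝ) × (ι → ℝ)) = ⟪y, y⟫ := by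
      simp [frameInner, frameIncl_apply]
    rw [h2] at h1
    simpa [hy] using h1
  have hγη : ∀ z z' i, Q (γ z (frameIncl z')) (η i) = K i * (z.2 i * z'.2 i) := by
    intro z z' i
    simp [hγ, hαη, hζη]
  -- The products of the values `γ(u j, u j)` with the `η i` form an invertible diagonal matrix.
  -- These `k` values are thus a basis of `U`, and a vector of `U` orthogonal to all the `η i` is
  -- zero.
  let e : ι → U := fun j ↦ ⟨γ (0, Pi.single j 1) (frameIncl (0, Pi.single j 1)), hγU _ _⟩
  have heη : ∀ (c : ι → ℝ) i, Q (∑ j, c j • (e j : W)) (η i) = c i * K i := by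
    intro c i
    simp only [map_sum, LinearMap.sum_apply, map_smul, LinearMap.smul_apply, smul_eq_mul, e, hγη]
    rw [Finset.sum_eq_single i]
    · simp
    · intro j _ hj
      simp [Ne.symm hj]
    · simp
  have he : LinearIndependent ℝ e := by
    rw [Fintype.linearIndependent_iff]
    intro c hc i
    have h1 := heη c i
    have h2 : ∑ j, c j • (e j : W) = 0 := by
      have := congrArg Subtype.val hc
      simpa using this
    rw [h2] at h1
    simpa [hK i] using h1.symm
  have hspan := he.span_eq_top_of_card_eq_finrank' hUdim.symm
  have hγ0 : ∀ z z', (∀ i, z.2 i * z'.2 i = 0) → γ z (frameIncl z') = 0 := by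
    intro z z' hzz
    have h1 : (⟨γ z (frameIncl z'), hγU _ _⟩ : U) ∈ Submodule.span ℝ (range e) := by
      rw [hspan]
      exact Submodule.mem_top
    obtain ⟨c, hc⟩ := (Submodule.mem_span_range_iff_exists_fun ℝ).1 h1
    have h2 : ∑ j, c j • (e j : W) = γ z (frameIncl z') := by
      have := congrArg Subtype.val hc
      simpa using this
    have h3 : c = 0 := by
      ext i
      have h4 := heη c i
      rw [h2, hγη, hzz, mul_zero] at h4
      simpa [hK i] using h4.symm
    rw [← h2, h3]
    simp
  refine ⟨fun y z ↦ ?_, fun i j hij ↦ ?_⟩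
  · have := hγ0 (y, 0) z (by simp)
    rw [hγ, sub_eq_zero] at this
    rw [this]
    simp [frameInner, frameIncl_apply]
  · have := hγ0 (0, Pi.single i 1) (0, Pi.single j 1) (by
      intro l
      by_cases hl : l = i
      · subst hl
        simp [hij]
      · simp [hl])
    rw [hγ, sub_eq_zero] at this
    rw [this]
    simp [frameInner, frameIncl_apply, hij]

end PlaneProduct

/-! ## Rotation of the planes -/

section Analytic

/-- If each system had an equation failing somewhere, then by analyticity each such equation would
fail on a dense open set. By Baire's theorem all would fail at a common point, against the
hypothesis. -/
theorem ContDiff.exists_forall_eq_zero {Θ C : Type*} [NormedAddCommGroup Θ] [NormedSpace ℝ Θ]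
    [CompleteSpace Θ] [Finite C] (S : C → Set (Θ → ℝ)) (hS : ∀ c, ∀ f ∈ S c, ContDiff ℝ ω f)
    (h : ∀ θ, ∃ c, ∀ f ∈ S c, f θ = 0) : ∃ c, ∀ f ∈ S c, ∀ θ, f θ = 0 := by
  by_contra! hc
  choose f hf θ hθ using hc
  have hopen : ∀ c, IsOpen {θ | f c θ ≠ 0} := fun c ↦
    isOpen_ne_fun (hS c _ (hf c)).continuous continuous_const
  have hdense : ∀ c, Dense {θ | f c θ ≠ 0} := by
    intro c
    rw [← compl_compl {θ | f c θ ≠ 0}, ← interior_eq_empty_iff_dense_compl,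
      Set.eq_empty_iff_forall_notMem]
    intro θ₀ hθ₀
    have hev : f c =ᶠ[nhds θ₀] 0 := by
      filter_upwards [mem_interior_iff_mem_nhds.1 hθ₀] with x hx
      simpa using hx
    exact hθ c (AnalyticOnNhd.eqOn_zero_of_preconnected_of_eventuallyEq_zero
      (contDiff_omega_iff_analyticOnNhd.1 (hS c _ (hf c))) isPreconnected_univ
      (mem_univ θ₀) hev (mem_univ (θ c)))
  obtain ⟨θ₀, hθ₀⟩ := (dense_iInter_of_isOpen hopen hdense).nonempty
  obtain ⟨c, hc⟩ := h θ₀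
  exact mem_iInter.1 hθ₀ c (hc _ (hf c))

end Analytic

/-! ### Rotated frames, and exclusion of a persistent umbilic line -/

section PlaneProduct

open Module

variable {Y ι W : Type*} [NormedAddCommGroup Y] [InnerProductSpace ℝ Y]

/-- The rotation by the angles `θ i` in the planes spanned by the `u i` and `v i`. -/
noncomputable def frameRotation (θ : ι → ℝ) : (Y × (ι → ℝ) × (ι → ℝ)) →ₗ[ℝ] Y × (ι → ℝ) × (ι → ℝ) where
  toFun p := (p.1, fun i ↦ Real.cos (θ i) * p.2.1 i - Real.sin (θ i) * p.2.2 i,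
    fun i ↦ Real.sin (θ i) * p.2.1 i + Real.cos (θ i) * p.2.2 i)
  map_add' p q := by
    ext i
    · simp
    · simp only [Prod.snd_add, Prod.fst_add, Pi.add_apply]
      ring
    · simp only [Prod.snd_add, Prod.fst_add, Pi.add_apply]
      ring
  map_smul' c p := by
    ext i
    · simp
    · simp only [Prod.smul_snd, Prod.smul_fst, Pi.smul_apply, smul_eq_mul, RingHom.id_apply]
      ring
    · simp only [Prod.smul_snd, Prod.smul_fst, Pi.smul_apply, smul_eq_mul, RingHom.id_apply]
      ring

theorem frameRotation_apply (θ : ι → ℝ) (p : Y × (ι → ℝ) × (ι → ℝ)) :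
    frameRotation θ p = (p.1, fun i ↦ Real.cos (θ i) * p.2.1 i - Real.sin (θ i) * p.2.2 i,
      fun i ↦ Real.sin (θ i) * p.2.1 i + Real.cos (θ i) * p.2.2 i) := rfl

variable [DecidableEq ι]

/-- The vector `a • u j + b • v j`. -/
def framePlane (j : ι) (a b : ℝ) : Y × (ι → ℝ) × (ι → ℝ) := (0, Pi.single j a, Pi.single j b)

theorem framePlane_eq (j : ι) (a b : ℝ) :
    (framePlane j a b : Y × (ι → ℝ) × (ι → ℝ)) = a • framePlane j 1 0 + b • framePlane j 0 1 := by
  ext i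
  · simp [framePlane]
  · by_cases h : i = j
    · subst h
      simp [framePlane]
    · simp [framePlane, h]
  · by_cases h : i = j
    · subst h
      simp [framePlane]
    · simp [framePlane, h]

theorem framePlane_bilin_eq_zero [AddCommGroup W] [Module ℝ W]
    {α : (Y × (ι → ℝ) × (ι → ℝ)) →ₗ[ℝ] (Y × (ι → ℝ) × (ι → ℝ)) →ₗ[ℝ] W} {i j : ι}
    (h1 : α (framePlane i 1 0) (framePlane j 1 0) = 0)
    (h2 : α (framePlane i 1 0) (framePlane j 0 1) = 0)
    (h3 : α (framePlane i 0 1) (framePlane j 1 0) = 0)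
    (h4 : α (framePlane i 0 1) (framePlane j 0 1) = 0) (a b c d : ℝ) :
    α (framePlane i a b) (framePlane j c d) = 0 := by
  rw [framePlane_eq i, framePlane_eq j]
  simp [h1, h2, h3, h4]

theorem frameIncl_single (j : ι) :
    (frameIncl (0, Pi.single j 1) : Y × (ι → ℝ) × (ι → ℝ)) = framePlane j 1 0 := by
  simp [frameIncl_apply, framePlane]

theorem frameRotation_framePlane (θ : ι → ℝ) (j : ι) (a b : ℝ) :
    (frameRotation θ (framePlane j a b) : Y × (ι → ℝ) × (ι → ℝ)) =
      framePlane j (Real.cos (θ j) * a - Real.sin (θ j) * b)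
        (Real.sin (θ j) * a + Real.cos (θ j) * b) := by
  ext i
  · simp [framePlane, frameRotation_apply]
  · by_cases h : i = j
    · subst h
      simp [framePlane, frameRotation_apply]
    · simp [framePlane, frameRotation_apply, h]
  · by_cases h : i = j
    · subst h
      simp [framePlane, frameRotation_apply]
    · simp [framePlane, frameRotation_apply, h]

omit [DecidableEq ι] in
@[simp]
theorem frameRotation_zero : (frameRotation 0 : _ →ₗ[ℝ] Y × (ι → ℝ) × (ι → ℝ)) = LinearMap.id := by
  ext <;> simp [frameRotation_apply]

theorem frameRotation_single_frameIncl (i : ι) (t : ℝ) (z : Y × (ι → ℝ)) (hz : z.2 i = 0) :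
    frameRotation (Pi.single i t) (frameIncl z) = frameIncl z := by
  ext j
  · simp [frameRotation_apply, frameIncl_apply]
  · by_cases h : j = i
    · subst h
      simp [frameRotation_apply, frameIncl_apply, hz]
    · simp [frameRotation_apply, frameIncl_apply, h]
  · by_cases h : j = i
    · subst h
      simp [frameRotation_apply, frameIncl_apply, hz]
    · simp [frameRotation_apply, frameIncl_apply, h]

omit [DecidableEq ι] in
theorem frameRotation_incl_fst (θ : ι → ℝ) (y : Y) :
    frameRotation θ (frameIncl (y, 0)) = frameIncl (y, 0) := by
  ext <;> simp [frameRotation_apply, frameIncl_apply]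

variable [NormedAddCommGroup W] [NormedSpace ℝ W]
  {Q : W →ₗ[ℝ] W →ₗ[ℝ] ℝ} {F : W} {K : ι → ℝ}
  {α : (Y × (ι → ℝ) × (ι → ℝ)) →ₗ[ℝ] (Y × (ι → ℝ) × (ι → ℝ)) →ₗ[ℝ] W}
  [Fintype ι]

omit [DecidableEq ι] in
theorem IsFrameForm.rotate (h : IsFrameForm Q F K α) (θ : ι → ℝ) :
    IsFrameForm Q F K (α.compl₁₂ (frameRotation θ) (frameRotation θ)) where
  symm p q := by simp [h.symm]
  pair p q := by
    rw [LinearMap.compl₁₂_apply, h.pair]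
    simp only [frameInner, frameRotation_apply, dotProduct, add_assoc, add_right_inj,
      ← Finset.sum_add_distrib]
    refine Finset.sum_congr rfl fun i _ ↦ ?_
    linear_combination (p.2.1 i * q.2.1 i + p.2.2 i * q.2.2 i) * Real.sin_sq_add_cos_sq (θ i)
  gauss p q r s := by
    simp only [LinearMap.compl₁₂_apply]
    rw [h.gauss]
    refine Finset.sum_congr rfl fun i _ ↦ ?_
    have hdet : ∀ a b a' b' : ℝ,
        (Real.cos (θ i) * a - Real.sin (θ i) * b) * (Real.sin (θ i) * a' + Real.cos (θ i) * b') -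
        (Real.cos (θ i) * a' - Real.sin (θ i) * b') * (Real.sin (θ i) * a + Real.cos (θ i) * b) =
        a * b' - a' * b := fun a b a' b' ↦ by
      linear_combination (a * b' - a' * b) * Real.sin_sq_add_cos_sq (θ i)
    have h1 := hdet (p.2.1 i) (p.2.2 i) (q.2.1 i) (q.2.2 i)
    have h2 := hdet (s.2.1 i) (s.2.2 i) (r.2.1 i) (r.2.2 i)
    simp only [frameRotation_apply]
    rw [h1, mul_comm (Real.sin (θ i) * r.2.1 i + _), h2]
    ring

variable [FiniteDimensional ℝ Y] [FiniteDimensional ℝ W]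

omit [DecidableEq ι] in
theorem contDiff_frameRotation_bilin {G : Type*} [NormedAddCommGroup G] [NormedSpace ℝ G]
    (β : (Y × (ι → ℝ) × (ι → ℝ)) →ₗ[ℝ] (Y × (ι → ℝ) × (ι → ℝ)) →ₗ[ℝ] G)
    (p q : Y × (ι → ℝ) × (ι → ℝ)) :
    ContDiff ℝ ω fun θ : ι → ℝ ↦ β (frameRotation θ p) (frameRotation θ q) := by
  have hrot : ∀ p : Y × (ι → ℝ) × (ι → ℝ), ContDiff ℝ ω fun θ : ι → ℝ ↦ frameRotation θ p := by
    intro p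
    simp only [frameRotation_apply]
    refine contDiff_const.prodMk (ContDiff.prodMk ?_ ?_)
    · refine contDiff_pi.2 fun i ↦ ?_
      fun_prop
    · refine contDiff_pi.2 fun i ↦ ?_
      fun_prop
  exact (β.toContinuousBilinearMap.contDiff.comp (hrot p)).clm_apply (hrot q)

/-- The line spanned by `u i` consists of umbilic directions with values in a null line orthogonal
to the image of `α`. -/
def IsNullUmbilic (Q : W →ₗ[ℝ] W →ₗ[ℝ] ℝ)
    (α : (Y × (ι → ℝ) × (ι → ℝ)) →ₗ[ℝ] (Y × (ι → ℝ) × (ι → ℝ)) →ₗ[ℝ] W) (i : ι) : Prop :=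
  (∀ z, z.2 i = 0 → α (framePlane i 1 0) (frameIncl z) = 0) ∧
    ∀ z p, Q (α (framePlane i 1 0) (framePlane i 1 0)) (α (frameIncl z) p) = 0

/-- Comparing the angles `0`, `π/4` and `π/2` shows that `α u u` and `α v v` are null and not
orthogonal. On the sum `L` of `Y` and of the other `u j`, of dimension at least `k + 1`, `α` is flat
with values in their anisotropic complement, of dimension `k`. A non-zero vector `z` of the nullity
would satisfy `⟪z, z⟫ = Q (α z z) F = 0`. -/
theorem IsFrameForm.not_forall_isNullUmbilic (h : IsFrameForm Q F K α) (hQ : IsLorentz Q F)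
    (hK : ∀ i, K i ≠ 0) (hY : finrank ℝ Y = 2) (hW : finrank ℝ W = Fintype.card ι + 2) (i : ι) :
    ¬ ∀ θ, IsNullUmbilic Q (α.compl₁₂ (frameRotation θ) (frameRotation θ)) i := by
  intro hall
  set u : Y × (ι → ℝ) × (ι → ℝ) := framePlane i 1 0 with hu
  set v : Y × (ι → ℝ) × (ι → ℝ) := framePlane i 0 1 with hv
  have hrot : ∀ t, frameRotation (Pi.single i t) u = Real.cos t • u + Real.sin t • v := by
    intro t
    rw [hu, frameRotation_framePlane, framePlane_eq]
    simp [hv]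
  have hrotv : ∀ t, frameRotation (Pi.single i t) v = -Real.sin t • u + Real.cos t • v := by
    intro t
    rw [hv, frameRotation_framePlane, framePlane_eq]
    simp [hu]
  have hui : frameIncl (0, Pi.single i 1) = u := frameIncl_single i
  have hp : ∀ z p, Q (α u u) (α (frameIncl z) p) = 0 := by
    intro z p
    simpa using (hall 0).2 z p
  have hr := (hall (Pi.single i (Real.pi / 2))).2
  simp only [LinearMap.compl₁₂_apply, ← hu, hrot, Real.cos_pi_div_two, Real.sin_pi_div_two,
    zero_smul, zero_add, one_smul] at hr
  have hpp : Q (α u u) (α u u) = 0 := by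
    have := hp (0, Pi.single i 1) u
    rwa [hui] at this
  have hpm : Q (α u u) (α u v) = 0 := by
    have := hp (0, Pi.single i 1) v
    rwa [hui] at this
  have hrr : Q (α v v) (α v v) = 0 := by
    have := hr (0, Pi.single i 1) u
    simpa [hui, hrot] using this
  have hrm : Q (α v v) (α u v) = 0 := by
    have := hr (0, Pi.single i 1) v
    simpa [hui, hrot, hrotv, h.symm v u] using this
  have hK' : Q (α u u) (α v v) - Q (α u v) (α u v) = K i := by
    have := h.gauss u v v u
    rw [h.symm v u] at this
    rw [this, frameCurvature, Finset.sum_eq_single i]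
    · simp [hu, hv, framePlane]
    · intro j _ hj
      simp [hu, hv, framePlane, hj]
    · simp
  -- At angle `π/4` the rotated vector is `(u + v)/√2`; this is the condition that its `α`-value be
  -- null. Together with the Gauss equation it yields `K i = (3/2) Q (α u u) (α v v)`.
  have hq : Q (α u u) (α v v) = -2 * Q (α u v) (α u v) := by
    have h1 := (hall (Pi.single i (Real.pi / 4))).2 (0, Pi.single i 1) u
    rw [hui] at h1
    simp only [LinearMap.compl₁₂_apply, ← hu, hrot, Real.cos_pi_div_four, Real.sin_pi_div_four,
      ← smul_add, map_smul, LinearMap.smul_apply, smul_eq_mul, map_add, LinearMap.add_apply,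
      h.symm v u, hpp, hrr, hrm, hpm, hQ.symm (α v v) (α u u), hQ.symm (α u v) (α u u),
      hQ.symm (α u v) (α v v)] at h1
    have h2 : √2 * √2 = 2 := Real.mul_self_sqrt (by norm_num)
    linear_combination 2 * h1 -
      (1 / 4) * (Q (α u u) (α v v) + 2 * Q (α u v) (α u v)) * (√2 * √2 + 2) * h2
  have hpr : Q (α u u) (α v v) ≠ 0 := by
    intro h0
    refine hK i ?_
    linarith
  have hpF : Q (α u u) F = 1 := by
    rw [h.pair]
    simp [hu, framePlane, frameInner]
  set U := orthogonalPair Q (α u u) (α v v) with hU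
  have hUdim : finrank ℝ U + 2 = finrank ℝ W := finrank_orthogonalPair hQ.symm hpp hrr hpr
  set L : Submodule ℝ (Y × (ι → ℝ)) :=
    ⊤ ⊓ LinearMap.ker (LinearMap.proj i ∘ₗ LinearMap.snd ℝ Y (ι → ℝ)) with hL
  have hLdim : Fintype.card ι + 2 ≤ finrank ℝ L + 1 := by
    have := Submodule.finrank_le_finrank_inf_ker_add_one (⊤ : Submodule ℝ (Y × (ι → ℝ)))
      (LinearMap.proj i ∘ₗ LinearMap.snd ℝ Y (ι → ℝ))
    rw [finrank_top, finrank_prod, hY, finrank_fintype_fun_eq_card, ← hL] at this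
    omega
  have hLmem : ∀ z ∈ L, z.2 i = 0 := fun z hz ↦ hz.2
  set γ : L →ₗ[ℝ] L →ₗ[ℝ] W := α.compl₁₂ (frameIncl ∘ₗ L.subtype) (frameIncl ∘ₗ L.subtype) with hγ
  have hγa : ∀ z z' : L, γ z z' = α (frameIncl z) (frameIncl z') := fun _ _ ↦ rfl
  have hnull := γ.le_finrank_rightNullity Q (fun z z' p q ↦ h.flat _ _ _ _) U
    (fun w hw hww ↦ by
      rw [mem_orthogonalPair, hQ.symm, hQ.symm (α v v)] at hw
      exact hQ.eq_zero_of_orthogonal hpp hpF hpr hw.1 hw.2 hww)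
    (fun z z' ↦ by
      rw [mem_orthogonalPair, hγa]
      refine ⟨hp _ _, ?_⟩
      -- The rotation by `π/2` in the plane `i` fixes `L`, so orthogonality to the value at the
      -- rotated `u` is orthogonality to `α v v`.
      have := hr z (frameIncl z')
      rwa [frameRotation_single_frameIncl _ _ _ (hLmem _ z.2),
        frameRotation_single_frameIncl _ _ _ (hLmem _ z'.2)] at this)
  have hpos : 0 < finrank ℝ γ.rightNullity := by omega
  have : Nontrivial γ.rightNullity := Module.nontrivial_of_finrank_pos hpos
  obtain ⟨⟨⟨⟨y, a⟩, hzL⟩, hz⟩, hz0⟩ := exists_ne (0 : γ.rightNullity)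
  refine hz0 ?_
  have h1 := LinearMap.mem_rightNullity.1 hz ⟨(y, a), hzL⟩
  rw [hγa] at h1
  have h2 := h.pair (frameIncl (y, a)) (frameIncl (y, a))
  rw [h1, map_zero, LinearMap.zero_apply] at h2
  simp only [frameInner, frameIncl_apply, zero_dotProduct, add_zero] at h2
  have h3 : 0 ≤ ⟪y, y⟫ := real_inner_self_nonneg
  have h4 : 0 ≤ a ⬝ᵥ a := Finset.sum_nonneg fun i _ ↦ mul_self_nonneg _
  have h5 : y = 0 := inner_self_eq_zero.1 (by linarith : ⟪y, y⟫ = 0)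
  have h6 : a = 0 := dotProduct_self_eq_zero.1 (by linarith)
  subst h5 h6
  rfl

end PlaneProduct

/-! ### One alternative valid in all frames -/

section PlaneProduct

open Module

variable {Y ι W : Type*} [NormedAddCommGroup Y] [InnerProductSpace ℝ Y] [Fintype ι]
  [NormedAddCommGroup W] [NormedSpace ℝ W]
  {Q : W →ₗ[ℝ] W →ₗ[ℝ] ℝ} {F : W} {K : ι → ℝ}
  {α : (Y × (ι → ℝ) × (ι → ℝ)) →ₗ[ℝ] (Y × (ι → ℝ) × (ι → ℝ)) →ₗ[ℝ] W}
  [FiniteDimensional ℝ Y] [FiniteDimensional ℝ W] [DecidableEq ι]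

/-- `α` vanishes on the sum of `Y` and of the lines `ℝ u i` times the sum of the lines `ℝ v i`. -/
def IsNormalForm (α : (Y × (ι → ℝ) × (ι → ℝ)) →ₗ[ℝ] (Y × (ι → ℝ) × (ι → ℝ)) →ₗ[ℝ] W) : Prop :=
  ∀ z b, α (frameIncl z) (0, 0, b) = 0

/-- `α` is diagonal on the sum of `Y` and of the lines `ℝ u i`, with null values on `Y`. -/
def IsDiagonalForm (Q : W →ₗ[ℝ] W →ₗ[ℝ] ℝ)
    (α : (Y × (ι → ℝ) × (ι → ℝ)) →ₗ[ℝ] (Y × (ι → ℝ) × (ι → ℝ)) →ₗ[ℝ] W) : Prop :=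
  (∀ y i, α (frameIncl (y, 0)) (framePlane i 1 0) = 0) ∧
    (∀ i j, i ≠ j → α (framePlane i 1 0) (framePlane j 1 0) = 0) ∧
    ∀ y₁ y₂ y₃ y₄, Q (α (frameIncl (y₁, 0)) (frameIncl (y₂, 0)))
      (α (frameIncl (y₃, 0)) (frameIncl (y₄, 0))) = 0

theorem IsFrameForm.trichotomy (h : IsFrameForm Q F K α) (hQ : IsLorentz Q F)
    (hK : ∀ i, K i ≠ 0) (hY : finrank ℝ Y = 2) (hW : finrank ℝ W = Fintype.card ι + 2) :
    IsNormalForm α ∨ IsDiagonalForm Q α ∨ ∃ i, IsNullUmbilic Q α i := by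
  rcases h.normal_or_null hQ hY hW with h1 | ⟨ζ, hζ, hζF, hζα⟩
  · exact Or.inl h1
  · refine Or.inr ?_
    rcases h.umbilic_or_diagonal hQ hK hY hW hζ hζF hζα with ⟨i, hi⟩ | ⟨h1, h2⟩
    · right
      rw [frameIncl_single] at hi
      refine ⟨i, fun z hz ↦ by rw [hi, hz, zero_smul], fun z p ↦ ?_⟩
      have := hi (0, Pi.single i 1)
      rw [frameIncl_single] at this
      rw [this]
      simp [hζα]
    · left
      refine ⟨fun y i ↦ ?_, fun i j hij ↦ ?_, fun y₁ y₂ y₃ y₄ ↦ ?_⟩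
      · rw [← frameIncl_single, h1]
        simp
      · rw [← frameIncl_single, ← frameIncl_single, h2 i j hij]
      · simp [h1, hζ]

/-- The forms of one type: either all the rotations of `α` are normal or all are diagonal. -/
theorem IsFrameForm.dichotomy (h : IsFrameForm Q F K α) (hQ : IsLorentz Q F)
    (hK : ∀ i, K i ≠ 0) (hY : finrank ℝ Y = 2) (hW : finrank ℝ W = Fintype.card ι + 2) :
    (∀ θ, IsNormalForm (α.compl₁₂ (frameRotation θ) (frameRotation θ))) ∨
      ∀ θ, IsDiagonalForm Q (α.compl₁₂ (frameRotation θ) (frameRotation θ)) := by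
  let B : (ι → ℝ) → (Y × (ι → ℝ) × (ι → ℝ)) → (Y × (ι → ℝ) × (ι → ℝ)) → W := fun θ p q ↦
    α (frameRotation θ p) (frameRotation θ q)
  have hB1 : ∀ p q w, ContDiff ℝ ω fun θ ↦ Q (B θ p q) w := fun p q w ↦
    contDiff_frameRotation_bilin (α.compr₂ (Q.flip w)) p q
  have hB2 : ∀ p q p' q', ContDiff ℝ ω fun θ ↦ Q (B θ p q) (B θ p' q') := fun p q p' q' ↦
    (Q.toContinuousBilinearMap.contDiff.comp (contDiff_frameRotation_bilin α p q)).clm_apply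
      (contDiff_frameRotation_bilin α p' q')
  -- Each alternative becomes a family of scalar equations in `θ`. Vector equations are tested
  -- against all `w`, which suffices as `Q` is nondegenerate.
  let S : Option (Option ι) → Set ((ι → ℝ) → ℝ)
    | none => {f | ∃ z b w, f = fun θ ↦ Q (B θ (frameIncl z) (0, 0, b)) w}
    | some none =>
        {f | ∃ y i w, f = fun θ ↦ Q (B θ (frameIncl (y, 0)) (framePlane i 1 0)) w} ∪
        {f | ∃ i j w, i ≠ j ∧ f = fun θ ↦ Q (B θ (framePlane i 1 0) (framePlane j 1 0)) w} ∪
        {f | ∃ y₁ y₂ y₃ y₄, f = fun θ ↦ Q (B θ (frameIncl (y₁, 0)) (frameIncl (y₂, 0)))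
          (B θ (frameIncl (y₃, 0)) (frameIncl (y₄, 0)))}
    | some (some i) =>
        {f | ∃ z w, z.2 i = 0 ∧ f = fun θ ↦ Q (B θ (framePlane i 1 0) (frameIncl z)) w} ∪
        {f | ∃ z p, f = fun θ ↦ Q (B θ (framePlane i 1 0) (framePlane i 1 0))
          (B θ (frameIncl z) p)}
  have hS : ∀ c, ∀ f ∈ S c, ContDiff ℝ ω f := by
    rintro (_ | _ | i) f hf
    · obtain ⟨z, b, w, rfl⟩ := hf
      exact hB1 _ _ _
    · rcases hf with (⟨y, i, w, rfl⟩ | ⟨i, j, w, _, rfl⟩) | ⟨y₁, y₂, y₃, y₄, rfl⟩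
      · exact hB1 _ _ _
      · exact hB1 _ _ _
      · exact hB2 _ _ _ _
    · rcases hf with ⟨z, w, _, rfl⟩ | ⟨z, p, rfl⟩
      · exact hB1 _ _ _
      · exact hB2 _ _ _ _
  have hzero : ∀ θ, ∃ c, ∀ f ∈ S c, f θ = 0 := by
    intro θ
    rcases (h.rotate θ).trichotomy hQ hK hY hW with h1 | ⟨h1, h2, h3⟩ | ⟨i, h1, h2⟩
    · refine ⟨none, ?_⟩
      rintro _ ⟨z, b, w, rfl⟩
      have := h1 z b
      rw [LinearMap.compl₁₂_apply] at this
      simp [B, this]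
    · refine ⟨some none, ?_⟩
      rintro _ ((⟨y, i, w, rfl⟩ | ⟨i, j, w, hij, rfl⟩) | ⟨y₁, y₂, y₃, y₄, rfl⟩)
      · have := h1 y i
        rw [LinearMap.compl₁₂_apply] at this
        simp [B, this]
      · have := h2 i j hij
        rw [LinearMap.compl₁₂_apply] at this
        simp [B, this]
      · exact h3 y₁ y₂ y₃ y₄
    · refine ⟨some (some i), ?_⟩
      rintro _ (⟨z, w, hz, rfl⟩ | ⟨z, p, rfl⟩)
      · have := h1 z hz
        rw [LinearMap.compl₁₂_apply] at this
        simp [B, this]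
      · exact h2 z p
  obtain ⟨c, hc⟩ := ContDiff.exists_forall_eq_zero S hS hzero
  rcases c with _ | _ | i
  · exact Or.inl fun θ z b ↦ hQ.nondegenerate _ fun w ↦ hc _ ⟨z, b, w, rfl⟩ θ
  · refine Or.inr fun θ ↦ ⟨fun y i ↦ hQ.nondegenerate _ fun w ↦ hc _ (Or.inl (Or.inl ⟨y, i, w, rfl⟩)) θ,
      fun i j hij ↦ hQ.nondegenerate _ fun w ↦ hc _ (Or.inl (Or.inr ⟨i, j, w, hij, rfl⟩)) θ,
      fun y₁ y₂ y₃ y₄ ↦ hc _ (Or.inr ⟨y₁, y₂, y₃, y₄, rfl⟩) θ⟩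
  · refine absurd (fun θ ↦ ⟨fun z hz ↦ ?_, fun z p ↦ ?_⟩)
      (h.not_forall_isNullUmbilic hQ hK hY hW i)
    · exact hQ.nondegenerate _ fun w ↦ hc _ (Or.inl ⟨z, w, hz, rfl⟩) θ
    · exact hc _ (Or.inr ⟨z, p, rfl⟩) θ

/-- A form on a product of planes, of which one is flat and the others are not, is adapted to the
product. The other planes are umbilic, or the flat plane is umbilic with a null value. -/
theorem IsFrameForm.adapted (h : IsFrameForm Q F K α) (hQ : IsLorentz Q F)
    (hK : ∀ i, K i ≠ 0) (hY : finrank ℝ Y = 2) (hW : finrank ℝ W = Fintype.card ι + 2) :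
    (∀ y i a b, α (frameIncl (y, 0)) (framePlane i a b) = 0) ∧
    (∀ i j, i ≠ j → ∀ a b c d, α (framePlane i a b) (framePlane j c d) = 0) ∧
    ((∀ i, α (framePlane i 1 0) (framePlane i 0 1) = 0 ∧
        α (framePlane i 0 1) (framePlane i 0 1) = α (framePlane i 1 0) (framePlane i 1 0)) ∨
      ∀ y₁ y₂ y₃ y₄, Q (α (frameIncl (y₁, 0)) (frameIncl (y₂, 0)))
        (α (frameIncl (y₃, 0)) (frameIncl (y₄, 0))) = 0) := by
  have hYadd : ∀ i, (∀ y, α (frameIncl (y, 0)) (framePlane i 1 0) = 0) →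
      (∀ y, α (frameIncl (y, 0)) (framePlane i 0 1) = 0) →
      ∀ y a b, α (frameIncl (y, 0)) (framePlane i a b) = 0 := by
    intro i h1 h2 y a b
    rw [framePlane_eq]
    simp [h1, h2]
  rcases h.dichotomy hQ hK hY hW with hall | hall
  · have hv : ∀ θ y i, α (frameIncl (y, 0)) (frameRotation θ (framePlane i 0 1)) = 0 := by
      intro θ y i
      have := hall θ (y, 0) (Pi.single i 1)
      rw [LinearMap.compl₁₂_apply, frameRotation_incl_fst] at this
      simpa [framePlane] using this
    have huv : ∀ θ i j, α (frameRotation θ (framePlane i 1 0))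
        (frameRotation θ (framePlane j 0 1)) = 0 := by
      intro θ i j
      have := hall θ (0, Pi.single i 1) (Pi.single j 1)
      rw [LinearMap.compl₁₂_apply, frameIncl_single] at this
      simpa [framePlane] using this
    simp only [frameRotation_framePlane] at hv huv
    refine ⟨fun y i a b ↦ hYadd i (fun y ↦ ?_) (fun y ↦ ?_) y a b, fun i j hij ↦ ?_, Or.inl ?_⟩
    · simpa using hv (fun _ ↦ -(Real.pi / 2)) y i
    · simpa using hv 0 y i
    · refine framePlane_bilin_eq_zero ?_ ?_ ?_ ?_
      -- Rotating the plane `j` alone by `-π/2` takes `v j` to `u j` and fixes `u i`.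
      · simpa [hij, hij.symm] using huv (Pi.single j (-(Real.pi / 2))) i j
      · simpa using huv 0 i j
      · rw [h.symm]
        simpa using huv 0 j i
      · simpa [hij, hij.symm] using huv (Pi.single i (Real.pi / 2)) i j
    · intro i
      have h0 : α (framePlane i 1 0) (framePlane i 0 1) = 0 := by simpa using huv 0 i i
      refine ⟨h0, ?_⟩
      -- At angle `π/4`, the relation `α(u i, v i) = 0` becomes equality of the two diagonal values.
      have h1 := huv (fun _ ↦ Real.pi / 4) i i
      simp only [Real.cos_pi_div_four, Real.sin_pi_div_four, mul_one, mul_zero, sub_zero, add_zero,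
        zero_sub, zero_add] at h1
      rw [framePlane_eq, framePlane_eq i (-(√2 / 2))] at h1
      have h2 : (√2 / 2 * (√2 / 2)) • (α (framePlane i 0 1) (framePlane i 0 1) -
          α (framePlane i 1 0) (framePlane i 1 0)) = 0 := by
        rw [← h1]
        simp only [map_add, map_smul, LinearMap.add_apply, LinearMap.smul_apply, h0,
          h.symm (framePlane i 0 1) (framePlane i 1 0)]
        module
      have h3 : √2 / 2 * (√2 / 2) ≠ 0 := by positivity
      exact sub_eq_zero.1 ((smul_eq_zero.1 h2).resolve_left h3)
  · have hv : ∀ θ y i, α (frameIncl (y, 0)) (frameRotation θ (framePlane i 1 0)) = 0 := by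
      intro θ y i
      have := (hall θ).1 y i
      rwa [LinearMap.compl₁₂_apply, frameRotation_incl_fst] at this
    have huv : ∀ θ i j, i ≠ j → α (frameRotation θ (framePlane i 1 0))
        (frameRotation θ (framePlane j 1 0)) = 0 := fun θ i j hij ↦ (hall θ).2.1 i j hij
    simp only [frameRotation_framePlane] at hv huv
    refine ⟨fun y i a b ↦ hYadd i (fun y ↦ ?_) (fun y ↦ ?_) y a b, fun i j hij ↦ ?_, Or.inr ?_⟩
    · simpa using hv 0 y i
    · simpa using hv (fun _ ↦ Real.pi / 2) y i
    · refine framePlane_bilin_eq_zero ?_ ?_ ?_ ?_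
      · simpa using huv 0 i j hij
      · simpa [hij, hij.symm] using huv (Pi.single j (Real.pi / 2)) i j hij
      · simpa [hij, hij.symm] using huv (Pi.single i (Real.pi / 2)) i j hij
      · simpa using huv (fun _ ↦ Real.pi / 2) i j hij
    · intro y₁ y₂ y₃ y₄
      simpa using (hall 0).2.2 y₁ y₂ y₃ y₄

end PlaneProduct

/-! ### Directions of the flat factor outside the chosen plane -/

section PlaneProduct

open Module

variable {Y ι W : Type*} [NormedAddCommGroup Y] [InnerProductSpace ℝ Y] [Fintype ι]
  [NormedAddCommGroup W] [NormedSpace ℝ W]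
  {Q : W →ₗ[ℝ] W →ₗ[ℝ] ℝ} {F : W} {K : ι → ℝ}
  {α : (Y × (ι → ℝ) × (ι → ℝ)) →ₗ[ℝ] (Y × (ι → ℝ) × (ι → ℝ)) →ₗ[ℝ] W}

/-- Otherwise `w` is not null, and `p`, `w` and the `ξ i` form a basis of `W`. Expanding `r` and `m`
in it gives `r = p` and `m = 0`, so `Q p p = Q m m = 0` and `p` is orthogonal to everything. In the
application `p`, `r`, `m` are the values of `α` on an orthonormal basis of `Y`, and `Q p r = Q m m`
is the flatness of `Y`. -/
theorem IsLorentz.eq_zero_of_orthogonal_family [FiniteDimensional ℝ W] (hQ : IsLorentz Q F)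
    (hW : finrank ℝ W = Fintype.card ι + 2) {ξ : ι → W} (hξ : ∀ i, Q (ξ i) (ξ i) ≠ 0)
    (hξξ : ∀ i j, i ≠ j → Q (ξ i) (ξ j) = 0) {p r m w : W} (hpξ : ∀ i, Q p (ξ i) = 0)
    (hrξ : ∀ i, Q r (ξ i) = 0) (hmξ : ∀ i, Q m (ξ i) = 0) (hwξ : ∀ i, Q w (ξ i) = 0)
    (hpF : Q p F = 1) (hrF : Q r F = 1) (hmF : Q m F = 0) (hwF : Q w F = 0) (hwp : Q w p = 0)
    (hwr : Q w r = 0) (hwm : Q w m = 0) (hprm : Q p r = Q m m) : w = 0 := by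
  classical
  by_contra hw
  have hww : Q w w ≠ 0 := fun h0 ↦
    hw (hQ.eq_zero (z := p) (by rw [hQ.symm, hpF]; exact one_ne_zero) hwF h0 hwp)
  have hp0 : p ≠ 0 := by
    rintro rfl
    simp at hpF
  let e : Option (Option ι) → W
    | none => p
    | some none => w
    | some (some i) => ξ i
  have hsum : ∀ c : Option (Option ι) → ℝ, ∑ i, c i • e i =
      c none • p + (c (some none) • w + ∑ i, c (some (some i)) • ξ i) := fun c ↦ by
    rw [Fintype.sum_option, Fintype.sum_option]
  have hcoef : ∀ (c : Option (Option ι) → ℝ) (x : W), ∑ i, c i • e i = x →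
      (∀ i, Q x (ξ i) = 0) → Q x w = 0 → x = c none • p := by
    intro c x hx h1 h2
    rw [hsum] at hx
    have h3 : ∀ i, c (some (some i)) = 0 := by
      intro i
      have := h1 i
      rw [← hx] at this
      simp only [map_add, map_smul, LinearMap.add_apply, LinearMap.smul_apply, hpξ, hwξ, map_sum,
        LinearMap.sum_apply, smul_eq_mul, mul_zero, zero_add] at this
      rw [Finset.sum_eq_single i (fun j _ hj ↦ by rw [hξξ j i hj, mul_zero]) (by simp)] at this
      exact (mul_eq_zero.1 this).resolve_right (hξ i)
    have h4 : c (some none) = 0 := by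
      have := h2
      rw [← hx] at this
      simpa [h3, hQ.symm p w, hwp, hww] using this
    rw [← hx, h4]
    simp [h3]
  have he : LinearIndependent ℝ e := by
    rw [Fintype.linearIndependent_iff]
    intro c hc
    have h1 := hcoef c 0 hc (by simp) (by simp)
    have h2 : c none = 0 := (smul_eq_zero.1 h1.symm).resolve_right hp0
    have h3 : c (some none) = 0 := by
      rw [hsum, h2, zero_smul, zero_add] at hc
      have := congrArg (fun x ↦ Q x w) hc
      simpa [hQ.symm _ w, hwξ, hww] using this
    rw [hsum, h2, h3, zero_smul, zero_smul, zero_add, zero_add] at hc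
    rintro (_ | _ | i)
    · exact h2
    · exact h3
    · have := congrArg (fun x ↦ Q x (ξ i)) hc
      simp only [map_sum, LinearMap.sum_apply, map_smul, LinearMap.smul_apply, smul_eq_mul,
        map_zero, LinearMap.zero_apply] at this
      rw [Finset.sum_eq_single i (fun j _ hj ↦ by rw [hξξ j i hj, mul_zero]) (by simp)] at this
      exact (mul_eq_zero.1 this).resolve_right (hξ i)
  have hspan := he.span_eq_top_of_card_eq_finrank' (by simp [hW])
  have hex : ∀ x, ∃ c : Option (Option ι) → ℝ, ∑ i, c i • e i = x := fun x ↦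
    (Submodule.mem_span_range_iff_exists_fun ℝ).1 (hspan ▸ Submodule.mem_top)
  have hr : r = p := by
    obtain ⟨c, hc⟩ := hex r
    have h1 := hcoef c r hc hrξ (by rw [hQ.symm, hwr])
    have h2 : c none = 1 := by
      rw [h1] at hrF
      simpa [hpF] using hrF
    rw [h1, h2, one_smul]
  have hm : m = 0 := by
    obtain ⟨c, hc⟩ := hex m
    have h1 := hcoef c m hc hmξ (by rw [hQ.symm, hwm])
    have h2 : c none = 0 := by
      rw [h1] at hmF
      simpa [hpF] using hmF
    rw [h1, h2, zero_smul]
  rw [hr, hm] at hprm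
  refine hp0 (hQ.nondegenerate p fun x ↦ ?_)
  obtain ⟨c, rfl⟩ := hex x
  rw [hsum]
  simp only [map_zero] at hprm
  simp [hprm, hQ.symm p w, hwp, hpξ]

variable [DecidableEq ι]

theorem IsFrameForm.gauss_framePlane (h : IsFrameForm Q F K α) (i : ι) :
    Q (α (framePlane i 1 0) (framePlane i 1 0)) (α (framePlane i 0 1) (framePlane i 0 1)) -
      Q (α (framePlane i 1 0) (framePlane i 0 1)) (α (framePlane i 1 0) (framePlane i 0 1)) =
        K i := by
  have := h.gauss (framePlane i 1 0) (framePlane i 0 1) (framePlane i 0 1) (framePlane i 1 0)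
  rw [h.symm (framePlane i 0 1) (framePlane i 1 0)] at this
  rw [this, frameCurvature, Finset.sum_eq_single i]
  · simp [framePlane]
  · intro j _ hj
    simp [framePlane, hj]
  · simp

variable [FiniteDimensional ℝ Y] [FiniteDimensional ℝ W]

/-- The Gauss equations determine the second fundamental form in the direction of an additional
vector `X` tangent to the same factor as `Y`; here `τ p` is the value at `X` and `p`. -/
theorem IsFrameForm.extension_eq_zero (h : IsFrameForm Q F K α) (hQ : IsLorentz Q F)
    (hK : ∀ i, K i ≠ 0) (hY : finrank ℝ Y = 2) (hW : finrank ℝ W = Fintype.card ι + 2)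
    (τ : (Y × (ι → ℝ) × (ι → ℝ)) →ₗ[ℝ] W) (hτF : ∀ i a b, Q (τ (framePlane i a b)) F = 0)
    (hτ : ∀ q r s, q.1 = 0 ∨ r.1 = 0 ∨ s.1 = 0 → Q (τ s) (α q r) = Q (τ r) (α q s)) (i : ι) :
    τ (framePlane i 1 0) = 0 := by
  obtain ⟨hadY, had, hcases⟩ := h.adapted hQ hK hY hW
  have horthY : ∀ y y' i a b c d, Q (α (frameIncl (y, 0)) (frameIncl (y', 0)))
      (α (framePlane i a b) (framePlane i c d)) = 0 := by
    intro y y' i a b c d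
    have := h.gauss (frameIncl (y, 0)) (framePlane i a b) (framePlane i c d) (frameIncl (y', 0))
    rw [hadY, map_zero, LinearMap.zero_apply, sub_zero] at this
    rw [this]
    simp [frameCurvature, frameIncl_apply]
  have horth : ∀ i j, i ≠ j → ∀ a b c d a' b' c' d',
      Q (α (framePlane i a b) (framePlane i c d))
        (α (framePlane j a' b') (framePlane j c' d')) = 0 := by
    intro i j hij a b c d a' b' c' d'
    have := h.gauss (framePlane i a b) (framePlane j a' b') (framePlane j c' d')
      (framePlane i c d)
    rw [had i j hij, map_zero, LinearMap.zero_apply, sub_zero] at this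
    rw [this]
    refine Finset.sum_eq_zero fun l _ ↦ ?_
    by_cases hl : l = i
    · subst hl
      simp [framePlane, hij]
    · simp [framePlane, hl]
  have hτY : ∀ i a b y y',
      Q (τ (framePlane i a b)) (α (frameIncl (y, 0)) (frameIncl (y', 0))) = 0 := by
    intro i a b y y'
    rw [hτ _ _ _ (Or.inr (Or.inr rfl)), hadY, map_zero]
  have hτj : ∀ i j, i ≠ j → ∀ a b a' b' c' d',
      Q (τ (framePlane i a b)) (α (framePlane j a' b') (framePlane j c' d')) = 0 := by
    intro i j hij a b a' b' c' d'
    rw [hτ _ _ _ (Or.inl rfl), had j i hij.symm, map_zero]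
  have hτi : ∀ a b a' b' c' d',
      Q (τ (framePlane i a b)) (α (framePlane i a' b') (framePlane i c' d')) =
        Q (τ (framePlane i c' d')) (α (framePlane i a' b') (framePlane i a b)) :=
    fun a b a' b' c' d' ↦ hτ _ _ _ (Or.inl rfl)
  have hyF : ∀ y y', Q (α (frameIncl (y, 0)) (frameIncl (y', 0))) F = ⟪y, y'⟫ := by
    intro y y'
    rw [h.pair]
    simp [frameInner, frameIncl_apply]
  let B := (stdOrthonormalBasis ℝ Y).reindex (finCongr hY)
  rcases hcases with humb | hnull
  · refine hQ.eq_zero_of_orthogonal_family hW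
      (ξ := fun j ↦ α (framePlane j 1 0) (framePlane j 1 0)) ?_ ?_
      (p := α (frameIncl (B 0, 0)) (frameIncl (B 0, 0)))
      (r := α (frameIncl (B 1, 0)) (frameIncl (B 1, 0)))
      (m := α (frameIncl (B 0, 0)) (frameIncl (B 1, 0)))
      (fun i ↦ horthY _ _ _ _ _ _ _) (fun i ↦ horthY _ _ _ _ _ _ _)
      (fun i ↦ horthY _ _ _ _ _ _ _) ?_ ?_ ?_ ?_ (hτF _ _ _) (hτY _ _ _ _ _) (hτY _ _ _ _ _)
      (hτY _ _ _ _ _) ?_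
    · intro j
      have := h.gauss_framePlane j
      rw [(humb j).1, (humb j).2, map_zero, sub_zero] at this
      rw [this]
      exact hK j
    · exact fun j l hjl ↦ horth j l hjl _ _ _ _ _ _ _ _
    · intro j
      by_cases hij : i = j
      · subst hij
        -- Umbilicity replaces `α(u i, u i)` by `α(v i, v i)`; the exchange relation for `τ` then
        -- produces `α(v i, u i) = 0`.
        rw [← (humb i).2, hτi, h.symm, (humb i).1, map_zero]
      · exact hτj i j hij _ _ _ _ _ _
    · simp [hyF]
    · simp [hyF]
    · simp [hyF]
    · have := h.gauss (frameIncl (B 0, 0)) (frameIncl (B 1, 0)) (frameIncl (B 1, 0))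
        (frameIncl (B 0, 0))
      rw [h.symm (frameIncl (B 1, 0)) (frameIncl (B 0, 0))] at this
      rw [← sub_eq_zero, this]
      simp [frameCurvature, frameIncl_apply]
  · set ζ := α (frameIncl (B 0, 0)) (frameIncl (B 0, 0)) with hζdef
    have hζ : Q ζ ζ = 0 := hnull _ _ _ _
    have hζF : Q ζ F = 1 := by
      rw [hyF]
      simp
    have hFζ : Q F ζ = 1 := by rw [hQ.symm, hζF]
    have hζα : ∀ i a b c d, Q ζ (α (framePlane i a b) (framePlane i c d)) = 0 :=
      fun i a b c d ↦ horthY _ _ _ _ _ _ _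
    set U := orthogonalPair Q F ζ with hU
    have hUdim : finrank ℝ U = Fintype.card ι := by
      have := finrank_orthogonalPair hQ.symm hQ.null hζ (p := F) (r := ζ) (by simp [hFζ])
      rw [← hU] at this
      omega
    have hUan : ∀ w ∈ U, Q w w = 0 → w = 0 := by
      intro w hw hww
      rw [mem_orthogonalPair] at hw
      exact hQ.eq_zero (z := ζ) (by simp [hFζ]) (by rw [hQ.symm, hw.1]) hww (by rw [hQ.symm, hw.2])
    -- Modulo `ζ`, the plane `j` contributes a form with values in the anisotropic `k`-dimensional
    -- space `U`. The `k` contributions are mutually orthogonal and non-zero as `K j ≠ 0`, so each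
    -- fills exactly one line, and `τ` of the plane `i` lies in the `i`-th line.
    let β : ι → (ℝ × ℝ) → (ℝ × ℝ) → W := fun j s t ↦
      α (framePlane j s.1 s.2) (framePlane j t.1 t.2) -
        frameInner (framePlane j s.1 s.2) (framePlane j t.1 t.2 : Y × (ι → ℝ) × (ι → ℝ)) • ζ
    have hβ : ∀ j s t, β j s t = α (framePlane j s.1 s.2) (framePlane j t.1 t.2) -
        frameInner (framePlane j s.1 s.2) (framePlane j t.1 t.2 : Y × (ι → ℝ) × (ι → ℝ)) • ζ :=
      fun _ _ _ ↦ rfl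
    have hβU : ∀ j s t, β j s t ∈ U := by
      intro j s t
      rw [mem_orthogonalPair, hβ]
      simp [hζα, hζ, hQ.symm F, h.pair, hζF]
    have hβα : ∀ j s t w, Q ζ w = 0 → Q w (β j s t) =
        Q w (α (framePlane j s.1 s.2) (framePlane j t.1 t.2)) := by
      intro j s t w hw
      rw [hβ, map_sub, map_smul, hQ.symm w ζ, hw, smul_zero, sub_zero]
    have hζβ : ∀ j s t, Q ζ (β j s t) = 0 := fun j s t ↦ (mem_orthogonalPair.1 (hβU j s t)).2
    have hββ : ∀ j s t l s' t', Q (β j s t) (β l s' t') =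
        Q (α (framePlane j s.1 s.2) (framePlane j t.1 t.2))
          (α (framePlane l s'.1 s'.2) (framePlane l t'.1 t'.2)) := by
      intro j s t l s' t'
      rw [hβα l _ _ _ (hζβ _ _ _), hQ.symm, hβα j _ _ _ (hζα _ _ _ _ _), hQ.symm]
    have hKβ : ∀ j, Q (β j (1, 0) (1, 0)) (β j (0, 1) (0, 1)) -
        Q (β j (1, 0) (0, 1)) (β j (1, 0) (0, 1)) = K j := by
      intro j
      rw [hββ, hββ, h.gauss_framePlane]
    have hne : ∀ j, ∃ s t, β j s t ≠ 0 := by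
      by_contra! hc
      obtain ⟨j, hj⟩ := hc
      have := hKβ j
      simp only [hj, map_zero, sub_zero] at this
      exact hK j this.symm
    choose s t hst using hne
    let e : ι → U := fun j ↦ ⟨β j (s j) (t j), hβU _ _ _⟩
    have heval : ∀ j, (e j : W) = β j (s j) (t j) := fun _ ↦ rfl
    have hee : ∀ j, Q (e j) (e j) ≠ 0 := fun j h0 ↦ hst j (hUan _ (e j).2 h0)
    have hej : ∀ j l, j ≠ l → Q (e j) (e l) = 0 := by
      intro j l hjl
      rw [heval, heval, hββ]
      exact horth j l hjl _ _ _ _ _ _ _ _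
    have hsum : ∀ (c : ι → ℝ) i, Q (∑ j, c j • (e j : W)) (e i) = c i * Q (e i) (e i) := by
      intro c i
      simp only [map_sum, LinearMap.sum_apply, map_smul, LinearMap.smul_apply, smul_eq_mul]
      rw [Finset.sum_eq_single i (fun j _ hj ↦ by rw [hej j i hj, mul_zero]) (by simp)]
    have he : LinearIndependent ℝ e := by
      rw [Fintype.linearIndependent_iff]
      intro c hc i
      have h1 := hsum c i
      have h2 : ∑ j, c j • (e j : W) = 0 := by
        have := congrArg Subtype.val hc
        simpa using this
      rw [h2, map_zero, LinearMap.zero_apply] at h1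
      exact (mul_eq_zero.1 h1.symm).resolve_right (hee i)
    have hspan := he.span_eq_top_of_card_eq_finrank' hUdim.symm
    have hmul : ∀ w ∈ U, (∀ j, i ≠ j → Q w (e j) = 0) → ∃ c : ℝ, w = c • (e i : W) := by
      intro w hw hwe
      have h1 : (⟨w, hw⟩ : U) ∈ Submodule.span ℝ (range e) := by
        rw [hspan]
        exact Submodule.mem_top
      obtain ⟨c, hc⟩ := (Submodule.mem_span_range_iff_exists_fun ℝ).1 h1
      have h2 : ∑ j, c j • (e j : W) = w := by
        have := congrArg Subtype.val hc
        simpa using this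
      refine ⟨c i, ?_⟩
      rw [← h2, Finset.sum_eq_single i ?_ (by simp)]
      intro j _ hj
      have h3 := hsum c j
      rw [h2, hwe j hj.symm] at h3
      rw [(mul_eq_zero.1 h3.symm).resolve_right (hee j), zero_smul]
    have hτU : ∀ a b, τ (framePlane i a b) ∈ U := by
      intro a b
      rw [mem_orthogonalPair, hQ.symm, hτF, hQ.symm ζ]
      exact ⟨rfl, hτY _ _ _ _ _⟩
    have hτe : ∀ a b, ∃ c : ℝ, τ (framePlane i a b) = c • (e i : W) := by
      intro a b
      refine hmul _ (hτU a b) fun j hij ↦ ?_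
      rw [heval, hβα _ _ _ _ (mem_orthogonalPair.1 (hτU a b)).2]
      exact hτj i j hij _ _ _ _ _ _
    have hβe : ∀ s t, ∃ c : ℝ, β i s t = c • (e i : W) := by
      intro s t
      refine hmul _ (hβU _ _ _) fun j hij ↦ ?_
      rw [heval, hββ]
      exact horth i j hij _ _ _ _ _ _ _ _
    obtain ⟨c, hc⟩ := hτe 1 0
    obtain ⟨d, hd⟩ := hτe 0 1
    obtain ⟨A, hA⟩ := hβe (1, 0) (1, 0)
    obtain ⟨C, hC⟩ := hβe (0, 1) (0, 1)
    obtain ⟨D, hD⟩ := hβe (1, 0) (0, 1)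
    have hDsymm : β i (0, 1) (1, 0) = β i (1, 0) (0, 1) := by
      rw [hβ, hβ, h.symm]
      simp [frameInner, framePlane]
    have hK' := hKβ i
    have hτβ : ∀ a b s t, Q (τ (framePlane i a b)) (β i s t) =
        Q (τ (framePlane i a b)) (α (framePlane i s.1 s.2) (framePlane i t.1 t.2)) :=
      fun a b s t ↦ hβα _ _ _ _ (mem_orthogonalPair.1 (hτU a b)).2
    have h1 : Q (τ (framePlane i 1 0)) (β i (1, 0) (0, 1)) =
        Q (τ (framePlane i 0 1)) (β i (1, 0) (1, 0)) := by
      rw [hτβ, hτβ, hτi]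
    have h2 : Q (τ (framePlane i 1 0)) (β i (0, 1) (0, 1)) =
        Q (τ (framePlane i 0 1)) (β i (1, 0) (0, 1)) := by
      rw [← hDsymm, hτβ, hτβ, hτi]
    rw [hA, hC, hD] at hK'
    rw [hc, hd, hD, hA] at h1
    rw [hc, hd, hC, hD] at h2
    simp only [map_smul, LinearMap.smul_apply, smul_eq_mul] at hK' h1 h2
    -- Along the line of `e i`, `β i` has the matrix `(A, D; D, C)` with `(A C - D²) Q(e, e) = K i`,
    -- and `τ` has coordinates `(c, d)`. The exchange relations read `c D = d A` and `c C = d D`, up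
    -- to the factor `Q(e, e)`; eliminating `d` gives the claim.
    have h3 : c * K i = 0 := by
      rw [← hK']
      linear_combination A * h2 - D * h1
    rw [hc, (mul_eq_zero.1 h3).resolve_right (hK i), zero_smul]

end PlaneProduct

/-! ## Second fundamental forms of products -/

section ProductForm

open Module

theorem exists_orthonormal_pair {E : Type*} [AddCommGroup E] [Module ℝ E] (G : E →ₗ[ℝ] E →ₗ[ℝ] ℝ)
    (hpos : ∀ v, v ≠ 0 → 0 < G v v) {u v : E} (hu : u ≠ 0)
    (hv : ∀ t : ℝ, v ≠ t • u) :
    ∃ c d e : ℝ, c ≠ 0 ∧ e ≠ 0 ∧ G (c • u) (c • u) = 1 ∧ G (c • u) (d • u + e • v) = 0 ∧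
      G (d • u + e • v) (d • u + e • v) = 1 := by
  have h1 := hpos u hu
  set t := G u v / G u u with ht
  have htu : t * G u u = G u v := by
    rw [ht]
    field_simp
  have h2 := hpos (v - t • u) (sub_ne_zero.2 (hv t))
  set a := G u u with ha
  set b := G (v - t • u) (v - t • u) with hb
  have hsa : (√a)⁻¹ * ((√a)⁻¹ * a) = 1 := by
    have : √a * √a = a := Real.mul_self_sqrt h1.le
    field_simp
    rw [sq, this]
  have hsb : (√b)⁻¹ * ((√b)⁻¹ * b) = 1 := by
    have : √b * √b = b := Real.mul_self_sqrt h2.le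
    field_simp
    rw [sq, this]
  have hw : (-((√b)⁻¹ * t)) • u + (√b)⁻¹ • v = (√b)⁻¹ • (v - t • u) := by module
  refine ⟨(√a)⁻¹, -((√b)⁻¹ * t), (√b)⁻¹, by positivity, by positivity, ?_, ?_, ?_⟩
  · simp only [map_smul, LinearMap.smul_apply, smul_eq_mul, ← ha, hsa]
  · rw [hw]
    simp only [map_smul, LinearMap.smul_apply, smul_eq_mul, map_sub, ← ha]
    rw [← htu]
    ring
  · rw [hw]
    simp only [map_smul G, map_smul (G (v - t • u)), LinearMap.smul_apply, smul_eq_mul, ← hb, hsb]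

variable {k : ℕ} {E : Fin (k + 1) → Type*} [∀ i, AddCommGroup (E i)] [∀ i, Module ℝ (E i)]

/-- The linear map from an orthogonal sum of planes to a product given by an orthonormal pair in
each factor. -/
def frameMap (u v : ∀ i, E i) :
    (EuclideanSpace ℝ (Fin 2) × (Fin k → ℝ) × (Fin k → ℝ)) →ₗ[ℝ] ∀ i, E i where
  toFun p i := (Fin.cons (p.1 0) p.2.1 : Fin (k + 1) → ℝ) i • u i +
    (Fin.cons (p.1 1) p.2.2 : Fin (k + 1) → ℝ) i • v i
  map_add' p q := by
    ext i
    refine Fin.cases ?_ (fun i ↦ ?_) i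
    · simp only [Pi.add_apply, Fin.cons_zero, Prod.fst_add, PiLp.add_apply]
      module
    · simp only [Pi.add_apply, Fin.cons_succ, Prod.fst_add, Prod.snd_add]
      module
  map_smul' c p := by
    ext i
    refine Fin.cases ?_ (fun i ↦ ?_) i
    · simp only [Pi.smul_apply, Fin.cons_zero, Prod.smul_fst, PiLp.smul_apply, RingHom.id_apply,
        smul_eq_mul]
      module
    · simp only [Pi.smul_apply, Fin.cons_succ, Prod.smul_fst, Prod.smul_snd, RingHom.id_apply,
        smul_eq_mul]
      module

theorem frameMap_zero (u v : ∀ i, E i) (p : EuclideanSpace ℝ (Fin 2) × (Fin k → ℝ) × (Fin k → ℝ)) :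
    frameMap u v p 0 = p.1 0 • u 0 + p.1 1 • v 0 := rfl

theorem frameMap_succ (u v : ∀ i, E i) (p : EuclideanSpace ℝ (Fin 2) × (Fin k → ℝ) × (Fin k → ℝ))
    (i : Fin k) : frameMap u v p i.succ = p.2.1 i • u i.succ + p.2.2 i • v i.succ := rfl

theorem frameMap_framePlane (u v : ∀ i, E i) (i : Fin k) :
    frameMap u v (framePlane i 1 0) = Pi.single i.succ (u i.succ) := by
  ext j
  refine Fin.cases ?_ (fun j ↦ ?_) j
  · rw [frameMap_zero]
    simp [framePlane, (Fin.succ_ne_zero i).symm]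
  · rw [frameMap_succ]
    by_cases hj : j = i
    · subst hj
      simp [framePlane]
    · simp [framePlane, hj]

variable {W : Type*} [NormedAddCommGroup W] [NormedSpace ℝ W]

/-- `α` is a symmetric bilinear form on a product which satisfies the Gauss equation of an isometric
immersion of a Riemannian product, with metrics `G i` and curvature tensors `R i`, into the light
cone. -/
structure IsProductForm (Q : W →ₗ[ℝ] W →ₗ[ℝ] ℝ) (F : W) (G : ∀ i, E i →ₗ[ℝ] E i →ₗ[ℝ] ℝ)
    (R : ∀ i, E i → E i → E i → E i → ℝ) (α : (∀ i, E i) →ₗ[ℝ] (∀ i, E i) →ₗ[ℝ] W) : Prop where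
  lorentz : IsLorentz Q F
  symm_metric : ∀ i u v, G i u v = G i v u
  pos_metric : ∀ i v, v ≠ 0 → 0 < G i v v
  symm : ∀ X Y, α X Y = α Y X
  pair : ∀ X Y, Q (α X Y) F = ∑ i, G i (X i) (Y i)
  gauss : ∀ X Y Z V, Q (α X V) (α Y Z) - Q (α X Z) (α Y V) = ∑ i, R i (X i) (Y i) (Z i) (V i)
  curvature_zero : ∀ i a b c d, a = 0 ∨ b = 0 ∨ c = 0 ∨ d = 0 → R i a b c d = 0

variable {Q : W →ₗ[ℝ] W →ₗ[ℝ] ℝ} {F : W} {G : ∀ i, E i →ₗ[ℝ] E i →ₗ[ℝ] ℝ}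
  {R : ∀ i, E i → E i → E i → E i → ℝ} {α : (∀ i, E i) →ₗ[ℝ] (∀ i, E i) →ₗ[ℝ] W}

theorem IsProductForm.curvature_eq (h : IsProductForm Q F G R α) (i : Fin (k + 1)) (a b c d : E i) :
    R i a b c d = Q (α (Pi.single i a) (Pi.single i d)) (α (Pi.single i b) (Pi.single i c)) -
      Q (α (Pi.single i a) (Pi.single i c)) (α (Pi.single i b) (Pi.single i d)) := by
  rw [h.gauss, Finset.sum_eq_single i]
  · simp
  · intro j _ hj
    exact h.curvature_zero _ _ _ _ _ (Or.inl (by simp [hj]))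
  · simp

/-- The Gauss equation expresses `R i` through the symmetric form `α`, so on a plane it scales by
the two coordinate determinants. No symmetry of `R` has to be assumed separately. -/
theorem IsProductForm.curvature_plane (h : IsProductForm Q F G R α) (i : Fin (k + 1)) (u v : E i)
    (a b a' b' c d c' d' : ℝ) :
    R i (a • u + b • v) (a' • u + b' • v) (c • u + d • v) (c' • u + d' • v) =
      R i u v v u * ((a * b' - a' * b) * (d * c' - c * d')) := by
  have hs : ∀ s t : ℝ, Pi.single i (s • u + t • v) =
      s • (Pi.single i u : ∀ i, E i) + t • (Pi.single i v : ∀ i, E i) := fun s t ↦ by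
    rw [Pi.single_add, Pi.single_smul, Pi.single_smul]
  simp only [h.curvature_eq, hs, map_add, map_smul, LinearMap.add_apply, LinearMap.smul_apply,
    smul_eq_mul, h.symm (Pi.single i v) (Pi.single i u),
    h.lorentz.symm (α (Pi.single i v) (Pi.single i v)),
    h.lorentz.symm (α (Pi.single i u) (Pi.single i v)) (α (Pi.single i u) (Pi.single i u))]
  ring

/-- The pull-back to an orthonormal frame. -/
theorem IsProductForm.isFrameForm (h : IsProductForm Q F G R α) {u v : ∀ i, E i}
    (huu : ∀ i, G i (u i) (u i) = 1) (huv : ∀ i, G i (u i) (v i) = 0)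
    (hvv : ∀ i, G i (v i) (v i) = 1) (h0 : R 0 (u 0) (v 0) (v 0) (u 0) = 0) :
    IsFrameForm Q F (fun i : Fin k ↦ R i.succ (u i.succ) (v i.succ) (v i.succ) (u i.succ))
      (α.compl₁₂ (frameMap u v) (frameMap u v)) where
  symm p q := h.symm _ _
  pair p q := by
    have hG : ∀ i (a b a' b' : ℝ), G i (a • u i + b • v i) (a' • u i + b' • v i) =
        a * a' + b * b' := fun i a b a' b' ↦ by
      simp only [map_add, map_smul, LinearMap.add_apply, LinearMap.smul_apply, huu, huv, hvv,
        h.symm_metric i (v i) (u i), smul_eq_mul]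
      ring
    rw [LinearMap.compl₁₂_apply, h.pair, Fin.sum_univ_succ]
    simp only [frameMap_zero, frameMap_succ, hG, frameInner, Finset.sum_add_distrib,
      PiLp.inner_apply, Fin.sum_univ_two, dotProduct]
    simp [mul_comm]
    ring
  gauss p q r s := by
    simp only [LinearMap.compl₁₂_apply]
    rw [h.gauss, Fin.sum_univ_succ]
    simp only [frameMap_zero, frameMap_succ, h.curvature_plane, h0, zero_mul, zero_add]
    rfl

/-- The vector `X` need not lie in the flat plane: `extension_eq_zero` is applied to `τ = α X`. Its
exchange relation is the Gauss equation, whose curvature term vanishes once one entry has no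
component in the factor `0`. -/
theorem IsProductForm.adapted_of_orthonormal [FiniteDimensional ℝ W] (h : IsProductForm Q F G R α)
    (hW : finrank ℝ W = k + 2) {u v : ∀ i, E i}
    (huu : ∀ i, G i (u i) (u i) = 1) (huv : ∀ i, G i (u i) (v i) = 0)
    (hvv : ∀ i, G i (v i) (v i) = 1) (h0 : R 0 (u 0) (v 0) (v 0) (u 0) = 0)
    (hR : ∀ i : Fin k, R i.succ (u i.succ) (v i.succ) (v i.succ) (u i.succ) ≠ 0) :
    (∀ X i, α (Pi.single 0 X) (Pi.single (Fin.succ i) (u (Fin.succ i))) = 0) ∧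
      ∀ i j : Fin k, i ≠ j → α (Pi.single i.succ (u i.succ)) (Pi.single j.succ (u j.succ)) = 0 := by
  have hf := h.isFrameForm huu huv hvv h0
  have hY : finrank ℝ (EuclideanSpace ℝ (Fin 2)) = 2 := by simp
  have hW' : finrank ℝ W = Fintype.card (Fin k) + 2 := by simpa using hW
  refine ⟨fun X i ↦ ?_, fun i j hij ↦ ?_⟩
  · have := hf.extension_eq_zero h.lorentz hR hY hW'
      (α (Pi.single 0 X) ∘ₗ frameMap u v) ?_ ?_ i
    · simpa only [LinearMap.comp_apply, frameMap_framePlane] using this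
    · intro j a b
      rw [LinearMap.comp_apply, h.pair]
      refine Finset.sum_eq_zero fun l _ ↦ ?_
      refine Fin.cases ?_ (fun l ↦ ?_) l
      · rw [frameMap_zero]
        simp [framePlane]
      · simp
    · intro q r s hqrs
      simp only [LinearMap.comp_apply, LinearMap.compl₁₂_apply]
      rw [← sub_eq_zero, h.gauss]
      refine Finset.sum_eq_zero fun l _ ↦ h.curvature_zero _ _ _ _ _ ?_
      refine Fin.cases ?_ (fun l ↦ ?_) l
      · right
        simp only [frameMap_zero]
        rcases hqrs with h1 | h1 | h1
        · exact Or.inl (by simp [h1])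
        · exact Or.inr (Or.inl (by simp [h1]))
        · exact Or.inr (Or.inr (by simp [h1]))
      · left
        simp
  · have := (hf.adapted h.lorentz hR hY hW').2.1 i j hij 1 0 1 0
    simpa only [LinearMap.compl₁₂_apply, frameMap_framePlane] using this

theorem IsProductForm.exists_orthonormal (h : IsProductForm Q F G R α) (i : Fin (k + 1))
    {u v : E i} (hu : u ≠ 0) (hv : ∀ t : ℝ, v ≠ t • u) :
    ∃ (c : ℝ) (w : E i), c ≠ 0 ∧ G i (c • u) (c • u) = 1 ∧ G i (c • u) w = 0 ∧ G i w w = 1 ∧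
      (R i (c • u) w w (c • u) = 0 ↔ R i u v v u = 0) := by
  obtain ⟨c, d, e, hc, he, h1, h2, h3⟩ :=
    exists_orthonormal_pair (G i) (h.pos_metric i) hu hv
  refine ⟨c, d • u + e • v, hc, h1, h2, h3, ?_⟩
  have h4 := h.curvature_plane i u v c 0 d e d e c 0
  rw [zero_smul, add_zero] at h4
  rw [h4]
  simp [hc, he]

theorem IsProductForm.ne_of_curvature_ne_zero (h : IsProductForm Q F G R α) (i : Fin (k + 1))
    {u v : E i} (huv : R i u v v u ≠ 0) : u ≠ 0 ∧ ∀ t : ℝ, v ≠ t • u := by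
  refine ⟨fun hu ↦ huv (h.curvature_zero _ _ _ _ _ (Or.inl hu)), fun t hv ↦ huv ?_⟩
  have h4 := h.curvature_plane i u 0 1 0 t 0 t 0 1 0
  rw [hv]
  simpa using h4

/-- Non-vanishing of `R u v v u` is open in `u`, and an open neighbourhood of a vector spans. -/
theorem IsProductForm.span_eq_top (h : IsProductForm Q F G R α) (i : Fin (k + 1))
    (hR : ∃ u v, R i u v v u ≠ 0) : Submodule.span ℝ {u | ∃ v, R i u v v u ≠ 0} = ⊤ := by
  obtain ⟨u, v, huv⟩ := hR
  rw [eq_top_iff]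
  intro X _
  have hmem : ∀ x ∈ {u | ∃ v, R i u v v u ≠ 0}, x ∈ Submodule.span ℝ {u | ∃ v, R i u v v u ≠ 0} :=
    fun x hx ↦ Submodule.subset_span hx
  have hcont : Continuous fun t : ℝ ↦ R i (u + t • X) v v (u + t • X) := by
    simp only [h.curvature_eq, Pi.single_add, Pi.single_smul, map_add, map_smul,
      LinearMap.add_apply, LinearMap.smul_apply, smul_eq_mul]
    fun_prop
  have hev : ∀ᶠ t in nhds (0 : ℝ), R i (u + t • X) v v (u + t • X) ≠ 0 :=
    hcont.continuousAt.eventually_ne (by simpa using huv)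
  obtain ⟨t, ht, ht0⟩ :=
    ((hev.filter_mono nhdsWithin_le_nhds).and (self_mem_nhdsWithin (s := {(0 : ℝ)}ᶜ))).exists
  have ht0' : t ≠ 0 := ht0
  have hX : X = t⁻¹ • ((u + t • X) - u) := by
    rw [add_sub_cancel_left, smul_smul, inv_mul_cancel₀ ht0', one_smul]
  rw [hX]
  exact Submodule.smul_mem _ _ (Submodule.sub_mem _ (hmem _ ⟨v, ht⟩) (hmem _ ⟨v, huv⟩))

/-- A form on a product, one factor of which has a flat plane while the others are not flat, is
adapted to the product. -/
theorem IsProductForm.adapted [FiniteDimensional ℝ W] (h : IsProductForm Q F G R α) (hW : finrank ℝ W = k + 2)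
    (h0 : ∃ u v, u ≠ 0 ∧ (∀ t : ℝ, v ≠ t • u) ∧ R 0 u v v u = 0)
    (hR : ∀ i, i ≠ 0 → ∃ u v, R i u v v u ≠ 0) (i j : Fin (k + 1)) (hij : i ≠ j) (X : E i)
    (Y : E j) : α (Pi.single i X) (Pi.single j Y) = 0 := by
  obtain ⟨u₀, v₀, hu₀, hv₀, h00⟩ := h0
  obtain ⟨c₀, w₀, _, h1, h2, h3, h4⟩ := h.exists_orthonormal 0 hu₀ hv₀
  -- Each `u i` lying in some plane of non-zero curvature is completed to an orthonormal pair of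
  -- that plane. The normalisation only rescales `u i`, so the conclusion passes back to it.
  have key : ∀ u : ∀ i : Fin k, E i.succ, (∀ i, ∃ v, R i.succ (u i) v v (u i) ≠ 0) →
      (∀ X i, α (Pi.single 0 X) (Pi.single (Fin.succ i) (u i)) = 0) ∧
      ∀ i j : Fin k, i ≠ j → α (Pi.single i.succ (u i)) (Pi.single j.succ (u j)) = 0 := by
    intro u hu
    choose v hv using hu
    choose c w hc hcc hcw hww hiff using fun i ↦
      h.exists_orthonormal i.succ (h.ne_of_curvature_ne_zero _ (hv i)).1
        (h.ne_of_curvature_ne_zero _ (hv i)).2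
    have := h.adapted_of_orthonormal hW (u := Fin.cons (c₀ • u₀) fun i ↦ c i • u i)
      (v := Fin.cons w₀ w) (Fin.cases h1 hcc) (Fin.cases h2 hcw) (Fin.cases h3 hww) (h4.2 h00)
      (fun i ↦ fun h0 ↦ hv i ((hiff i).1 h0))
    simp only [Fin.cons_succ, Pi.single_smul, map_smul, LinearMap.smul_apply] at this
    refine ⟨fun X i ↦ (smul_eq_zero.1 (this.1 X i)).resolve_left (hc i), fun i j hij ↦ ?_⟩
    exact (smul_eq_zero.1 ((smul_eq_zero.1 (this.2 i j hij)).resolve_left (hc _))).resolve_left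
      (hc _)
  choose u' v' huv' using fun i : Fin k ↦ hR i.succ (Fin.succ_ne_zero i)
  have hspan : ∀ i : Fin k, ∀ x : E i.succ,
      x ∈ Submodule.span ℝ {u | ∃ v, R i.succ u v v u ≠ 0} := fun i x ↦ by
    rw [h.span_eq_top i.succ ⟨_, _, huv' i⟩]
    exact Submodule.mem_top
  have hup : ∀ (u : ∀ i : Fin k, E i.succ) (i : Fin k) (x : E i.succ),
      (∀ i, ∃ v, R i.succ (u i) v v (u i) ≠ 0) → (∃ v, R i.succ x v v x ≠ 0) →
      ∀ j, ∃ v, R j.succ (Function.update u i x j) v v (Function.update u i x j) ≠ 0 := by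
    intro u i x hu hx j
    by_cases hj : j = i
    · subst hj
      simpa using hx
    · simpa [hj] using hu j
  have hker : ∀ (i : Fin k) (A : E i.succ →ₗ[ℝ] W),
      (∀ x, (∃ v, R i.succ x v v x ≠ 0) → A x = 0) → A = 0 := by
    intro i A hA
    refine LinearMap.ext fun x ↦ ?_
    have hle : Submodule.span ℝ {u | ∃ v, R i.succ u v v u ≠ 0} ≤ LinearMap.ker A :=
      Submodule.span_le.2 fun y hy ↦ hA y hy
    exact hle (hspan i x)
  have hu' : ∀ i, ∃ v, R i.succ (u' i) v v (u' i) ≠ 0 := fun i ↦ ⟨_, huv' i⟩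
  have hA0 : ∀ (X : E 0) (j : Fin k) (Y : E j.succ),
      α (Pi.single 0 X) (Pi.single j.succ Y) = 0 := by
    intro X j Y
    refine DFunLike.congr_fun (hker j (α (Pi.single 0 X) ∘ₗ LinearMap.single ℝ E j.succ) ?_) Y
    intro x hx
    simpa using (key _ (hup u' j x hu' hx)).1 X j
  have hAij : ∀ (i j : Fin k), i ≠ j → ∀ (X : E i.succ) (Y : E j.succ),
      α (Pi.single i.succ X) (Pi.single j.succ Y) = 0 := by
    intro i j hij X Y
    refine DFunLike.congr_fun
      (hker j (α (Pi.single i.succ X) ∘ₗ LinearMap.single ℝ E j.succ) fun y hy ↦ ?_) Y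
    refine DFunLike.congr_fun
      (hker i (α.flip (Pi.single j.succ y) ∘ₗ LinearMap.single ℝ E i.succ) fun x hx ↦ ?_) X
    -- Only the components `i` and `j` of the reference family `u'` are replaced, by `x` and `y`,
    -- since `key` needs a vector in every factor.
    have := (key _ (hup _ j y (hup u' i x hu' hx) hy)).2 i j hij
    simpa [hij] using this
  induction i using Fin.cases with
  | zero =>
    induction j using Fin.cases with
    | zero => exact absurd rfl hij
    | succ j => exact hA0 X j Y
  | succ i =>
    induction j using Fin.cases with
    | zero =>
      rw [h.symm]
      exact hA0 Y i X
    | succ j => exact hAij i j (fun e ↦ hij (by rw [e])) X Y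

end ProductForm

/-! ## Christoffel symbols and the Gauss equation -/

section Christoffel

open Module

variable {E : Type*} [NormedAddCommGroup E] [NormedSpace ℝ E]

theorem koszulForm_apply (D : E →L[ℝ] E →L[ℝ] E →L[ℝ] ℝ) (u v w : E) :
    ((1 / 2 : ℝ) • (D u v + D v u - (D.flip u).flip v)) w =
      1 / 2 * (D u v w + D v u w - D w u v) :=
  rfl

theorem christoffel_add_left (G : E → E →L[ℝ] E →L[ℝ] ℝ) (y u u' v : E) :
    christoffel G y (u + u') v = christoffel G y u v + christoffel G y u' v := by
  rw [christoffel, christoffel, christoffel, ← map_add]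
  congr 1
  refine ContinuousLinearMap.ext fun c ↦ ?_
  rw [add_apply, koszulForm_apply, koszulForm_apply, koszulForm_apply, (fderiv ℝ G y).map_add,
    (fderiv ℝ G y v).map_add, (fderiv ℝ G y c).map_add, add_apply, add_apply, add_apply, add_apply]
  ring

theorem christoffel_smul_left (G : E → E →L[ℝ] E →L[ℝ] ℝ) (y : E) (r : ℝ) (u v : E) :
    christoffel G y (r • u) v = r • christoffel G y u v := by
  rw [christoffel, christoffel, ← map_smul]
  congr 1
  refine ContinuousLinearMap.ext fun c ↦ ?_
  rw [koszulForm_apply, smul_apply, koszulForm_apply, (fderiv ℝ G y).map_smul,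
    (fderiv ℝ G y v).map_smul, (fderiv ℝ G y c).map_smul, smul_apply, smul_apply, smul_apply,
    smul_apply]
  simp only [smul_eq_mul]
  ring

theorem christoffel_add_right (G : E → E →L[ℝ] E →L[ℝ] ℝ) (y u v v' : E) :
    christoffel G y u (v + v') = christoffel G y u v + christoffel G y u v' := by
  rw [christoffel, christoffel, christoffel, ← map_add]
  congr 1
  refine ContinuousLinearMap.ext fun c ↦ ?_
  rw [add_apply, koszulForm_apply, koszulForm_apply, koszulForm_apply, (fderiv ℝ G y).map_add,
    (fderiv ℝ G y u).map_add, (fderiv ℝ G y c u).map_add, add_apply, add_apply, add_apply]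
  ring

theorem christoffel_smul_right (G : E → E →L[ℝ] E →L[ℝ] ℝ) (y : E) (r : ℝ) (u v : E) :
    christoffel G y u (r • v) = r • christoffel G y u v := by
  rw [christoffel, christoffel, ← map_smul]
  congr 1
  refine ContinuousLinearMap.ext fun c ↦ ?_
  rw [koszulForm_apply, smul_apply, koszulForm_apply, (fderiv ℝ G y).map_smul,
    (fderiv ℝ G y u).map_smul, (fderiv ℝ G y c u).map_smul, smul_apply, smul_apply, smul_apply]
  simp only [smul_eq_mul]
  ring

@[simp]
theorem christoffel_zero_left (G : E → E →L[ℝ] E →L[ℝ] ℝ) (y v : E) : christoffel G y 0 v = 0 := by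
  simpa using christoffel_smul_left G y 0 0 v

@[simp]
theorem christoffel_zero_right (G : E → E →L[ℝ] E →L[ℝ] ℝ) (y v : E) :
    christoffel G y v 0 = 0 := by
  simpa using christoffel_smul_right G y 0 v 0

theorem chartCurvature_eq_zero (G : E → E →L[ℝ] E →L[ℝ] ℝ) (y u v w : E)
    (h : u = 0 ∨ v = 0 ∨ w = 0) : chartCurvature G y u v w = 0 := by
  rcases h with rfl | rfl | rfl <;> simp [chartCurvature]

theorem apply_christoffel {G : E → E →L[ℝ] E →L[ℝ] ℝ} {y : E} (hG : (G y).IsInvertible)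
    (u v w : E) : G y (christoffel G y u v) w =
      1 / 2 * (fderiv ℝ G y u v w + fderiv ℝ G y v u w - fderiv ℝ G y w u v) := by
  rw [christoffel, hG.self_apply_inverse, koszulForm_apply]

set_option maxSynthPendingDepth 3 in
theorem DifferentiableAt.koszulForm {D : E → E →L[ℝ] E →L[ℝ] E →L[ℝ] ℝ} {y : E}
    (hD : DifferentiableAt ℝ D y) (u v : E) : DifferentiableAt ℝ
      (fun z ↦ (1 / 2 : ℝ) • (D z u v + D z v u - ((D z).flip u).flip v)) y := by
  have h1 : ∀ u v, DifferentiableAt ℝ (fun z ↦ D z u v) y := fun u v ↦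
    (hD.clm_apply (differentiableAt_const u)).clm_apply (differentiableAt_const v)
  have h2 : DifferentiableAt ℝ (fun z ↦ ((D z).flip u).flip v) y :=
    (differentiableAt_const (ContinuousLinearMap.apply ℝ ℝ v)).clm_comp
      ((differentiableAt_const (ContinuousLinearMap.apply ℝ (E →L[ℝ] ℝ) u)).clm_comp hD)
  exact (((h1 u v).add (h1 v u)).sub h2).const_smul (1 / 2 : ℝ)

set_option maxSynthPendingDepth 3 in
theorem differentiableAt_christoffel [CompleteSpace E] {G : E → E →L[ℝ] E →L[ℝ] ℝ} {y : E}
    (hG : (G y).IsInvertible) (hG' : ContDiffAt ℝ 2 G y) (u v : E) :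
    DifferentiableAt ℝ (fun z ↦ christoffel G z u v) y := by
  have h1 : ContDiffAt ℝ 1 (fun z ↦ (G z).inverse) y := by
    obtain ⟨e, he⟩ := hG
    have := contDiffAt_map_inverse (n := 1) e
    rw [he] at this
    exact this.comp y (hG'.of_le one_le_two)
  have h2 : DifferentiableAt ℝ (fderiv ℝ G) y :=
    (hG'.fderiv_right (m := 1) (by norm_num)).differentiableAt one_ne_zero
  exact (h1.differentiableAt one_ne_zero).clm_apply (h2.koszulForm u v)

theorem ContinuousLinearMap.isInvertible_of_pos [FiniteDimensional ℝ E] {B : E →L[ℝ] E →L[ℝ] ℝ}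
    (hB : ∀ v, v ≠ 0 → 0 < B v v) : B.IsInvertible := by
  have hinj : Function.Injective B.toLinearMap := by
    rw [← LinearMap.ker_eq_bot, LinearMap.ker_eq_bot']
    intro v hv
    by_contra h0
    have h1 := hB v h0
    have h2 : B v = 0 := hv
    rw [h2] at h1
    simp at h1
  have hdim : finrank ℝ E = finrank ℝ (E →L[ℝ] ℝ) := by
    rw [← (LinearMap.toContinuousLinearMap : (E →ₗ[ℝ] ℝ) ≃ₗ[ℝ] (E →L[ℝ] ℝ)).finrank_eq]
    exact Subspace.dual_finrank_eq.symm
  exact ⟨(LinearMap.linearEquivOfInjective B.toLinearMap hinj hdim).toContinuousLinearEquiv, rfl⟩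

theorem ContinuousAt.eventually_isInvertible {F X : Type*} [NormedAddCommGroup F] [NormedSpace ℝ F]
    [CompleteSpace E] [TopologicalSpace X] {B : X → E →L[ℝ] F} {x : X} (hB : ContinuousAt B x)
    (hx : (B x).IsInvertible) : ∀ᶠ z in nhds x, (B z).IsInvertible := by
  obtain ⟨e, he⟩ := hx
  have := e.nhds
  rw [he] at this
  exact hB this

end Christoffel

/-! ### Koszul formula and Gauss equation in coordinates -/

section Gauss

variable {E W : Type*} [NormedAddCommGroup E] [NormedSpace ℝ E] [NormedAddCommGroup W]
  [NormedSpace ℝ W] {Q : W →L[ℝ] W →L[ℝ] ℝ}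

theorem fderiv_bilin_apply (Q : W →L[ℝ] W →L[ℝ] ℝ) {f g : E → W} {x : E}
    (hf : DifferentiableAt ℝ f x) (hg : DifferentiableAt ℝ g x) (a : E) :
    fderiv ℝ (fun z ↦ Q (f z) (g z)) x a = Q (fderiv ℝ f x a) (g x) + Q (f x) (fderiv ℝ g x a) := by
  rw [(Q.hasFDerivAt_of_bilinear hf.hasFDerivAt hg.hasFDerivAt).fderiv]
  simp [add_comm]

theorem fderiv_fderiv_symm {Φ : E → W} {z : E} (hΦ : ContDiffAt ℝ 2 Φ z) (a b : E) :
    fderiv ℝ (fderiv ℝ Φ) z a b = fderiv ℝ (fderiv ℝ Φ) z b a :=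
  (hΦ.isSymmSndFDerivAt (by simp)).eq a b

theorem fderiv_fderiv_apply {V : Type*} [NormedAddCommGroup V] [NormedSpace ℝ V] {Φ : E → V →L[ℝ] W}
    {z : E} (hΦ : DifferentiableAt ℝ Φ z) (a : E) (b : V) :
    fderiv ℝ (fun z ↦ Φ z b) z a = fderiv ℝ Φ z a b := by
  rw [fderiv_clm_apply hΦ (differentiableAt_const b)]
  simp

/-- The Koszul formula. -/
theorem koszul (hQ : ∀ v w, Q v w = Q w v) {Φ : E → W} {z : E} (hΦ : ContDiffAt ℝ 2 Φ z)
    (a b c : E) : Q (fderiv ℝ (fderiv ℝ Φ) z a b) (fderiv ℝ Φ z c) = 1 / 2 *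
      (fderiv ℝ (fun x ↦ Q (fderiv ℝ Φ x b) (fderiv ℝ Φ x c)) z a +
        fderiv ℝ (fun x ↦ Q (fderiv ℝ Φ x a) (fderiv ℝ Φ x c)) z b -
        fderiv ℝ (fun x ↦ Q (fderiv ℝ Φ x a) (fderiv ℝ Φ x b)) z c) := by
  have h1 : DifferentiableAt ℝ (fderiv ℝ Φ) z :=
    (hΦ.fderiv_right (m := 1) (by norm_num)).differentiableAt one_ne_zero
  have h2 : ∀ b, DifferentiableAt ℝ (fun x ↦ fderiv ℝ Φ x b) z := fun b ↦
    h1.clm_apply (differentiableAt_const b)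
  rw [fderiv_bilin_apply Q (h2 b) (h2 c), fderiv_bilin_apply Q (h2 a) (h2 c),
    fderiv_bilin_apply Q (h2 a) (h2 b)]
  simp only [fderiv_fderiv_apply h1]
  rw [fderiv_fderiv_symm hΦ b a, fderiv_fderiv_symm hΦ c a, fderiv_fderiv_symm hΦ c b,
    hQ (fderiv ℝ (fderiv ℝ Φ) z a c), hQ (fderiv ℝ Φ z a)]
  ring

/-- The Gauss equation for a map `Φ` into a vector space with a symmetric form `Q`; `Γ` is the
Levi-Civita connection of the induced metric. -/
theorem gauss_equation (hQ : ∀ v w, Q v w = Q w v) {Φ : E → W} {y : E} (hΦ : ContDiffAt ℝ 3 Φ y)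
    {Γ : E → E → E → E} (hΓ : ∀ b c, DifferentiableAt ℝ (fun z ↦ Γ z b c) y)
    (hconn : ∀ᶠ z in nhds y, ∀ a b c, Q (fderiv ℝ (fderiv ℝ Φ) z a b) (fderiv ℝ Φ z c) =
      Q (fderiv ℝ Φ z (Γ z a b)) (fderiv ℝ Φ z c)) (a b c d : E) :
    Q (fderiv ℝ Φ y (fderiv ℝ (fun z ↦ Γ z b c) y a - fderiv ℝ (fun z ↦ Γ z a c) y b +
      Γ y a (Γ y b c) - Γ y b (Γ y a c))) (fderiv ℝ Φ y d) =
    Q (fderiv ℝ (fderiv ℝ Φ) y a d - fderiv ℝ Φ y (Γ y a d))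
        (fderiv ℝ (fderiv ℝ Φ) y b c - fderiv ℝ Φ y (Γ y b c)) -
      Q (fderiv ℝ (fderiv ℝ Φ) y a c - fderiv ℝ Φ y (Γ y a c))
        (fderiv ℝ (fderiv ℝ Φ) y b d - fderiv ℝ Φ y (Γ y b d)) := by
  have h1 : ContDiffAt ℝ 2 (fderiv ℝ Φ) y := hΦ.fderiv_right (by norm_num)
  have h1d : DifferentiableAt ℝ (fderiv ℝ Φ) y := h1.differentiableAt two_ne_zero
  have h2d : DifferentiableAt ℝ (fderiv ℝ (fderiv ℝ Φ)) y :=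
    (h1.fderiv_right (m := 1) (by norm_num)).differentiableAt one_ne_zero
  have hcy := hconn.self_of_nhds
  have hnormal : ∀ a b c, Q (fderiv ℝ (fderiv ℝ Φ) y a b - fderiv ℝ Φ y (Γ y a b))
      (fderiv ℝ Φ y c) = 0 := by
    intro a b c
    rw [map_sub, sub_apply, hcy, sub_self]
  -- Differentiate in the direction `a` the orthogonality of the normal part of the Hessian at `(b,
  -- c)` to the image of `d`. Antisymmetrising in `a` and `b` cancels the third derivatives of `Φ`
  -- and leaves the curvature of `Γ`.
  have key : ∀ a b c d, Q (fderiv ℝ (fderiv ℝ (fderiv ℝ Φ)) y a b c) (fderiv ℝ Φ y d) -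
      Q (fderiv ℝ Φ y (Γ y a (Γ y b c))) (fderiv ℝ Φ y d) -
      Q (fderiv ℝ Φ y (fderiv ℝ (fun z ↦ Γ z b c) y a)) (fderiv ℝ Φ y d) +
      Q (fderiv ℝ (fderiv ℝ Φ) y b c - fderiv ℝ Φ y (Γ y b c))
        (fderiv ℝ (fderiv ℝ Φ) y a d - fderiv ℝ Φ y (Γ y a d)) = 0 := by
    intro a b c d
    have hH1 : DifferentiableAt ℝ (fun z ↦ fderiv ℝ (fderiv ℝ Φ) z b c) y :=
      (h2d.clm_apply (differentiableAt_const b)).clm_apply (differentiableAt_const c)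
    have hH2 : DifferentiableAt ℝ (fun z ↦ fderiv ℝ Φ z (Γ z b c)) y := h1d.clm_apply (hΓ b c)
    have hd : DifferentiableAt ℝ (fun z ↦ fderiv ℝ Φ z d) y :=
      h1d.clm_apply (differentiableAt_const d)
    have hzero : (fun z ↦ Q (fderiv ℝ (fderiv ℝ Φ) z b c - fderiv ℝ Φ z (Γ z b c))
        (fderiv ℝ Φ z d)) =ᶠ[nhds y] fun _ ↦ 0 := by
      filter_upwards [hconn] with z hz
      rw [map_sub, sub_apply, hz, sub_self]
    have h3 := fderiv_bilin_apply Q (hH1.sub hH2) hd a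
    simp only [Pi.sub_apply] at h3
    rw [hzero.fderiv_eq, fderiv_fderiv_apply h1d] at h3
    have h4 : fderiv ℝ ((fun z ↦ fderiv ℝ (fderiv ℝ Φ) z b c) - fun z ↦ fderiv ℝ Φ z (Γ z b c)) y a =
        fderiv ℝ (fderiv ℝ (fderiv ℝ Φ)) y a b c - (fderiv ℝ (fderiv ℝ Φ) y a (Γ y b c) +
          fderiv ℝ Φ y (fderiv ℝ (fun z ↦ Γ z b c) y a)) := by
      rw [fderiv_sub hH1 hH2, sub_apply, fderiv_clm_apply h1d (hΓ b c),
        fderiv_fderiv_apply (h2d.clm_apply (differentiableAt_const b)), fderiv_fderiv_apply h2d]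
      simp [add_comm]
    rw [h4] at h3
    simp only [fderiv_fun_const, Pi.zero_apply, zero_apply, map_sub, map_add,
      sub_apply, add_apply] at h3
    have h5 := hcy a (Γ y b c) d
    have h6 := hnormal b c (Γ y a d)
    simp only [map_sub, sub_apply] at h6 ⊢
    linarith
  have k1 := key a b c d
  have k2 := key b a c d
  have h7 : fderiv ℝ (fderiv ℝ (fderiv ℝ Φ)) y a b = fderiv ℝ (fderiv ℝ (fderiv ℝ Φ)) y b a :=
    (h1.isSymmSndFDerivAt (by simp)).eq a b
  rw [h7] at k1
  rw [hQ (fderiv ℝ (fderiv ℝ Φ) y b c - _)] at k1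
  rw [map_sub (fderiv ℝ Φ y), map_add (fderiv ℝ Φ y), map_sub (fderiv ℝ Φ y), map_sub Q, map_add Q,
    map_sub Q]
  simp only [sub_apply, add_apply]
  linarith

end Gauss

/-! ## Isometric immersions of products into the light cone -/

section NormalSpace

open Module

variable {U V : Type*} [AddCommGroup U] [Module ℝ U] [AddCommGroup V] [Module ℝ V]

/-- The orthogonal complement, with respect to `Q`, of the range of `D`. -/
def normalSpace (Q : V →ₗ[ℝ] V →ₗ[ℝ] ℝ) (D : U →ₗ[ℝ] V) : Submodule ℝ V :=
  LinearMap.ker ((LinearMap.lcomp ℝ ℝ D) ∘ₗ Q)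

variable {Q : V →ₗ[ℝ] V →ₗ[ℝ] ℝ} {D : U →ₗ[ℝ] V}

theorem mem_normalSpace {w : V} : w ∈ normalSpace Q D ↔ ∀ a, Q w (D a) = 0 := by
  simp [normalSpace, LinearMap.ext_iff]

variable [FiniteDimensional ℝ U] (hD : ∀ a, a ≠ 0 → 0 < Q (D a) (D a))
include hD

theorem exists_tangential_part (u : V) : ∃ a, u - D a ∈ normalSpace Q D := by
  set T : U →ₗ[ℝ] Dual ℝ U := (LinearMap.lcomp ℝ ℝ D) ∘ₗ Q ∘ₗ D with hT
  have hinj : Function.Injective T := by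
    rw [← LinearMap.ker_eq_bot, LinearMap.ker_eq_bot']
    intro a ha
    by_contra h0
    have h1 := DFunLike.congr_fun ha a
    simp only [hT, LinearMap.comp_apply, LinearMap.lcomp_apply, LinearMap.zero_apply] at h1
    exact (hD a h0).ne' h1
  have hsurj : Function.Surjective T :=
    (LinearMap.injective_iff_surjective_of_finrank_eq_finrank Subspace.dual_finrank_eq.symm).1 hinj
  obtain ⟨a, ha⟩ := hsurj (LinearMap.lcomp ℝ ℝ D (Q u))
  refine ⟨a, mem_normalSpace.2 fun b ↦ ?_⟩
  have h1 := DFunLike.congr_fun ha b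
  simp only [hT, LinearMap.comp_apply, LinearMap.lcomp_apply] at h1
  rw [map_sub, LinearMap.sub_apply, h1, sub_self]

theorem finrank_normalSpace [FiniteDimensional ℝ V] :
    finrank ℝ (normalSpace Q D) + finrank ℝ U = finrank ℝ V := by
  have hinj : Function.Injective D := by
    rw [← LinearMap.ker_eq_bot, LinearMap.ker_eq_bot']
    intro a ha
    by_contra h0
    have := hD a h0
    simp [ha] at this
  have hcompl : IsCompl (normalSpace Q D) (LinearMap.range D) := by
    constructor
    · rw [Submodule.disjoint_def]
      rintro _ hx ⟨a, rfl⟩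
      by_contra h0
      exact (hD a fun e ↦ h0 (by simp [e])).ne' (mem_normalSpace.1 hx a)
    · rw [codisjoint_iff, Submodule.eq_top_iff']
      intro u
      obtain ⟨a, ha⟩ := exists_tangential_part hD u
      exact Submodule.mem_sup.2 ⟨_, ha, D a, ⟨a, rfl⟩, by simp⟩
  rw [← Submodule.finrank_add_eq_of_isCompl hcompl, LinearMap.finrank_range_of_inj hinj]

/-- The range of `D` is positive definite, so the whole space splits as range plus complement. This
gives nondegeneracy; the condition on null vectors is inherited by any subspace containing `F`. -/
theorem IsLorentz.normalSpace {F : V} (h : IsLorentz Q F) (hF : F ∈ normalSpace Q D) :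
    IsLorentz (Q.domRestrict₁₂ (normalSpace Q D) (normalSpace Q D)) ⟨F, hF⟩ where
  symm v w := h.symm v w
  nondegenerate v hv := by
    refine Subtype.ext (h.nondegenerate _ fun u ↦ ?_)
    obtain ⟨a, ha⟩ := exists_tangential_part hD u
    have h1 : Q v (u - D a) = 0 := hv ⟨_, ha⟩
    rw [map_sub, mem_normalSpace.1 v.2 a, sub_zero] at h1
    exact h1
  null := h.null
  exists_eq_smul w hw hw' := by
    obtain ⟨c, hc⟩ := h.exists_eq_smul w hw hw'
    exact ⟨c, Subtype.ext hc⟩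

end NormalSpace

/-! ### Isometric maps of products of metrics: connection and Gauss equation -/

section ProductImmersion

open Module Filter Topology

set_option maxSynthPendingDepth 3

variable {ι : Type*} [Fintype ι] {E : ι → Type*}
  [∀ i, NormedAddCommGroup (E i)] [∀ i, NormedSpace ℝ (E i)]
  {V : Type*} [NormedAddCommGroup V] [NormedSpace ℝ V]

/-- Near `y`, the map `Φ` is isometric with respect to the product of the metrics `G i` and the form
`Q`. -/
structure IsProductImmersionAt (Q : V →L[ℝ] V →L[ℝ] ℝ) (G : ∀ i, E i → E i →L[ℝ] E i →L[ℝ] ℝ)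
    (Φ : (∀ i, E i) → V) (y : ∀ i, E i) : Prop where
  symm : ∀ v w, Q v w = Q w v
  contDiffAt : ContDiffAt ℝ 3 Φ y
  isometric : ∀ᶠ z in 𝓝 y, ∀ a b,
    Q (fderiv ℝ Φ z a) (fderiv ℝ Φ z b) = ∑ i, G i (z i) (a i) (b i)
  pos : ∀ i v, v ≠ 0 → 0 < G i (y i) v v

variable {Q : V →L[ℝ] V →L[ℝ] ℝ} {G : ∀ i, E i → E i →L[ℝ] E i →L[ℝ] ℝ} {Φ : (∀ i, E i) → V}
  {y : ∀ i, E i}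

/-- Near `y i`, the metric is the pull-back of `Q` by the restriction of `Φ` to a coordinate slice,
so its regularity follows from that of `Φ`. -/
theorem IsProductImmersionAt.contDiffAt_metric (h : IsProductImmersionAt Q G Φ y) (i : ι) :
    ContDiffAt ℝ 2 (G i) (y i) := by
  classical
  set A : E i → E i →L[ℝ] V := fun w ↦
    (fderiv ℝ Φ (Function.update y i w)).comp (ContinuousLinearMap.single ℝ E i) with hA
  have hupd : ContDiff ℝ 2 (fun w : E i ↦ Function.update y i w) := contDiff_update 2 y i
  have hA' : ContDiffAt ℝ 2 A (y i) := by
    have h1 : ContDiffAt ℝ 2 (fderiv ℝ Φ) (Function.update y i (y i)) := by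
      rw [Function.update_eq_self]
      exact h.contDiffAt.fderiv_right (by norm_num)
    exact (h1.comp (y i) hupd.contDiffAt).clm_comp contDiffAt_const
  have hC : ContDiffAt ℝ 2 (fun w ↦
      ((ContinuousLinearMap.compL ℝ (E i) V ℝ).flip (A w)).comp (Q.comp (A w))) (y i) :=
    (((ContinuousLinearMap.compL ℝ (E i) V ℝ).flip.contDiff.contDiffAt).comp (y i) hA').clm_comp
      (contDiffAt_const.clm_comp hA')
  refine hC.congr_of_eventuallyEq ?_
  have hcont : Tendsto (fun w : E i ↦ Function.update y i w) (𝓝 (y i)) (𝓝 y) := by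
    have := hupd.continuous.tendsto (y i)
    rwa [Function.update_eq_self] at this
  filter_upwards [hcont.eventually h.isometric] with w hw
  ext u v
  have := hw (Pi.single i u) (Pi.single i v)
  rw [Finset.sum_eq_single i (fun j _ hj ↦ by simp [hj]) (by simp)] at this
  simpa [hA] using this.symm

variable [∀ i, FiniteDimensional ℝ (E i)]

theorem IsProductImmersionAt.isInvertible (h : IsProductImmersionAt Q G Φ y) (i : ι) :
    (G i (y i)).IsInvertible :=
  ContinuousLinearMap.isInvertible_of_pos (h.pos i)

/-- The Levi-Civita connection of a product of metrics. -/
noncomputable def productChristoffel (G : ∀ i, E i → E i →L[ℝ] E i →L[ℝ] ℝ) (z a b : ∀ i, E i) :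
    ∀ i, E i :=
  fun i ↦ christoffel (G i) (z i) (a i) (b i)

/-- By the Koszul formula the tangential part of the Hessian depends only on the first derivatives
of the induced metric. Each summand of that metric involves one factor, so the connection acts
factorwise. -/
theorem IsProductImmersionAt.connection (h : IsProductImmersionAt Q G Φ y) :
    ∀ᶠ z in 𝓝 y, ∀ a b c, Q (fderiv ℝ (fderiv ℝ Φ) z a b) (fderiv ℝ Φ z c) =
      Q (fderiv ℝ Φ z (productChristoffel G z a b)) (fderiv ℝ Φ z c) := by
  have h1 : ∀ᶠ z in 𝓝 y, ContDiffAt ℝ 2 Φ z :=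
    (h.contDiffAt.of_le (by norm_num)).eventually (by simp)
  have h2 : ∀ᶠ z in 𝓝 y, ∀ i, DifferentiableAt ℝ (G i) (z i) := eventually_all.2 fun i ↦
    (continuous_apply i).continuousAt.eventually <|
      (((h.contDiffAt_metric i).of_le one_le_two).eventually (by simp)).mono fun z hz ↦
        hz.differentiableAt one_ne_zero
  have h3 : ∀ᶠ z in 𝓝 y, ∀ i, (G i (z i)).IsInvertible := eventually_all.2 fun i ↦
    (continuous_apply i).continuousAt.eventually <|
      (h.contDiffAt_metric i).continuousAt.eventually_isInvertible (h.isInvertible i)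
  filter_upwards [h1, h2, h3, eventually_eventually_nhds.2 h.isometric] with z hz1 hz2 hz3 hz4 a b c
  have hd : ∀ a b c : ∀ i, E i, fderiv ℝ (fun x ↦ Q (fderiv ℝ Φ x b) (fderiv ℝ Φ x c)) z a =
      ∑ i, fderiv ℝ (G i) (z i) (a i) (b i) (c i) := by
    intro a b c
    have he : (fun x ↦ Q (fderiv ℝ Φ x b) (fderiv ℝ Φ x c)) =ᶠ[𝓝 z]
        fun x ↦ ∑ i, G i (x i) (b i) (c i) := hz4.mono fun x hx ↦ hx b c
    have hG : ∀ i, HasFDerivAt (fun x : ∀ i, E i ↦ G i (x i))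
        ((fderiv ℝ (G i) (z i)).comp (ContinuousLinearMap.proj i)) z := fun i ↦
      (hz2 i).hasFDerivAt.comp z (ContinuousLinearMap.proj (R := ℝ) (φ := E) i).hasFDerivAt
    have hG' : ∀ i, DifferentiableAt ℝ (fun x : ∀ i, E i ↦ G i (x i) (b i) (c i)) z := fun i ↦
      ((hG i).differentiableAt.clm_apply (differentiableAt_const _)).clm_apply
        (differentiableAt_const _)
    rw [he.fderiv_eq, fderiv_fun_sum fun i _ ↦ hG' i, sum_apply]
    refine Finset.sum_congr rfl fun i _ ↦ ?_
    rw [fderiv_fderiv_apply ((hG i).differentiableAt.clm_apply (differentiableAt_const _)),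
      fderiv_fderiv_apply (hG i).differentiableAt, (hG i).fderiv]
    rfl
  rw [koszul h.symm hz1, hd, hd, hd, hz4.self_of_nhds, ← Finset.sum_add_distrib,
    ← Finset.sum_sub_distrib, Finset.mul_sum]
  exact Finset.sum_congr rfl fun i _ ↦ (apply_christoffel (hz3 i) _ _ _).symm

theorem IsProductImmersionAt.hasFDerivAt_productChristoffel (h : IsProductImmersionAt Q G Φ y)
    (b c : ∀ i, E i) : HasFDerivAt (fun z ↦ productChristoffel G z b c)
      (ContinuousLinearMap.pi fun i ↦
        (fderiv ℝ (fun w ↦ christoffel (G i) w (b i) (c i)) (y i)).comp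
          (ContinuousLinearMap.proj i)) y := by
  refine hasFDerivAt_pi.2 fun i ↦ ?_
  exact (differentiableAt_christoffel (h.isInvertible i)
    (h.contDiffAt_metric i) (b i) (c i)).hasFDerivAt.comp y
      (ContinuousLinearMap.proj (R := ℝ) (φ := E) i).hasFDerivAt

/-- The second fundamental form `α^Φ(a, b)` of `Φ` at `y`. -/
noncomputable def normalHessian (G : ∀ i, E i → E i →L[ℝ] E i →L[ℝ] ℝ) (Φ : (∀ i, E i) → V)
    (y a b : ∀ i, E i) : V :=
  fderiv ℝ (fderiv ℝ Φ) y a b - fderiv ℝ Φ y (productChristoffel G y a b)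

theorem IsProductImmersionAt.gauss (h : IsProductImmersionAt Q G Φ y) (a b c d : ∀ i, E i) :
    Q (normalHessian G Φ y a d) (normalHessian G Φ y b c) -
      Q (normalHessian G Φ y a c) (normalHessian G Φ y b d) =
    ∑ i, G i (y i) (chartCurvature (G i) (y i) (a i) (b i) (c i)) (d i) := by
  have h1 := gauss_equation h.symm h.contDiffAt
    (fun b c ↦ (h.hasFDerivAt_productChristoffel b c).differentiableAt) h.connection a b c d
  rw [(h.hasFDerivAt_productChristoffel b c).fderiv, (h.hasFDerivAt_productChristoffel a c).fderiv,
    h.isometric.self_of_nhds] at h1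
  exact h1.symm

end ProductImmersion

/-! ### Immersions into the light cone -/

section LightCone

open Module Filter Topology

set_option maxSynthPendingDepth 3

variable {ι : Type*} [Fintype ι] {E : ι → Type*}
  [∀ i, NormedAddCommGroup (E i)] [∀ i, NormedSpace ℝ (E i)]
  {V : Type*} [NormedAddCommGroup V] [NormedSpace ℝ V]
  {Q : V →L[ℝ] V →L[ℝ] ℝ} {G : ∀ i, E i → E i →L[ℝ] E i →L[ℝ] ℝ} {Φ : (∀ i, E i) → V}
  {y : ∀ i, E i}

theorem IsProductImmersionAt.inner_fderiv (h : IsProductImmersionAt Q G Φ y) (a b : ∀ i, E i) :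
    Q (fderiv ℝ Φ y a) (fderiv ℝ Φ y b) = ∑ i, G i (y i) (a i) (b i) :=
  h.isometric.self_of_nhds a b

theorem IsProductImmersionAt.fderiv_apply_null (h : IsProductImmersionAt Q G Φ y)
    (hnull : ∀ᶠ z in 𝓝 y, Q (Φ z) (Φ z) = 0) :
    ∀ᶠ z in 𝓝 y, ∀ a, Q (fderiv ℝ Φ z a) (Φ z) = 0 := by
  have h1 : ∀ᶠ z in 𝓝 y, ContDiffAt ℝ 1 Φ z :=
    (h.contDiffAt.of_le (by norm_num)).eventually (by simp)
  filter_upwards [h1, eventually_eventually_nhds.2 hnull] with z hz hz' a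
  have hd := hz.differentiableAt one_ne_zero
  have h2 := fderiv_bilin_apply Q hd hd a
  have h3 : (fun z ↦ Q (Φ z) (Φ z)) =ᶠ[𝓝 z] fun _ ↦ 0 := hz'
  rw [h3.fderiv_eq, h.symm (Φ z)] at h2
  simp only [fderiv_fun_const, Pi.zero_apply, zero_apply] at h2
  linarith

/-- Differentiating `Q Φ Φ = 0` twice gives this identity. The sign is why the null normal is taken
to be `-Φ`. -/
theorem IsProductImmersionAt.fderiv_fderiv_null (h : IsProductImmersionAt Q G Φ y)
    (hnull : ∀ᶠ z in 𝓝 y, Q (Φ z) (Φ z) = 0) (a b : ∀ i, E i) :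
    Q (fderiv ℝ (fderiv ℝ Φ) y a b) (Φ y) = - ∑ i, G i (y i) (a i) (b i) := by
  have h1 : DifferentiableAt ℝ (fderiv ℝ Φ) y :=
    (h.contDiffAt.fderiv_right (m := 2) (by norm_num)).differentiableAt two_ne_zero
  have h2 := fderiv_bilin_apply Q (h1.clm_apply (differentiableAt_const b))
    (h.contDiffAt.differentiableAt three_ne_zero) a
  have h3 : (fun z ↦ Q (fderiv ℝ Φ z b) (Φ z)) =ᶠ[𝓝 y] fun _ ↦ 0 :=
    (h.fderiv_apply_null hnull).mono fun z hz ↦ hz b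
  rw [h3.fderiv_eq, fderiv_fderiv_apply h1, h.symm (fderiv ℝ Φ y b), h.inner_fderiv] at h2
  simp only [fderiv_fun_const, Pi.zero_apply, zero_apply] at h2
  linarith

theorem IsProductImmersionAt.metric_symm (h : IsProductImmersionAt Q G Φ y) (i : ι) (u v : E i) :
    G i (y i) u v = G i (y i) v u := by
  classical
  have h1 := h.inner_fderiv (Pi.single i u) (Pi.single i v)
  have h2 := h.inner_fderiv (Pi.single i v) (Pi.single i u)
  rw [Finset.sum_eq_single i (fun j _ hj ↦ by simp [hj]) (by simp)] at h1 h2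
  simp only [Pi.single_eq_same] at h1 h2
  rw [← h1, ← h2, h.symm]

theorem IsProductImmersionAt.pos_fderiv (h : IsProductImmersionAt Q G Φ y) (a : ∀ i, E i)
    (ha : a ≠ 0) : 0 < Q (fderiv ℝ Φ y a) (fderiv ℝ Φ y a) := by
  rw [h.inner_fderiv]
  obtain ⟨i, hi⟩ := Function.ne_iff.1 ha
  refine Finset.sum_pos' (fun j _ ↦ ?_) ⟨i, Finset.mem_univ i, h.pos i _ hi⟩
  by_cases hj : a j = 0
  · simp [hj]
  · exact (h.pos j _ hj).le

variable [∀ i, FiniteDimensional ℝ (E i)]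

theorem IsProductImmersionAt.normalHessian_orthogonal (h : IsProductImmersionAt Q G Φ y)
    (a b c : ∀ i, E i) : Q (normalHessian G Φ y a b) (fderiv ℝ Φ y c) = 0 := by
  rw [normalHessian, map_sub, sub_apply, h.connection.self_of_nhds, sub_self]

theorem IsProductImmersionAt.normalHessian_symm (h : IsProductImmersionAt Q G Φ y)
    (a b : ∀ i, E i) : normalHessian G Φ y a b = normalHessian G Φ y b a := by
  have h0 : fderiv ℝ Φ y (productChristoffel G y a b) =
      fderiv ℝ Φ y (productChristoffel G y b a) := by
    congr 1
    refine funext fun i ↦ ?_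
    have hinj : Function.Injective (G i (y i)) := by
      obtain ⟨e, he⟩ := h.isInvertible i
      rw [← he]
      exact e.injective
    refine hinj (ContinuousLinearMap.ext fun w ↦ ?_)
    have h1 := h.connection.self_of_nhds
    have h2 : ∀ a b c, Q (fderiv ℝ Φ y (productChristoffel G y a b)) (fderiv ℝ Φ y c) =
      Q (fderiv ℝ Φ y (productChristoffel G y b a)) (fderiv ℝ Φ y c) := fun a b c ↦ by
      rw [← h1, ← h1, fderiv_fderiv_symm (h.contDiffAt.of_le (by norm_num))]
    classical
    have h3 := h2 a b (Pi.single i w)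
    rw [h.inner_fderiv, h.inner_fderiv,
      Finset.sum_eq_single i (fun j _ hj ↦ by simp [hj]) (by simp),
      Finset.sum_eq_single i (fun j _ hj ↦ by simp [hj]) (by simp)] at h3
    simpa using h3
  rw [normalHessian, normalHessian, h0, fderiv_fderiv_symm (h.contDiffAt.of_le (by norm_num))]

/-- The second fundamental form of `Φ` at `y` as a bilinear map into the normal space. -/
noncomputable def IsProductImmersionAt.secondForm (h : IsProductImmersionAt Q G Φ y) :
    (∀ i, E i) →ₗ[ℝ] (∀ i, E i) →ₗ[ℝ]
      normalSpace Q.toBilinForm (fderiv ℝ Φ y).toLinearMap :=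
  LinearMap.mk₂ ℝ
    (fun a b ↦ ⟨normalHessian G Φ y a b, mem_normalSpace.2 (h.normalHessian_orthogonal a b)⟩)
    (fun a a' b ↦ Subtype.ext <| by
      have : productChristoffel G y (a + a') b =
          productChristoffel G y a b + productChristoffel G y a' b :=
        funext fun i ↦ christoffel_add_left _ _ _ _ _
      simp only [normalHessian, this, map_add, add_apply, Submodule.coe_add]
      abel)
    (fun r a b ↦ Subtype.ext <| by
      have : productChristoffel G y (r • a) b = r • productChristoffel G y a b :=
        funext fun i ↦ christoffel_smul_left _ _ _ _ _
      simp only [normalHessian, this, map_smul, smul_apply, Submodule.coe_smul, smul_sub])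
    (fun a b b' ↦ Subtype.ext <| by
      have : productChristoffel G y a (b + b') =
          productChristoffel G y a b + productChristoffel G y a b' :=
        funext fun i ↦ christoffel_add_right _ _ _ _ _
      simp only [normalHessian, this, map_add, Submodule.coe_add]
      abel)
    (fun r a b ↦ Subtype.ext <| by
      have : productChristoffel G y a (r • b) = r • productChristoffel G y a b :=
        funext fun i ↦ christoffel_smul_right _ _ _ _ _
      simp only [normalHessian, this, map_smul, Submodule.coe_smul, smul_sub])

end LightCone

/-! ### Vanishing of the mixed second derivatives of the lift -/

section LightConeProduct

open Module Filter Topology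

set_option maxSynthPendingDepth 3

variable {k : ℕ} {E : Fin (k + 1) → Type*}
  [∀ i, NormedAddCommGroup (E i)] [∀ i, NormedSpace ℝ (E i)] [∀ i, FiniteDimensional ℝ (E i)]
  {V : Type*} [NormedAddCommGroup V] [NormedSpace ℝ V] [FiniteDimensional ℝ V]
  {Q : V →L[ℝ] V →L[ℝ] ℝ} {G : ∀ i, E i → E i →L[ℝ] E i →L[ℝ] ℝ} {Φ : (∀ i, E i) → V}
  {y : ∀ i, E i}

theorem IsProductImmersionAt.fderiv_fderiv_eq_zero (h : IsProductImmersionAt Q G Φ y)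
    (hnull : ∀ᶠ z in 𝓝 y, Q (Φ z) (Φ z) = 0) (hL : IsLorentz Q.toBilinForm (-Φ y))
    (hdim : finrank ℝ V = ∑ i, finrank ℝ (E i) + k + 2)
    (h0 : ∃ u v, u ≠ 0 ∧ (∀ t : ℝ, v ≠ t • u) ∧
      G 0 (y 0) (chartCurvature (G 0) (y 0) u v v) u = 0)
    (hR : ∀ i, i ≠ 0 → ∃ u v, G i (y i) (chartCurvature (G i) (y i) u v v) u ≠ 0)
    {i j : Fin (k + 1)} (hij : i ≠ j) (X : E i) (Y : E j) :
    fderiv ℝ (fderiv ℝ Φ) y (Pi.single i X) (Pi.single j Y) = 0 := by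
  have hF : -Φ y ∈ normalSpace Q.toBilinForm (fderiv ℝ Φ y).toLinearMap := by
    refine mem_normalSpace.2 fun a ↦ ?_
    have := (h.fderiv_apply_null hnull).self_of_nhds a
    change Q (-Φ y) (fderiv ℝ Φ y a) = 0
    rw [h.symm, map_neg, this, neg_zero]
  have hform : IsProductForm _ ⟨-Φ y, hF⟩ (fun i ↦ (G i (y i)).toBilinForm)
      (fun i a b c d ↦ G i (y i) (chartCurvature (G i) (y i) a b c) d) h.secondForm :=
    { lorentz := hL.normalSpace h.pos_fderiv hF
      symm_metric := h.metric_symm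
      pos_metric := h.pos
      symm := fun X Y ↦ Subtype.ext (h.normalHessian_symm X Y)
      pair := fun X Y ↦ by
        change Q (normalHessian G Φ y X Y) (-Φ y) = ∑ i, G i (y i) (X i) (Y i)
        rw [normalHessian, map_neg, map_sub, sub_apply, h.fderiv_fderiv_null hnull,
          (h.fderiv_apply_null hnull).self_of_nhds]
        ring
      gauss := h.gauss
      curvature_zero := fun i a b c d hz ↦ by
        rcases hz with rfl | rfl | rfl | rfl
        · rw [chartCurvature_eq_zero _ _ _ _ _ (Or.inl rfl), map_zero, zero_apply]
        · rw [chartCurvature_eq_zero _ _ _ _ _ (Or.inr (Or.inl rfl)), map_zero, zero_apply]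
        · rw [chartCurvature_eq_zero _ _ _ _ _ (Or.inr (Or.inr rfl)), map_zero, zero_apply]
        · rw [map_zero] }
  have hrank : finrank ℝ (normalSpace Q.toBilinForm (fderiv ℝ Φ y).toLinearMap) = k + 2 := by
    have h1 := finrank_normalSpace (Q := Q.toBilinForm) (D := (fderiv ℝ Φ y).toLinearMap)
      h.pos_fderiv
    rw [finrank_pi_fintype] at h1
    omega
  have h2 : normalHessian G Φ y (Pi.single i X) (Pi.single j Y) = 0 :=
    congrArg Subtype.val (hform.adapted hrank h0 hR i j hij X Y)
  -- In each factor one of the two arguments is zero, so the Hessian equals its normal part.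
  have h3 : productChristoffel G y (Pi.single i X) (Pi.single j Y) = 0 := by
    refine funext fun l ↦ ?_
    by_cases hl : l = i
    · subst hl
      simp [productChristoffel, hij]
    · simp [productChristoffel, hl]
  rwa [normalHessian, h3, map_zero, sub_zero] at h2

end LightConeProduct

/-! ## Lifting a conformal immersion to the light cone -/

section SecondDerivative

open Filter Topology

set_option maxSynthPendingDepth 3

variable {E F V : Type*} [NormedAddCommGroup E] [NormedSpace ℝ E]
  [NormedAddCommGroup F] [NormedSpace ℝ F] [NormedAddCommGroup V] [NormedSpace ℝ V]

theorem ContDiffAt.differentiableAt_fderiv {f : E → F} {y : E} (hf : ContDiffAt ℝ 2 f y) :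
    DifferentiableAt ℝ (fderiv ℝ f) y :=
  (hf.fderiv_right (m := 1) (by norm_num)).differentiableAt one_ne_zero

theorem ContDiffAt.eventually_differentiableAt {f : E → F} {y : E} (hf : ContDiffAt ℝ 2 f y) :
    ∀ᶠ z in 𝓝 y, DifferentiableAt ℝ f z :=
  ((hf.of_le one_le_two).eventually (by simp)).mono fun _ hz ↦ hz.differentiableAt one_ne_zero

theorem fderiv_fderiv_clm_comp (L : V →L[ℝ] F) {f : E → V} {y : E} (hf : ContDiffAt ℝ 2 f y)
    (a b : E) : fderiv ℝ (fderiv ℝ fun z ↦ L (f z)) y a b = L (fderiv ℝ (fderiv ℝ f) y a b) := by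
  have h0 : ContDiffAt ℝ 2 (fun z ↦ L (f z)) y := L.contDiff.contDiffAt.comp y hf
  rw [← fderiv_fderiv_apply h0.differentiableAt_fderiv]
  have h1 : (fun z ↦ fderiv ℝ (fun z ↦ L (f z)) z b) =ᶠ[𝓝 y] fun z ↦ L (fderiv ℝ f z b) := by
    filter_upwards [hf.eventually_differentiableAt] with z hz
    exact DFunLike.congr_fun (L.hasFDerivAt.comp z hz.hasFDerivAt).fderiv b
  have h2 := hf.differentiableAt_fderiv.clm_apply (differentiableAt_const b)
  rw [h1.fderiv_eq, ← fderiv_fderiv_apply hf.differentiableAt_fderiv]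
  exact DFunLike.congr_fun (L.hasFDerivAt.comp y h2.hasFDerivAt).fderiv a

theorem fderiv_fderiv_smul {l : E → ℝ} {f : E → F} {y : E} (hl : ContDiffAt ℝ 2 l y)
    (hf : ContDiffAt ℝ 2 f y) (a b : E) :
    fderiv ℝ (fderiv ℝ fun z ↦ l z • f z) y a b =
      l y • fderiv ℝ (fderiv ℝ f) y a b + fderiv ℝ l y a • fderiv ℝ f y b +
        fderiv ℝ l y b • fderiv ℝ f y a + fderiv ℝ (fderiv ℝ l) y a b • f y := by
  have h0 : ContDiffAt ℝ 2 (fun z ↦ l z • f z) y := hl.smul hf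
  rw [← fderiv_fderiv_apply h0.differentiableAt_fderiv]
  have h1 : (fun z ↦ fderiv ℝ (fun z ↦ l z • f z) z b) =ᶠ[𝓝 y]
      fun z ↦ l z • fderiv ℝ f z b + fderiv ℝ l z b • f z := by
    filter_upwards [hf.eventually_differentiableAt, hl.eventually_differentiableAt] with z hz hz'
    rw [fderiv_fun_smul hz' hz]
    rfl
  have h2 := hf.differentiableAt_fderiv.clm_apply (differentiableAt_const b)
  have h3 := hl.differentiableAt_fderiv.clm_apply (differentiableAt_const b)
  have h4 := hf.differentiableAt two_ne_zero
  have h5 := hl.differentiableAt two_ne_zero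
  rw [h1.fderiv_eq, fderiv_fun_add (h5.fun_smul h2) (h3.fun_smul h4), fderiv_fun_smul h5 h2,
    fderiv_fun_smul h3 h4]
  simp only [add_apply, smul_apply, ContinuousLinearMap.smulRight_apply,
    fderiv_fderiv_apply hf.differentiableAt_fderiv, fderiv_fderiv_apply hl.differentiableAt_fderiv]
  abel

end SecondDerivative

/-! ### The light cone over Euclidean space -/

section ConeLift

open Module Filter Topology

set_option maxSynthPendingDepth 3

variable {F : Type*} [NormedAddCommGroup F] [InnerProductSpace ℝ F]

/-- The Lorentzian form `⟪p, p'⟫ + a b' + b a'` on `F × ℝ × ℝ`. -/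
noncomputable def coneForm (F : Type*) [NormedAddCommGroup F] [InnerProductSpace ℝ F] :
    (F × ℝ × ℝ) →L[ℝ] (F × ℝ × ℝ) →L[ℝ] ℝ :=
  let B : F →L[ℝ] F →L[ℝ] ℝ := innerSL ℝ
  let p₁ : (F × ℝ × ℝ) →L[ℝ] F := ContinuousLinearMap.fst ℝ F (ℝ × ℝ)
  let p₂ : (F × ℝ × ℝ) →L[ℝ] ℝ :=
    (ContinuousLinearMap.fst ℝ ℝ ℝ).comp (ContinuousLinearMap.snd ℝ F (ℝ × ℝ))
  let p₃ : (F × ℝ × ℝ) →L[ℝ] ℝ :=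
    (ContinuousLinearMap.snd ℝ ℝ ℝ).comp (ContinuousLinearMap.snd ℝ F (ℝ × ℝ))
  B.bilinearComp p₁ p₁ + (ContinuousLinearMap.mul ℝ ℝ).bilinearComp p₂ p₃ +
    (ContinuousLinearMap.mul ℝ ℝ).bilinearComp p₃ p₂

theorem coneForm_apply (v w : F × ℝ × ℝ) :
    coneForm F v w = ⟪v.1, w.1⟫ + v.2.1 * w.2.2 + v.2.2 * w.2.1 :=
  rfl

theorem coneForm_symm (v w : F × ℝ × ℝ) : coneForm F v w = coneForm F w v := by
  rw [coneForm_apply, coneForm_apply, real_inner_comm]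
  ring

/-- The point of the light cone of `coneForm F` over `p` at height `l`. -/
noncomputable def conePoint (l : ℝ) (p : F) : F × ℝ × ℝ :=
  (l • p, l, (-1 / 2) * (l * ⟪p, p⟫))

theorem coneForm_conePoint (l : ℝ) (p : F) : coneForm F (conePoint l p) (conePoint l p) = 0 := by
  simp only [coneForm_apply, conePoint, real_inner_smul_left, real_inner_smul_right]
  ring

theorem isLorentz_coneForm {l : ℝ} (hl : l ≠ 0) (p : F) :
    IsLorentz (coneForm F).toBilinForm (-conePoint l p) where
  symm := coneForm_symm
  nondegenerate v hv := by
    have h1 := hv (v.1, 0, 0)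
    have h2 := hv (0, 1, 0)
    have h3 := hv (0, 0, 1)
    simp only [ContinuousLinearMap.toBilinForm_apply, coneForm_apply, inner_zero_right, mul_zero,
      add_zero, mul_one, zero_add, inner_self_eq_zero] at h1 h2 h3
    exact Prod.ext h1 (Prod.ext h3 h2)
  null := by
    change coneForm F (-conePoint l p) (-conePoint l p) = 0
    rw [map_neg, coneForm_symm, map_neg, coneForm_conePoint, neg_zero, neg_zero]
  exists_eq_smul := by
    rintro ⟨q, a, b⟩ h1 h2
    simp only [ContinuousLinearMap.toBilinForm_apply, coneForm_apply, conePoint, Prod.fst_neg,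
      Prod.snd_neg, inner_neg_right, real_inner_smul_right] at h1 h2
    have h3 : b = a / 2 * ⟪p, p⟫ - ⟪q, p⟫ := by
      have : l * (b - (a / 2 * ⟪p, p⟫ - ⟪q, p⟫)) = 0 := by linarith
      rcases mul_eq_zero.1 this with h | h
      · exact absurd h hl
      · exact sub_eq_zero.1 h
    have h4 : q - a • p = 0 := by
      rw [← inner_self_eq_zero (𝕜 := ℝ)]
      simp only [inner_sub_left, inner_sub_right, real_inner_smul_left, real_inner_smul_right,
        real_inner_comm q p]
      rw [h3] at h2
      linarith
    have h5 : q = a • p := sub_eq_zero.1 h4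
    refine ⟨-(a / l), ?_⟩
    simp only [conePoint, Prod.neg_mk, Prod.smul_mk, smul_neg, neg_smul, neg_neg, smul_smul,
      smul_eq_mul]
    rw [mul_neg, neg_neg, div_mul_cancel₀ _ hl]
    refine Prod.ext h5 (Prod.ext rfl ?_)
    change b = -(a / l * -(-1 / 2 * (l * ⟪p, p⟫)))
    rw [h3, h5, real_inner_smul_left]
    field_simp
    ring

variable {E : Type*} [NormedAddCommGroup E] [NormedSpace ℝ E]

/-- Terms containing derivatives of `l` cancel because `conePoint` is null, so the lift rescales the
induced metric by `l ^ 2` alone. With `l = φ⁻¹` it becomes isometric. -/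
theorem coneForm_fderiv_conePoint {l : E → ℝ} {f : E → F} {z : E} (hl : DifferentiableAt ℝ l z)
    (hf : DifferentiableAt ℝ f z) (a b : E) :
    coneForm F (fderiv ℝ (fun z ↦ conePoint (l z) (f z)) z a)
      (fderiv ℝ (fun z ↦ conePoint (l z) (f z)) z b) =
    l z ^ 2 * ⟪fderiv ℝ f z a, fderiv ℝ f z b⟫ := by
  have h1 : HasFDerivAt (fun z ↦ l z • f z) _ z := hl.hasFDerivAt.smul hf.hasFDerivAt
  have h2 : HasFDerivAt (fun z ↦ (-1 / 2 : ℝ) * (l z * ⟪f z, f z⟫)) _ z :=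
    (hl.hasFDerivAt.mul (hf.hasFDerivAt.inner ℝ hf.hasFDerivAt)).const_mul _
  have h3 : HasFDerivAt (fun z ↦ conePoint (l z) (f z)) _ z :=
    h1.prodMk (hl.hasFDerivAt.prodMk h2)
  rw [h3.fderiv]
  simp [coneForm_apply, inner_add_left, inner_add_right, real_inner_smul_right,
    real_inner_comm]
  ring

theorem ContDiffAt.conePoint {l : E → ℝ} {f : E → F} {z : E} {n : WithTop ℕ∞}
    (hl : ContDiffAt ℝ n l z) (hf : ContDiffAt ℝ n f z) :
    ContDiffAt ℝ n (fun z ↦ conePoint (l z) (f z)) z :=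
  (hl.smul hf).prodMk (hl.prodMk (contDiffAt_const.mul (hl.mul (hf.inner ℝ hf))))

/-- The second component of the lift gives `∂a ∂b l = 0`. The first then gives `l ∂a ∂b f = -(∂a l
∂b f + ∂b l ∂a f)`, which is tangent. -/
theorem fderiv_fderiv_mem_range {l : E → ℝ} {f : E → F} {y : E} (hl : ContDiffAt ℝ 2 l y)
    (hf : ContDiffAt ℝ 2 f y) (hy : l y ≠ 0) {a b : E}
    (h : fderiv ℝ (fderiv ℝ fun z ↦ conePoint (l z) (f z)) y a b = 0) :
    fderiv ℝ (fderiv ℝ f) y a b ∈ LinearMap.range (fderiv ℝ f y).toLinearMap := by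
  have h1 := fderiv_fderiv_clm_comp (ContinuousLinearMap.fst ℝ F (ℝ × ℝ)) (hl.conePoint hf) a b
  have h2 := fderiv_fderiv_clm_comp ((ContinuousLinearMap.fst ℝ ℝ ℝ).comp
    (ContinuousLinearMap.snd ℝ F (ℝ × ℝ))) (hl.conePoint hf) a b
  rw [h, map_zero] at h1 h2
  change fderiv ℝ (fderiv ℝ fun z ↦ l z • f z) y a b = 0 at h1
  change fderiv ℝ (fderiv ℝ l) y a b = 0 at h2
  rw [fderiv_fderiv_smul hl hf, h2, zero_smul, add_zero] at h1
  refine ⟨-(l y)⁻¹ • (fderiv ℝ l y a • b + fderiv ℝ l y b • a), ?_⟩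
  have h3 : fderiv ℝ (fderiv ℝ f) y a b = (l y)⁻¹ • (l y • fderiv ℝ (fderiv ℝ f) y a b) := by
    rw [smul_smul, inv_mul_cancel₀ hy, one_smul]
  have h4 : l y • fderiv ℝ (fderiv ℝ f) y a b =
      -(fderiv ℝ l y a • fderiv ℝ f y b + fderiv ℝ l y b • fderiv ℝ f y a) := by
    rw [add_assoc] at h1
    exact eq_neg_of_add_eq_zero_left h1
  rw [h3, h4]
  simp [add_comm]

end ConeLift

/-! ### Conformal immersions of products in coordinates -/

section ConformalProduct

open Module Filter Topology

set_option maxSynthPendingDepth 3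

variable {k : ℕ} {E : Fin (k + 1) → Type*}
  [∀ i, NormedAddCommGroup (E i)] [∀ i, NormedSpace ℝ (E i)] [∀ i, FiniteDimensional ℝ (E i)]
  {F : Type*} [NormedAddCommGroup F] [InnerProductSpace ℝ F] [FiniteDimensional ℝ F]

/-- The second fundamental form of a conformal immersion, with conformal factor `l⁻¹`, of a product of
metrics `G i` on open subsets of vector spaces is adapted to the product. -/
theorem fderiv_fderiv_mem_range_of_conformal {G : ∀ i, E i → E i →L[ℝ] E i →L[ℝ] ℝ}
    {l : (∀ i, E i) → ℝ} {f : (∀ i, E i) → F} {y : ∀ i, E i} (hl : ContDiffAt ℝ 3 l y)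
    (hf : ContDiffAt ℝ 3 f y) (hy : l y ≠ 0)
    (hiso : ∀ᶠ z in 𝓝 y, ∀ a b, l z ^ 2 * ⟪fderiv ℝ f z a, fderiv ℝ f z b⟫ =
      ∑ i, G i (z i) (a i) (b i))
    (hpos : ∀ i v, v ≠ 0 → 0 < G i (y i) v v)
    (hdim : finrank ℝ F = ∑ i, finrank ℝ (E i) + k)
    (h0 : ∃ u v, u ≠ 0 ∧ (∀ t : ℝ, v ≠ t • u) ∧
      G 0 (y 0) (chartCurvature (G 0) (y 0) u v v) u = 0)
    (hR : ∀ i, i ≠ 0 → ∃ u v, G i (y i) (chartCurvature (G i) (y i) u v v) u ≠ 0)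
    {i j : Fin (k + 1)} (hij : i ≠ j) (X : E i) (Y : E j) :
    fderiv ℝ (fderiv ℝ f) y (Pi.single i X) (Pi.single j Y) ∈
      LinearMap.range (fderiv ℝ f y).toLinearMap := by
  have hl2 : ContDiffAt ℝ 2 l y := hl.of_le (by norm_num)
  have hf2 : ContDiffAt ℝ 2 f y := hf.of_le (by norm_num)
  have himm : IsProductImmersionAt (coneForm F) G (fun z ↦ conePoint (l z) (f z)) y :=
    { symm := coneForm_symm
      contDiffAt := hl.conePoint hf
      isometric := by
        filter_upwards [hiso, hl2.eventually_differentiableAt, hf2.eventually_differentiableAt]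
          with z hz hz' hz'' a b
        rw [coneForm_fderiv_conePoint hz' hz'', hz]
      pos := hpos }
  refine fderiv_fderiv_mem_range hl2 hf2 hy (himm.fderiv_fderiv_eq_zero
    (Eventually.of_forall fun z ↦ coneForm_conePoint _ _) (isLorentz_coneForm hy _) ?_ h0 hR hij X Y)
  rw [finrank_prod, finrank_prod, finrank_self, hdim]

end ConformalProduct

/-! ## Charts -/

section Chart

open Filter Topology

variable {E H M : Type*} [NormedAddCommGroup E] [NormedSpace ℝ E] [TopologicalSpace H]
  (I : ModelWithCorners ℝ E H) [TopologicalSpace M] [ChartedSpace H M]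

/-- The tangent space at `x` is modelled through the preferred chart at `x`, in which this chart
reads as the identity. -/
theorem hasMFDerivAt_extChartAt_self (x : M) :
    HasMFDerivAt I 𝓘(ℝ, E) (extChartAt I x) x (ContinuousLinearMap.id ℝ E) := by
  refine ⟨continuousAt_extChartAt x, ?_⟩
  refine (hasFDerivWithinAt_id (𝕜 := ℝ) (extChartAt I x x) (range I)).congr_of_eventuallyEq ?_ ?_
  · filter_upwards [extChartAt_target_mem_nhdsWithin (I := I) x] with y hy
    exact writtenInExtChartAt_extChartAt hy
  · exact writtenInExtChartAt_extChartAt (mem_extChartAt_target x)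

theorem mfderiv_extChartAt_apply_self (x : M) (v : TangentSpace I x) :
    (mfderiv I 𝓘(ℝ, E) (extChartAt I x) x v : E) = v := by
  rw [(hasMFDerivAt_extChartAt_self I x).mfderiv]
  rfl

end Chart

/-! ### Sectional curvature and the curvature tensor in a chart -/

section SectionalCurvature

variable {E : Type*} [NormedAddCommGroup E] [NormedSpace ℝ E]
  {M : Type*} [TopologicalSpace M] [ChartedSpace E M] [IsManifold 𝓘(ℝ, E) ∞ M]
  (g : ContMDiffRiemannianMetric 𝓘(ℝ, E) ∞ E (fun p : M ↦ TangentSpace 𝓘(ℝ, E) p)) (x : M)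

theorem metricInChart_pos (v : E) (hv : v ≠ 0) :
    0 < metricInChart g x (extChartAt 𝓘(ℝ, E) x x) v v := by
  rw [metricInChart_apply]
  refine g.pos _ _ fun h ↦ hv ?_
  have : IsManifold 𝓘(ℝ, E) 1 M := IsManifold.of_le (n := ∞) (by simp)
  obtain ⟨e, he⟩ := isInvertible_mfderivWithin_extChartAt_symm (I := 𝓘(ℝ, E))
    (mem_extChartAt_target (I := 𝓘(ℝ, E)) x)
  rw [modelWithCornersSelf_coe, range_id, mfderivWithin_univ] at he
  rw [← he] at h
  exact e.injective (h.trans e.map_zero.symm)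

theorem metricInChart_symm (y u v : E) : metricInChart g x y u v = metricInChart g x y v u := by
  rw [metricInChart_apply, metricInChart_apply, g.symm]

theorem gram_pos {B : E →L[ℝ] E →L[ℝ] ℝ} (hB : ∀ u v, B u v = B v u)
    (hpos : ∀ v, v ≠ 0 → 0 < B v v) {u v : E} (huv : LinearIndependent ℝ ![u, v]) :
    0 < B u u * B v v - B u v ^ 2 := by
  have hu : u ≠ 0 := by simpa using huv.ne_zero 0
  have hw : B u u • v - B u v • u ≠ 0 := by
    intro h
    have h1 := LinearIndependent.pair_iff.1 huv (-B u v) (B u u) (by rw [← h]; module)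
    exact (hpos u hu).ne' h1.2
  have h1 := hpos _ hw
  have h2 : B (B u u • v - B u v • u) (B u u • v - B u v • u) =
      B u u * (B u u * B v v - B u v ^ 2) := by
    simp only [map_sub, map_smul, sub_apply, smul_apply, smul_eq_mul, hB v u]
    ring
  rw [h2] at h1
  exact (mul_pos_iff_of_pos_left (hpos u hu)).1 h1

theorem sectionalCurvature_eq_zero_iff {u v : E} (huv : LinearIndependent ℝ ![u, v]) :
    sectionalCurvature g x u v = 0 ↔ metricInChart g x (extChartAt 𝓘(ℝ, E) x x)
      (chartCurvature (metricInChart g x) (extChartAt 𝓘(ℝ, E) x x) u v v) u = 0 := by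
  have h : sectionalCurvature g x u v =
      chartSectionalCurvature (metricInChart g x) (extChartAt 𝓘(ℝ, E) x x) u v :=
    congrArg₂ (chartSectionalCurvature (metricInChart g x) (extChartAt 𝓘(ℝ, E) x x))
      (mfderiv_extChartAt_apply_self 𝓘(ℝ, E) x u) (mfderiv_extChartAt_apply_self 𝓘(ℝ, E) x v)
  rw [h, chartSectionalCurvature, div_eq_zero_iff]
  exact or_iff_left (gram_pos (metricInChart_symm g x _) (metricInChart_pos g x) huv).ne'

theorem HasFlatPlaneAt.exists_curvature_eq_zero (h : HasFlatPlaneAt g x) :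
    ∃ u v : E, u ≠ 0 ∧ (∀ t : ℝ, v ≠ t • u) ∧ metricInChart g x (extChartAt 𝓘(ℝ, E) x x)
      (chartCurvature (metricInChart g x) (extChartAt 𝓘(ℝ, E) x x) u v v) u = 0 := by
  obtain ⟨u, v, huv, h0⟩ := h
  have hu : u ≠ 0 := by simpa using huv.ne_zero 0
  exact ⟨u, v, hu, fun t ht ↦ (LinearIndependent.pair_iff' hu).1 huv t ht.symm,
    (sectionalCurvature_eq_zero_iff g x huv).1 h0⟩

theorem exists_curvature_ne_zero (h : ¬ IsFlatAt g x) :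
    ∃ u v : E, metricInChart g x (extChartAt 𝓘(ℝ, E) x x)
      (chartCurvature (metricInChart g x) (extChartAt 𝓘(ℝ, E) x x) u v v) u ≠ 0 := by
  simp only [IsFlatAt, not_forall] at h
  obtain ⟨u, v, huv, h0⟩ := h
  exact ⟨u, v, fun e ↦ h0 ((sectionalCurvature_eq_zero_iff g x huv).2 e)⟩

end SectionalCurvature

/-! ### The product chart and its derivative -/

section ProductChart

open Filter Topology

set_option maxSynthPendingDepth 3

variable {ι : Type*} [Fintype ι] {n : ι → ℕ} {M : ι → Type*} [∀ i, TopologicalSpace (M i)]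
  [∀ i, ChartedSpace (EuclideanSpace ℝ (Fin (n i))) (M i)]

theorem range_productModel : range (productModel n) = univ :=
  range_eq_univ.2 fun z ↦ ⟨z, rfl⟩

theorem eventually_mem_extChartAt_target (x : ∀ i, M i) :
    ∀ᶠ z in 𝓝 (extChartAt (productModel n) x x), ∀ i,
      z i ∈ (extChartAt 𝓘(ℝ, EuclideanSpace ℝ (Fin (n i))) (x i)).target :=
  eventually_all.2 fun i ↦ (continuous_apply i).continuousAt.eventually
    (extChartAt_target_mem_nhds (I := 𝓘(ℝ, EuclideanSpace ℝ (Fin (n i)))) (x i))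

theorem contDiffAt_comp_extChartAt_symm {F : Type*} [NormedAddCommGroup F] [NormedSpace ℝ F]
    {f : (∀ i, M i) → F} {m : WithTop ℕ∞} (hf : ContMDiff (productModel n) 𝓘(ℝ, F) m f)
    (x : ∀ i, M i) :
    ContDiffAt ℝ m (f ∘ (extChartAt (productModel n) x).symm) (extChartAt (productModel n) x x) := by
  have h := (contMDiffAt_iff.1 (hf x)).2
  rw [range_productModel, contDiffWithinAt_univ] at h
  exact h

variable [∀ i, IsManifold 𝓘(ℝ, EuclideanSpace ℝ (Fin (n i))) ∞ (M i)]

/-- The derivative of the inverse of the chart of a product at `x`. -/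
noncomputable def chartSymmDeriv (x : ∀ i, M i) (z : ∀ i, EuclideanSpace ℝ (Fin (n i))) :
    (∀ i, EuclideanSpace ℝ (Fin (n i))) →L[ℝ] ∀ i, EuclideanSpace ℝ (Fin (n i)) :=
  ContinuousLinearMap.pi fun i ↦
    (mfderiv 𝓘(ℝ, EuclideanSpace ℝ (Fin (n i))) 𝓘(ℝ, EuclideanSpace ℝ (Fin (n i)))
      (extChartAt 𝓘(ℝ, EuclideanSpace ℝ (Fin (n i))) (x i)).symm (z i) :
        EuclideanSpace ℝ (Fin (n i)) →L[ℝ] EuclideanSpace ℝ (Fin (n i))).comp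
      (ContinuousLinearMap.proj i)

theorem hasMFDerivAt_extChartAt_symm (x : ∀ i, M i) {z : ∀ i, EuclideanSpace ℝ (Fin (n i))}
    (hz : ∀ i, z i ∈ (extChartAt 𝓘(ℝ, EuclideanSpace ℝ (Fin (n i))) (x i)).target) :
    HasMFDerivAt 𝓘(ℝ, ∀ i, EuclideanSpace ℝ (Fin (n i))) (productModel n)
      (extChartAt (productModel n) x).symm z (chartSymmDeriv x z) := by
  have h : ∀ i, HasMFDerivAt 𝓘(ℝ, EuclideanSpace ℝ (Fin (n i)))
      𝓘(ℝ, EuclideanSpace ℝ (Fin (n i)))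
      (extChartAt 𝓘(ℝ, EuclideanSpace ℝ (Fin (n i))) (x i)).symm (z i)
      (mfderiv 𝓘(ℝ, EuclideanSpace ℝ (Fin (n i))) 𝓘(ℝ, EuclideanSpace ℝ (Fin (n i)))
        (extChartAt 𝓘(ℝ, EuclideanSpace ℝ (Fin (n i))) (x i)).symm (z i)) := by
    intro i
    have : IsManifold 𝓘(ℝ, EuclideanSpace ℝ (Fin (n i))) 1 (M i) :=
      IsManifold.of_le (n := ∞) (by simp)
    have h1 := mdifferentiableWithinAt_extChartAt_symm (hz i)
    rw [modelWithCornersSelf_coe, range_id, mdifferentiableWithinAt_univ] at h1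
    exact h1.hasMFDerivAt
  refine ⟨continuousAt_pi.2 fun i ↦ (h i).1.comp (f := fun z : ∀ i, EuclideanSpace ℝ (Fin (n i)) ↦
    z i) (continuous_apply i).continuousAt, ?_⟩
  refine hasFDerivWithinAt_pi.2 fun i ↦ ?_
  have h0 := (h i).2
  rw [modelWithCornersSelf_coe, range_id] at h0
  have h1 : HasFDerivAt (writtenInExtChartAt 𝓘(ℝ, EuclideanSpace ℝ (Fin (n i)))
      𝓘(ℝ, EuclideanSpace ℝ (Fin (n i))) (z i)
      (extChartAt 𝓘(ℝ, EuclideanSpace ℝ (Fin (n i))) (x i)).symm)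
      (mfderiv 𝓘(ℝ, EuclideanSpace ℝ (Fin (n i))) 𝓘(ℝ, EuclideanSpace ℝ (Fin (n i)))
        (extChartAt 𝓘(ℝ, EuclideanSpace ℝ (Fin (n i))) (x i)).symm (z i) :
          EuclideanSpace ℝ (Fin (n i)) →L[ℝ] EuclideanSpace ℝ (Fin (n i))) (z i) :=
    hasFDerivWithinAt_univ.1 h0
  exact (h1.comp z (ContinuousLinearMap.proj (R := ℝ)
    (φ := fun i ↦ EuclideanSpace ℝ (Fin (n i))) i).hasFDerivAt).hasFDerivWithinAt

theorem fderiv_comp_extChartAt_symm {F : Type*} [NormedAddCommGroup F] [NormedSpace ℝ F]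
    {f : (∀ i, M i) → F} (hf : MDifferentiable (productModel n) 𝓘(ℝ, F) f) (x : ∀ i, M i)
    {z : ∀ i, EuclideanSpace ℝ (Fin (n i))}
    (hz : ∀ i, z i ∈ (extChartAt 𝓘(ℝ, EuclideanSpace ℝ (Fin (n i))) (x i)).target)
    (a : ∀ i, EuclideanSpace ℝ (Fin (n i))) :
    fderiv ℝ (f ∘ (extChartAt (productModel n) x).symm) z a =
      mfderiv (productModel n) 𝓘(ℝ, F) f ((extChartAt (productModel n) x).symm z)
        (chartSymmDeriv x z a) := by
  have h := (hf ((extChartAt (productModel n) x).symm z)).hasMFDerivAt.comp z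
    (hasMFDerivAt_extChartAt_symm x hz)
  obtain ⟨A, hA⟩ : ∃ A : (∀ i, EuclideanSpace ℝ (Fin (n i))) →L[ℝ] F, A =
      mfderiv (productModel n) 𝓘(ℝ, F) f ((extChartAt (productModel n) x).symm z) := ⟨_, rfl⟩
  rw [← hA] at h
  have h1 : HasFDerivAt (f ∘ (extChartAt (productModel n) x).symm) (A.comp (chartSymmDeriv x z)) z :=
    hasMFDerivAt_iff_hasFDerivAt.1 h
  rw [h1.fderiv, ← hA]
  rfl

end ProductChart

/-! ### The theorem on manifolds -/

section MainTheorem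

open Module Filter Topology

set_option maxSynthPendingDepth 3

theorem mainTheorem5 {k : ℕ} (n : Fin (k + 1) → ℕ) (hn : ∀ i, 2 ≤ n i)
    (M : Fin (k + 1) → Type*) [∀ i, TopologicalSpace (M i)]
    [∀ i, ChartedSpace (EuclideanSpace ℝ (Fin (n i))) (M i)]
    [∀ i, IsManifold 𝓘(ℝ, EuclideanSpace ℝ (Fin (n i))) ∞ (M i)]
    (g : ∀ i, ContMDiffRiemannianMetric 𝓘(ℝ, EuclideanSpace ℝ (Fin (n i))) ∞
      (EuclideanSpace ℝ (Fin (n i)))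
      (fun p : M i ↦ TangentSpace 𝓘(ℝ, EuclideanSpace ℝ (Fin (n i))) p))
    (f : (∀ i, M i) → EuclideanSpace ℝ (Fin ((∑ i, n i) + k)))
    (hf : IsConformalImmersion g f) (x : ∀ i, M i)
    (h_zero : HasFlatPlaneAt (g 0) (x 0))
    (h_nonflat : ∀ i, i ≠ 0 → ¬ IsFlatAt (g i) (x i)) :
    IsAdaptedAt (n := n) f x := by
  obtain ⟨hfs, φ, hφ, hφpos, hconf⟩ := hf
  intro i j hij X Y hX hY
  set y := extChartAt (productModel n) x x
  set ψ : (∀ i, EuclideanSpace ℝ (Fin (n i))) → ∀ i, M i :=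
    ⇑(extChartAt (productModel n) x).symm
  have hψy : ψ y = x := extChartAt_to_inv x
  have hmd : MDifferentiable (productModel n) 𝓘(ℝ, EuclideanSpace ℝ (Fin ((∑ i, n i) + k))) f :=
    hfs.mdifferentiable (by simp)
  have hle : (3 : WithTop ℕ∞) ≤ ∞ := WithTop.coe_le_coe.2 (le_top : (3 : ℕ∞) ≤ ⊤)
  have hu : ContDiffAt ℝ 3 (f ∘ ψ) y :=
    (contDiffAt_comp_extChartAt_symm hfs x).of_le hle
  have hl : ContDiffAt ℝ 3 (fun z ↦ (φ (ψ z))⁻¹) y :=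
    ((contDiffAt_comp_extChartAt_symm hφ x).of_le hle).inv
      (hφpos _).ne'
  have htarget := eventually_mem_extChartAt_target (n := n) x
  have hmem : fderiv ℝ (fderiv ℝ (f ∘ ψ)) y (Pi.single i (tangentComponent x X i))
      (Pi.single j (tangentComponent x Y j)) ∈
        LinearMap.range (fderiv ℝ (f ∘ ψ) y).toLinearMap := by
    refine fderiv_fderiv_mem_range_of_conformal (G := fun i ↦ metricInChart (g i) (x i)) hl hu
      (inv_ne_zero (hφpos _).ne') ?_ (fun i ↦ metricInChart_pos (g i) (x i)) ?_
      h_zero.exists_curvature_eq_zero (fun i hi ↦ exists_curvature_ne_zero _ _ (h_nonflat i hi))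
      hij _ _
    -- The inverse product chart differentiates factorwise, so it pulls the product metric back to
    -- the sum of the chart metrics; `l = φ⁻¹` cancels the conformal factor.
    · filter_upwards [htarget] with z hz a b
      rw [fderiv_comp_extChartAt_symm hmd x hz, fderiv_comp_extChartAt_symm hmd x hz]
      have h1 := hconf (ψ z) (chartSymmDeriv x z a) (chartSymmDeriv x z b)
      have h2 : (φ (ψ z))⁻¹ ^ 2 * φ (ψ z) ^ 2 = 1 := by
        rw [← mul_pow, inv_mul_cancel₀ (hφpos _).ne', one_pow]
      refine (congrArg ((φ (ψ z))⁻¹ ^ 2 * ·) h1).trans ?_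
      rw [← mul_assoc, h2, one_mul]
      rfl
    · simp
  have hrange : LinearMap.range (fderiv ℝ (f ∘ ψ) y).toLinearMap ≤
      tangentImage (productModel n) f x := by
    rintro _ ⟨a, rfl⟩
    have h1 := fderiv_comp_extChartAt_symm hmd x htarget.self_of_nhds a
    have h2 : tangentImage (productModel n) f (ψ y) = tangentImage (productModel n) f x := by
      rw [hψy]
    rw [← h2]
    exact ⟨_, h1.symm⟩
  have hsingle : ∀ (l : Fin (k + 1)) (Z : TangentSpace (productModel n) x),
      (∀ m, m ≠ l → tangentComponent x Z m = 0) →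
      (mfderiv (productModel n) 𝓘(ℝ, ∀ i, EuclideanSpace ℝ (Fin (n i)))
        (extChartAt (productModel n) x) x Z : ∀ i, EuclideanSpace ℝ (Fin (n i))) =
      Pi.single l (tangentComponent x Z l) := by
    intro l Z hZ
    refine (mfderiv_extChartAt_apply_self (productModel n) x Z).trans (funext fun m ↦ ?_)
    by_cases hm : m = l
    · subst hm
      exact (Pi.single_eq_same (M := fun i ↦ EuclideanSpace ℝ (Fin (n i))) m _).symm
    · exact (hZ m hm).trans
        (Pi.single_eq_of_ne (M := fun i ↦ EuclideanSpace ℝ (Fin (n i))) hm _).symm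
  have hproj : (tangentImage (productModel n) f x)ᗮ.starProjection
      (fderiv ℝ (fderiv ℝ (f ∘ ψ)) y (Pi.single i (tangentComponent x X i))
        (Pi.single j (tangentComponent x Y j))) = 0 := by
    rw [Submodule.starProjection_apply_eq_zero_iff, Submodule.orthogonal_orthogonal]
    exact hrange hmem
  have h3 := congrArg₂ (fun a b ↦ (tangentImage (productModel n) f x)ᗮ.starProjection
    (fderiv ℝ (fderiv ℝ (f ∘ ψ)) y a b)) (hsingle i X hX) (hsingle j Y hY)
  exact h3.trans hproj

end MainTheorem
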